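/- There is an absolute constant $C>0$ such that the following holds for all integers $D\ge 1$ and $\ell\ge 1$, with $n=\ell^D$ (so $n^{1/D}=\ell$). Place one qubit on each vertex of the $D$-dimensional grid, i.e. the Cartesian product of $D$ line graphs with $n^{1/D}$ vertices each. A circuit of depth $d$ on the grid is a sequence of $d$ layers, each consisting of arbitrary unitary gates on pairwise disjoint sets that are single vertices or pairs of adjacent vertices; no auxiliary qubits are used. Then there are an integer $d\le C\,D\,n^{1/D}$ and a probability measure $\mu$ on the unitary group of the $n$ qubits such that $\mu$-almost every $U$ is implemented by a circuit of depth at most $d$ on the grid, and $\mu$ is a design with measurable error at most $$\varepsilon = 2(n+1)\,e^{-n^{1/D}\log(2)/3}$$ against experiments that make one query of $U$ or $U^T$ and one query of $\bar U$ or $U^\dagger$, in the following sense. For every number $m\ge 0$ of auxiliary qubits, all unitaries $W_0,W_1,W_2$ on the $n+m$ qubits, all choices of queries $V_1,V_2$ of which one (in either order) is $U$ or $U^T$ and the other is $\bar U$ or $U^\dagger$, and every observable $0\le O\le 1$, the output state $$|\mathcal A^U\rangle = W_2\,(V_2\otimes 1)\,W_1\,(V_1\otimes 1)\,W_0\,|0^{n+m}\rangle$$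 satisfies $$\Big|\,\mathbb E_{U\sim\mu}\operatorname{Tr}\big[O\,|\mathcal A^U\rangle\langle\mathcal A^U|\big]-\mathbb E_{U\sim \mathrm{Haar}}\operatorname{Tr}\big[O\,|\mathcal A^U\rangle\langle\mathcal A^U|\big]\Big|\le\varepsilon ;$$ equivalently, the averaged output states are $\varepsilon$-close in trace distance. -/

import Mathlib

open MeasureTheory
open scoped Kronecker ComplexOrder

noncomputable section

/-! ## Qubits and unitaries

The qubits are labelled by a finite type `V`; the computational basis of their Hilbert space is
`V → Fin 2`. -/

/-- Computational basis labels of a register of qubits labelled by `V`. -/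
abbrev Basis01 (V : Type) : Type := V → Fin 2

/-- The unitary group of the space with orthonormal basis labelled by `ι`. -/
abbrev UGroup (ι : Type) [Fintype ι] [DecidableEq ι] : Type := ↥(Matrix.unitaryGroup ι ℂ)

section Haar

variable (ι : Type) [Fintype ι] [DecidableEq ι]

instance UGroup.instMeasurableSpace : MeasurableSpace (UGroup ι) := borel (UGroup ι)

instance UGroup.instBorelSpace : BorelSpace (UGroup ι) := ⟨rfl⟩

instance UGroup.instCompactSpace : CompactSpace (UGroup ι) := by
  have hclosed : IsClosed (Matrix.unitaryGroup ι ℂ : Set (Matrix ι ι ℂ)) :=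
    isClosed_unitary (R := Matrix ι ι ℂ)
  have hK : IsCompact ({M : Matrix ι ι ℂ | ∀ i j, M i j ∈ Metric.closedBall (0 : ℂ) 1}) := by
    have h := isCompact_univ_pi (fun _ : ι =>
      isCompact_univ_pi (fun _ : ι => isCompact_closedBall (0 : ℂ) 1))
    refine (Eq.subst (motive := fun S => IsCompact S) ?_ h : IsCompact
      ({M : ι → ι → ℂ | ∀ i j, M i j ∈ Metric.closedBall (0 : ℂ) 1}))
    ext M
    simp only [Set.mem_setOf_eq, Set.mem_pi, Set.mem_univ, true_implies]
  have hsub : (Matrix.unitaryGroup ι ℂ : Set (Matrix ι ι ℂ)) ⊆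
      {M : Matrix ι ι ℂ | ∀ i j, M i j ∈ Metric.closedBall (0 : ℂ) 1} := by
    intro M hM i j
    simpa using entry_norm_bound_of_unitary hM i j
  exact isCompact_iff_compactSpace.mp (hK.of_isClosed_subset hclosed hsub)

/-- The Haar probability measure on the unitary group. -/
def haarUnitary : Measure (UGroup ι) := Measure.haarMeasure ⊤

end Haar

/-! ## Circuits on a connectivity graph -/

section Circuits

variable {V : Type} [Fintype V] [DecidableEq V]

/-- A gate that may be applied on the connectivity graph `G`: an arbitrary unitary on a single
qubit, or on the two endpoints of an edge. -/
structure Gate (G : SimpleGraph V) where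
  /-- the qubits on which the gate acts -/
  support : Finset V
  isLocal : (∃ v, support = {v}) ∨ ∃ u v, G.Adj u v ∧ support = {u, v}
  /-- the unitary that is applied to these qubits -/
  op : UGroup (Basis01 support)

/-- The action of a gate on all qubits: `op` on the support, tensored with the identity on all
other qubits. -/
def Gate.toMatrix {G : SimpleGraph V} (g : Gate G) : Matrix (Basis01 V) (Basis01 V) ℂ :=
  fun x y =>
    if ∀ w, w ∉ g.support → x w = y w then
      (g.op : Matrix (Basis01 g.support) (Basis01 g.support) ℂ) (fun w => x w) (fun w => y w)
    else 0

/-- A circuit on the connectivity graph `G` (without auxiliary qubits): a sequence of layers, each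
of which consists of gates with pairwise disjoint supports. -/
structure Circuit (G : SimpleGraph V) where
  layers : List (List (Gate G))
  disjoint : ∀ L ∈ layers, L.Pairwise (fun g h => Disjoint g.support h.support)

/-- The depth of a circuit is its number of layers. -/
def Circuit.depth {G : SimpleGraph V} (c : Circuit G) : ℕ := c.layers.length

/-- The operator that a circuit implements (the last layer of the list acts first). -/
def Circuit.toMatrix {G : SimpleGraph V} (c : Circuit G) : Matrix (Basis01 V) (Basis01 V) ℂ :=
  (c.layers.map (fun L => (L.map Gate.toMatrix).prod)).prod

/-- `U` is implemented by a circuit of depth at most `d` on the connectivity graph `G`. -/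
def HasCircuitDepth (G : SimpleGraph V) (d : ℕ) (U : UGroup (Basis01 V)) : Prop :=
  ∃ c : Circuit G, c.depth ≤ d ∧ c.toMatrix = (U : Matrix (Basis01 V) (Basis01 V) ℂ)

end Circuits

/-- The `D`-dimensional grid of side length `ℓ`: the Cartesian product of `D` line graphs with `ℓ`
vertices. Two vertices are adjacent if they are neighbours on the line in one coordinate and agree
in all the other coordinates. -/
def gridGraph (D ℓ : ℕ) : SimpleGraph (Fin D → Fin ℓ) where
  Adj u v := ∃ i, (SimpleGraph.pathGraph ℓ).Adj (u i) (v i) ∧ ∀ j, j ≠ i → u j = v j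
  symm := ⟨by
    rintro u v ⟨i, hi, h⟩
    exact ⟨i, hi.symm, fun j hj => (h j hj).symm⟩⟩
  loopless := ⟨by
    rintro u ⟨i, hi, -⟩
    exact (SimpleGraph.pathGraph ℓ).irrefl hi⟩

/-! ## Experiments with two queries -/

/-- The four ways in which an experiment may query a unitary `U`. -/
inductive Query
  | direct
  | transpose
  | conj
  | adjoint

/-- The operator applied by a query: `U`, `Uᵀ`, `Ū` or `U†`. -/
def Query.apply {ι : Type} (q : Query) (U : Matrix ι ι ℂ) : Matrix ι ι ℂ :=
  match q with
  | .direct => U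
  | .transpose => U.transpose
  | .conj => U.map star
  | .adjoint => U.conjTranspose

/-- The query is `U` or `Uᵀ`. -/
def Query.IsForward (q : Query) : Prop := q = .direct ∨ q = .transpose

/-- The query is `Ū` or `U†`. -/
def Query.IsBackward (q : Query) : Prop := q = .conj ∨ q = .adjoint

section Experiments

variable (V : Type) [Fintype V] [DecidableEq V]

/-- An experiment that queries a unitary on the qubits `V` twice: it uses `m` auxiliary qubits, and
applies the unitaries `W₀`, `W₁`, `W₂` before, between and after the queries `q₁` and `q₂`. -/
structure Experiment where
  m : ℕ
  W₀ : UGroup (Basis01 V × Basis01 (Fin m))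
  W₁ : UGroup (Basis01 V × Basis01 (Fin m))
  W₂ : UGroup (Basis01 V × Basis01 (Fin m))
  q₁ : Query
  q₂ : Query

variable {V}

/-- The experiment makes one query of `U` or `Uᵀ` and one query of `Ū` or `U†`, in either order. -/
def Experiment.IsMixed (A : Experiment V) : Prop :=
  (A.q₁.IsForward ∧ A.q₂.IsBackward) ∨ (A.q₁.IsBackward ∧ A.q₂.IsForward)

/-- The output state `W₂ (V₂ ⊗ 1) W₁ (V₁ ⊗ 1) W₀ |0⋯0⟩`, where `V₁`, `V₂` are the queried
operators. -/
def Experiment.output (A : Experiment V) (U : UGroup (Basis01 V)) :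
    Basis01 V × Basis01 (Fin A.m) → ℂ :=
  ((A.W₂ : Matrix (Basis01 V × Basis01 (Fin A.m)) (Basis01 V × Basis01 (Fin A.m)) ℂ)
      * (A.q₂.apply (U : Matrix (Basis01 V) (Basis01 V) ℂ)
          ⊗ₖ (1 : Matrix (Basis01 (Fin A.m)) (Basis01 (Fin A.m)) ℂ))
      * (A.W₁ : Matrix (Basis01 V × Basis01 (Fin A.m)) (Basis01 V × Basis01 (Fin A.m)) ℂ)
      * (A.q₁.apply (U : Matrix (Basis01 V) (Basis01 V) ℂ)
          ⊗ₖ (1 : Matrix (Basis01 (Fin A.m)) (Basis01 (Fin A.m)) ℂ))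
      * (A.W₀ : Matrix (Basis01 V × Basis01 (Fin A.m)) (Basis01 V × Basis01 (Fin A.m)) ℂ)).mulVec
    (Pi.single (fun _ => 0, fun _ => 0) 1)

/-- The expected value `Tr[O |A^U⟩⟨A^U|]` of the observable `O` in the output state. -/
def Experiment.expect (A : Experiment V)
    (O : Matrix (Basis01 V × Basis01 (Fin A.m)) (Basis01 V × Basis01 (Fin A.m)) ℂ)
    (U : UGroup (Basis01 V)) : ℂ :=
  (O * Matrix.vecMulVec (A.output U) (star (A.output U))).trace

/-- The ensemble `μ` is a design, with measurable error at most `ε`, with respect to experiments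
that make one query of `U` or `Uᵀ` and one query of `Ū` or `U†`: for every observable
`0 ≤ O ≤ 1` the expected outcome is `ε`-close to that for a Haar-random unitary, that is, the
averaged output states are `ε`-close in trace distance. -/
def IsMixedQueryDesign (μ : Measure (UGroup (Basis01 V))) (ε : ℝ) : Prop :=
  ∀ A : Experiment V, A.IsMixed →
    ∀ O : Matrix (Basis01 V × Basis01 (Fin A.m)) (Basis01 V × Basis01 (Fin A.m)) ℂ,
      O.PosSemidef → (1 - O).PosSemidef →
        ‖(∫ U, A.expect O U ∂μ) - ∫ U, A.expect O U ∂(haarUnitary (Basis01 V))‖ ≤ ε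

end Experiments

end

/-!
The design is a random Clifford circuit with random Pauli operators on either side. Pauli operators
on the qubits `V` are labelled by `Lab V`, pairs of bits at each qubit, and a Clifford circuit
permutes the labels up to signs.

*Reduction to labels.* For a unitary `U`, the numbers `‖chi U P Q‖ ^ 2`, the squared entries of the
matrix of `U` acting by conjugation on normalized Pauli operators, are doubly stochastic, and `0`
(the identity) is decoupled from the other labels. If `U` stands between independent random Pauli
operators, then only these numbers matter: the outcome of an experiment with one query of `U` or
`Uᵀ` and one query of `Ū` or `U†` is `∑ P Q, ‖chi U P Q‖ ^ 2 * φ P Q`, where `φ` is non-negative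
and bounded by a weight of total mass one that depends on one of the two labels only
(`exists_twirl_form`). Multiplying `U` by a Clifford unitary permutes the other label. Hence if a
random Clifford unitary `C`, and also its inverse, maps each non-zero label to a label that is
uniform up to an error `ε`, then the average over `C * U` or `U * C` is `ε`-close to a constant
independent of `U`. Taking `U = 1` and averaging over Haar-random `U` bounds the distance of the two
expectations by `2 * ε` (`norm_expect_sub_integral_haar_le`). The condition on the inverse is met by
the product of one random circuit and the inverse of an independent one.

*Circuits.* An odd-even transposition network on a line of `ℓ` qubits, run for `2 * ℓ` steps,
returns all qubits to their places after letting each pair of them meet. With controlled-`Z` gates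
at the meetings and phase gates it adds to the `Z` exponents an arbitrary symmetric matrix applied
to the `X` exponents (`exists_cliffordDepth_shear`). A uniformly random symmetric matrix over the
field with two elements maps a non-zero vector to a uniformly random vector (`expect_shear`).
Conjugation with Hadamard gates gives the same step with the exponents exchanged. A step on the `Z`
exponents followed by one on the `X` exponents, on all lines in a direction, is `lineAvg`.

*Mixing.* These steps are applied in the directions `m, …, 1, 0, 0, 1, …, m`. By induction on `m`,
this makes every label nearly uniform on the union of those slabs spanned by the directions
`0, …, m` on which it is not zero (`abs_sweepAvg_sub_le`). In the induction step, the first pair of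
steps in direction `m + 1` makes the `X` exponents on each line that meets the support of the label
random, so that the sweep in the lower directions randomizes about half of the sites of each line
of the slab. The last pair of steps then makes the whole slab uniform, unless the `X` exponents
vanish on one of its lines. Each site lies on such a line with a probability of order `(3 / 4) ^ ℓ`,
and the union bound over the `ℓ ^ D / ℓ` lines in each of the `D` directions gives the error, which
is below the claimed one whenever the latter is less than one (`one_le_or_stepError_le`).
-/

open scoped BigOperators Matrix

noncomputable section

set_option linter.unusedSectionVars false

namespace PauliMixing

/-! ### Pauli operators -/

/-- A bit of the computational basis, read as an element of the field with two elements. -/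
def bit (i : Fin 2) : ZMod 2 := i

/-- The entries of the real single-qubit Pauli matrix `X ^ p.1 * Z ^ p.2`. -/
def pauliEntry (p : ZMod 2 × ZMod 2) (i j : Fin 2) : ℤ :=
  if bit i = bit j + p.1 then (if p.2 = 1 ∧ j = 1 then -1 else 1) else 0

/-- The sign by which the single-qubit Pauli matrices with labels `r` and `p` commute. -/
def siteSign (r p : ZMod 2 × ZMod 2) : ℤ := if r.1 * p.2 + r.2 * p.1 = 0 then 1 else -1

lemma pauliEntry_complete : ∀ b d b' d' : Fin 2,
    ∑ p, pauliEntry p b d * pauliEntry p b' d' = if b = b' ∧ d = d' then 2 else 0 := by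
  decide

lemma pauliEntry_mul_transpose : ∀ (p : ZMod 2 × ZMod 2) (i k : Fin 2),
    ∑ j, pauliEntry p i j * pauliEntry p k j = if i = k then 1 else 0 := by
  decide

lemma pauliEntry_conj : ∀ (r p : ZMod 2 × ZMod 2) (i k : Fin 2),
    ∑ j, ∑ l, pauliEntry r j i * pauliEntry p j l * pauliEntry r l k
      = siteSign r p * pauliEntry p i k := by
  decide

lemma pauliEntry_orthogonal : ∀ p q : ZMod 2 × ZMod 2,
    ∑ i, ∑ j, pauliEntry p i j * pauliEntry q i j = if p = q then 2 else 0 := by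
  decide

lemma siteSign_orthogonal : ∀ p q : ZMod 2 × ZMod 2,
    ∑ r, siteSign r p * siteSign r q = if p = q then 4 else 0 := by
  decide

lemma pauliEntry_zero : ∀ i j : Fin 2, pauliEntry 0 i j = if i = j then 1 else 0 := by
  decide

/-- Labels of the Pauli operators on the qubits `V`: the exponents of `X` and of `Z` on each
qubit. -/
abbrev Lab (V : Type) : Type := V → ZMod 2 × ZMod 2

variable {V : Type} [Fintype V] [DecidableEq V]

/-- The tensor product of matrices that act on single qubits. -/
def tensor (A : V → Matrix (Fin 2) (Fin 2) ℂ) : Matrix (Basis01 V) (Basis01 V) ℂ :=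
  fun x y => ∏ w, A w (x w) (y w)

lemma tensor_mul (A B : V → Matrix (Fin 2) (Fin 2) ℂ) :
    tensor A * tensor B = tensor (fun w => A w * B w) := by
  ext x y
  simp only [tensor, Matrix.mul_apply, Fintype.prod_sum, ← Finset.prod_mul_distrib]

lemma tensor_one : tensor (fun _ : V => (1 : Matrix (Fin 2) (Fin 2) ℂ)) = 1 := by
  ext x y
  simp only [tensor, Matrix.one_apply, Finset.prod_ite_zero, Finset.prod_const_one, funext_iff,
    Finset.mem_univ, true_implies]

/-- The single-qubit Pauli matrix `X ^ p.1 * Z ^ p.2`. -/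
def sitePauli (p : ZMod 2 × ZMod 2) : Matrix (Fin 2) (Fin 2) ℂ := fun i j => (pauliEntry p i j : ℂ)

/-- The Pauli operator with label `v`. All its entries are real. -/
def pauli (v : Lab V) : Matrix (Basis01 V) (Basis01 V) ℂ := tensor (fun w => sitePauli (v w))

lemma pauli_apply (v : Lab V) (x y : Basis01 V) :
    pauli v x y = ∏ w, (pauliEntry (v w) (x w) (y w) : ℂ) := rfl

lemma pauli_zero : pauli (0 : Lab V) = 1 := by
  have h : sitePauli 0 = 1 := by
    ext i j
    simp only [sitePauli, pauliEntry_zero, Matrix.one_apply]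
    split_ifs <;> simp
  simp only [pauli, Pi.zero_apply, h, tensor_one]

lemma star_pauli_apply (v : Lab V) (x y : Basis01 V) : star (pauli v x y) = pauli v x y := by
  simp [pauli_apply]

lemma conjTranspose_pauli (v : Lab V) : (pauli v)ᴴ = (pauli v)ᵀ := by
  ext x y
  simp only [Matrix.conjTranspose_apply, Matrix.transpose_apply, star_pauli_apply]

lemma sitePauli_mul_transpose (p : ZMod 2 × ZMod 2) : sitePauli p * (sitePauli p)ᵀ = 1 := by
  ext i k
  have := pauliEntry_mul_transpose p i k
  simp only [Matrix.mul_apply, Matrix.transpose_apply, sitePauli, Matrix.one_apply]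
  exact_mod_cast this

lemma transpose_tensor (A : V → Matrix (Fin 2) (Fin 2) ℂ) :
    (tensor A)ᵀ = tensor (fun w => (A w)ᵀ) := rfl

lemma pauli_mul_transpose (v : Lab V) : pauli v * (pauli v)ᵀ = 1 := by
  simp only [pauli, transpose_tensor, tensor_mul, sitePauli_mul_transpose, tensor_one]

lemma pauli_mem_unitary (v : Lab V) : pauli v ∈ Matrix.unitaryGroup (Basis01 V) ℂ := by
  rw [Matrix.mem_unitaryGroup_iff, Matrix.star_eq_conjTranspose, conjTranspose_pauli,
    pauli_mul_transpose]

/-- A Pauli operator as an element of the unitary group. -/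
def pauliU (v : Lab V) : UGroup (Basis01 V) := ⟨pauli v, pauli_mem_unitary v⟩

/-- The sign by which the Pauli operators with labels `r` and `p` commute. -/
def labSign (r p : Lab V) : ℂ := ∏ w, (siteSign (r w) (p w) : ℂ)

lemma star_labSign (r p : Lab V) : star (labSign r p) = labSign r p := by
  simp [labSign]

lemma transpose_pauli_mul_pauli_mul (r p : Lab V) :
    (pauli r)ᵀ * pauli p * pauli r = labSign r p • pauli p := by
  have h : ∀ a b : ZMod 2 × ZMod 2,
      (sitePauli a)ᵀ * sitePauli b * sitePauli a = (siteSign a b : ℂ) • sitePauli b := by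
    intro a b
    ext i k
    have := pauliEntry_conj a b i k
    rw [Finset.sum_comm] at this
    simp only [Matrix.mul_apply, Matrix.transpose_apply, sitePauli, Matrix.smul_apply,
      smul_eq_mul, Finset.sum_mul]
    exact_mod_cast this
  simp only [pauli, transpose_tensor, tensor_mul, h]
  ext x y
  simp [tensor, labSign, Finset.prod_mul_distrib]

lemma pauli_mul_pauli_mul_transpose (r p : Lab V) :
    pauli r * pauli p * (pauli r)ᵀ = labSign r p • pauli p := by
  have h1 : labSign r p * labSign r p = 1 := by
    simp only [labSign, ← Finset.prod_mul_distrib]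
    refine Finset.prod_eq_one fun w _ => ?_
    unfold siteSign
    split_ifs <;> simp
  have h2 := transpose_pauli_mul_pauli_mul r p
  calc pauli r * pauli p * (pauli r)ᵀ
      = labSign r p • (pauli r * (labSign r p • pauli p) * (pauli r)ᵀ) := by
        rw [Matrix.mul_smul, Matrix.smul_mul, smul_smul, h1, one_smul]
    _ = labSign r p • ((pauli r * (pauli r)ᵀ) * pauli p * (pauli r * (pauli r)ᵀ)) := by
        rw [← h2]; simp only [Matrix.mul_assoc]
    _ = _ := by rw [pauli_mul_transpose, one_mul, mul_one]

/-- The dimension of the Hilbert space of the qubits `V`. -/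
def dimC (V : Type) [Fintype V] : ℂ := 2 ^ Fintype.card V

lemma dimC_ne_zero : dimC V ≠ 0 := by simp [dimC]

lemma pauli_complete (b d b' d' : Basis01 V) :
    ∑ v : Lab V, pauli v b d * pauli v b' d' = if b = b' ∧ d = d' then dimC V else 0 := by
  have h : ∀ b d b' d' : Fin 2, ∑ p, (pauliEntry p b d : ℂ) * (pauliEntry p b' d' : ℂ)
      = if b = b' ∧ d = d' then 2 else 0 := by
    intro b d b' d'
    exact_mod_cast pauliEntry_complete b d b' d'
  simp only [pauli_apply, ← Finset.prod_mul_distrib]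
  rw [← Fintype.prod_sum (fun (w : V) (p : ZMod 2 × ZMod 2) =>
    (pauliEntry p (b w) (d w) : ℂ) * (pauliEntry p (b' w) (d' w) : ℂ))]
  simp only [h, Finset.prod_ite_zero, Finset.prod_const, Finset.card_univ, dimC, funext_iff,
    Finset.mem_univ, true_implies, forall_and]

lemma pauli_orthogonal (p q : Lab V) :
    ∑ x, ∑ y, pauli p x y * pauli q x y = if p = q then dimC V else 0 := by
  have h : ∀ p q : ZMod 2 × ZMod 2,
      ∑ i, ∑ j, (pauliEntry p i j : ℂ) * (pauliEntry q i j : ℂ) = if p = q then 2 else 0 := by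
    intro p q
    exact_mod_cast pauliEntry_orthogonal p q
  simp only [pauli_apply, ← Finset.prod_mul_distrib]
  have h2 : ∀ x : Basis01 V, ∑ y : Basis01 V,
      ∏ w, (pauliEntry (p w) (x w) (y w) : ℂ) * (pauliEntry (q w) (x w) (y w) : ℂ)
      = ∏ w, ∑ j, (pauliEntry (p w) (x w) j : ℂ) * (pauliEntry (q w) (x w) j : ℂ) :=
    fun x => (Fintype.prod_sum (fun (w : V) (j : Fin 2) =>
      (pauliEntry (p w) (x w) j : ℂ) * (pauliEntry (q w) (x w) j : ℂ))).symm
  simp only [h2]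
  rw [← Fintype.prod_sum (fun (w : V) (i : Fin 2) =>
    ∑ j, (pauliEntry (p w) i j : ℂ) * (pauliEntry (q w) i j : ℂ))]
  simp only [h, Finset.prod_ite_zero, Finset.prod_const, Finset.card_univ, dimC, funext_iff,
    Finset.mem_univ, true_implies]

lemma labSign_orthogonal (p q : Lab V) :
    ∑ r : Lab V, labSign r p * labSign r q = if p = q then dimC V ^ 2 else 0 := by
  have h : ∀ p q : ZMod 2 × ZMod 2,
      ∑ r, (siteSign r p : ℂ) * (siteSign r q : ℂ) = if p = q then 4 else 0 := by
    intro p q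
    exact_mod_cast siteSign_orthogonal p q
  simp only [labSign, ← Finset.prod_mul_distrib]
  rw [← Fintype.prod_sum (fun (w : V) (r : ZMod 2 × ZMod 2) =>
    (siteSign r (p w) : ℂ) * (siteSign r (q w) : ℂ))]
  simp only [h, Finset.prod_ite_zero, Finset.prod_const, Finset.card_univ, dimC, funext_iff,
    Finset.mem_univ, true_implies, ← pow_mul, mul_comm _ 2]
  norm_num [pow_mul]

lemma card_lab : (Fintype.card (Lab V) : ℂ) = dimC V ^ 2 := by
  simp [dimC, ← pow_mul, mul_comm _ 2]
  norm_num [pow_mul]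

lemma sum_norm_sq_of_orthogonal {I K : Type*} [Fintype I] [Fintype K] [DecidableEq K]
    (e : I → K → ℂ) (he : ∀ v k, star (e v k) = e v k) (c : ℝ)
    (h : ∀ k k', ∑ v, e v k * e v k' = if k = k' then (c : ℂ) else 0) (Y : K → ℂ) :
    ∑ v, ‖∑ k, e v k * Y k‖ ^ 2 = c * ∑ k, ‖Y k‖ ^ 2 := by
  have nsq : ∀ z : ℂ, ((‖z‖ ^ 2 : ℝ) : ℂ) = z * star z := fun z => by
    rw [Complex.star_def, Complex.mul_conj, Complex.normSq_eq_norm_sq]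
  apply Complex.ofReal_injective
  rw [Complex.ofReal_sum, Complex.ofReal_mul, Complex.ofReal_sum]
  simp only [nsq, star_sum, star_mul', he, Finset.sum_mul_sum]
  rw [Finset.sum_comm, Finset.mul_sum]
  refine Finset.sum_congr rfl fun a _ => ?_
  have e2 : ∀ v b, e v a * Y a * (e v b * star (Y b)) = e v a * e v b * (Y a * star (Y b)) := by
    intros; ring
  rw [Finset.sum_comm]
  simp only [e2, ← Finset.sum_mul, h, ite_mul, zero_mul, Finset.sum_ite_eq, Finset.mem_univ,
    if_true]

/-- Plancherel's identity for the Pauli basis. -/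
lemma sum_norm_sq_pauli (Y : Basis01 V → Basis01 V → ℂ) :
    ∑ v : Lab V, ‖∑ j, ∑ k, pauli v j k * Y j k‖ ^ 2
      = 2 ^ Fintype.card V * ∑ j, ∑ k, ‖Y j k‖ ^ 2 := by
  have := sum_norm_sq_of_orthogonal (fun (v : Lab V) (a : Basis01 V × Basis01 V) =>
    pauli v a.1 a.2) (fun v a => star_pauli_apply v a.1 a.2) (2 ^ Fintype.card V)
    (fun a b => by simp only [pauli_complete, Prod.ext_iff, dimC]; norm_num)
    (fun a => Y a.1 a.2)
  simpa only [Fintype.sum_prod_type] using this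

/-! ### The adjoint action in the Pauli basis -/

/-- The matrix entries of `X ↦ U X U†` in the Pauli basis, normalised so that they form a unitary
matrix when `U` is unitary. -/
def chi (U : Matrix (Basis01 V) (Basis01 V) ℂ) (p q : Lab V) : ℂ :=
  (dimC V)⁻¹ * ((pauli p)ᵀ * (U * pauli q * Uᴴ)).trace

lemma trace_transpose_mul (A X : Matrix (Basis01 V) (Basis01 V) ℂ) :
    (Aᵀ * X).trace = ∑ a, ∑ c, A a c * X a c := by
  simp only [Matrix.trace, Matrix.diag, Matrix.mul_apply, Matrix.transpose_apply]
  exact Finset.sum_comm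

lemma pauli_expansion (X : Matrix (Basis01 V) (Basis01 V) ℂ) (a c : Basis01 V) :
    X a c = (dimC V)⁻¹ * ∑ p, ((pauli p)ᵀ * X).trace * pauli p a c := by
  have h : ∑ p, ((pauli p)ᵀ * X).trace * pauli p a c = dimC V * X a c := by
    simp only [trace_transpose_mul, Finset.sum_mul]
    rw [Finset.sum_comm]
    have : ∀ a' : Basis01 V, ∑ p : Lab V, ∑ c', pauli p a' c' * X a' c' * pauli p a c
        = ∑ c', if a' = a ∧ c' = c then dimC V * X a' c' else 0 := by
      intro a'
      rw [Finset.sum_comm]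
      refine Finset.sum_congr rfl fun c' _ => ?_
      have e : ∀ p : Lab V, pauli p a' c' * X a' c' * pauli p a c
          = pauli p a' c' * pauli p a c * X a' c' := by intro p; ring
      simp only [e, ← Finset.sum_mul, pauli_complete, ite_mul, zero_mul]
    simp only [this, ite_and, Finset.sum_ite_eq', Finset.sum_ite_irrel, Finset.sum_const_zero,
      Finset.mem_univ, if_true]
  rw [h, inv_mul_cancel_left₀ dimC_ne_zero]

/-- The expansion of `U ⊗ Ū` in Pauli operators. -/
lemma mul_star_expansion (U : Matrix (Basis01 V) (Basis01 V) ℂ) (a b c d : Basis01 V) :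
    U a b * star (U c d)
      = (dimC V)⁻¹ * ∑ p, ∑ q, chi U p q * (pauli p a c * pauli q b d) := by
  have h1 : ∀ q : Lab V, ∑ p, chi U p q * (pauli p a c * pauli q b d)
      = (U * pauli q * Uᴴ) a c * pauli q b d := by
    intro q
    rw [pauli_expansion (U * pauli q * Uᴴ) a c, Finset.mul_sum, Finset.sum_mul]
    exact Finset.sum_congr rfl fun p _ => by simp only [chi]; ring
  have h2 : ∑ q, (U * pauli q * Uᴴ) a c * pauli q b d = dimC V * (U a b * star (U c d)) := by
    simp only [Matrix.mul_apply, Matrix.conjTranspose_apply, Finset.sum_mul]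
    rw [Finset.sum_comm]
    have : ∀ d' : Basis01 V, ∑ q : Lab V, ∑ b', U a b' * pauli q b' d' * star (U c d') * pauli q b d
        = ∑ b', if b' = b ∧ d' = d then dimC V * (U a b' * star (U c d')) else 0 := by
      intro d'
      rw [Finset.sum_comm]
      refine Finset.sum_congr rfl fun b' _ => ?_
      have e : ∀ q : Lab V, U a b' * pauli q b' d' * star (U c d') * pauli q b d
          = pauli q b' d' * pauli q b d * (U a b' * star (U c d')) := by intro p; ring
      simp only [e, ← Finset.sum_mul, pauli_complete, ite_mul, zero_mul]
    simp only [this, ite_and, Finset.sum_ite_eq', Finset.mem_univ, if_true]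
  rw [Finset.sum_comm]
  simp only [h1, h2]
  rw [inv_mul_cancel_left₀ dimC_ne_zero]

lemma chi_pauli_twirl (U : Matrix (Basis01 V) (Basis01 V) ℂ) (r₁ r₂ p q : Lab V) :
    chi (pauli r₁ * U * pauli r₂) p q = labSign r₁ p * labSign r₂ q * chi U p q := by
  have e : (pauli p)ᵀ * (pauli r₁ * U * pauli r₂ * pauli q * (pauli r₁ * U * pauli r₂)ᴴ)
      = (pauli p)ᵀ * pauli r₁ * (U * (pauli r₂ * pauli q * (pauli r₂)ᵀ) * Uᴴ) * (pauli r₁)ᵀ := by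
    simp only [Matrix.conjTranspose_mul, conjTranspose_pauli, Matrix.mul_assoc]
  have e2 : (pauli r₁)ᵀ * ((pauli p)ᵀ * pauli r₁) = labSign r₁ p • (pauli p)ᵀ := by
    rw [← Matrix.transpose_smul, ← transpose_pauli_mul_pauli_mul]
    simp only [Matrix.transpose_mul, Matrix.transpose_transpose, Matrix.mul_assoc]
  rw [chi, e, pauli_mul_pauli_mul_transpose, Matrix.trace_mul_comm, ← Matrix.mul_assoc, e2]
  simp only [Matrix.mul_smul, Matrix.smul_mul, Matrix.trace_smul, smul_eq_mul, chi]
  ring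

lemma star_chi (U : Matrix (Basis01 V) (Basis01 V) ℂ) (p q : Lab V) :
    star (chi U p q) = chi Uᴴ q p := by
  have hd : star (dimC V) = dimC V := by simp [dimC]
  rw [chi, chi, star_mul', star_inv₀, hd, ← Matrix.trace_conjTranspose]
  congr 1
  simp only [Matrix.conjTranspose_mul, ← conjTranspose_pauli, Matrix.conjTranspose_conjTranspose]
  rw [Matrix.mul_assoc, Matrix.mul_assoc, Matrix.trace_mul_comm]
  simp only [Matrix.mul_assoc]

lemma chi_zero_right {U : Matrix (Basis01 V) (Basis01 V) ℂ}
    (hU : U ∈ Matrix.unitaryGroup (Basis01 V) ℂ) (p : Lab V) :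
    chi U p 0 = if p = 0 then 1 else 0 := by
  have h1 : U * Uᴴ = 1 := Matrix.mem_unitaryGroup_iff.mp hU
  have h2 : ((pauli p)ᵀ * (U * pauli 0 * Uᴴ)).trace = if p = 0 then dimC V else 0 := by
    rw [pauli_zero, mul_one, h1, ← pauli_zero, trace_transpose_mul, pauli_orthogonal]
  rw [chi, h2]
  split_ifs
  · exact inv_mul_cancel₀ dimC_ne_zero
  · exact mul_zero _

lemma conjTranspose_mem_unitary {U : Matrix (Basis01 V) (Basis01 V) ℂ}
    (hU : U ∈ Matrix.unitaryGroup (Basis01 V) ℂ) : Uᴴ ∈ Matrix.unitaryGroup (Basis01 V) ℂ :=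
  Unitary.star_mem hU

lemma chi_zero_left {U : Matrix (Basis01 V) (Basis01 V) ℂ}
    (hU : U ∈ Matrix.unitaryGroup (Basis01 V) ℂ) (q : Lab V) :
    chi U 0 q = if q = 0 then 1 else 0 := by
  have := star_chi U 0 q
  rw [chi_zero_right (conjTranspose_mem_unitary hU)] at this
  rw [← star_star (chi U 0 q), this]
  split_ifs <;> simp

lemma sum_norm_sq_mulVec {ι : Type} [Fintype ι] [DecidableEq ι] {U : Matrix ι ι ℂ}
    (hU : U ∈ Matrix.unitaryGroup ι ℂ) (x : ι → ℂ) :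
    ∑ i, ‖(U *ᵥ x) i‖ ^ 2 = ∑ i, ‖x i‖ ^ 2 := by
  have nsq : ∀ z : ℂ, ((‖z‖ ^ 2 : ℝ) : ℂ) = star z * z := fun z => by
    rw [mul_comm, Complex.star_def, Complex.mul_conj, Complex.normSq_eq_norm_sq]
  have h1 : Uᴴ * U = 1 := Matrix.mem_unitaryGroup_iff'.mp hU
  apply Complex.ofReal_injective
  rw [Complex.ofReal_sum, Complex.ofReal_sum]
  simp only [nsq]
  change star (U *ᵥ x) ⬝ᵥ (U *ᵥ x) = star x ⬝ᵥ x
  rw [Matrix.star_mulVec, Matrix.dotProduct_mulVec, Matrix.vecMul_vecMul, h1, Matrix.vecMul_one]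

lemma sum_norm_sq_unitary {ι : Type} [Fintype ι] [DecidableEq ι] {U : Matrix ι ι ℂ}
    (hU : U ∈ Matrix.unitaryGroup ι ℂ) : ∑ i, ∑ j, ‖U i j‖ ^ 2 = Fintype.card ι := by
  rw [Finset.sum_comm]
  have h : ∀ j, ∑ i, ‖U i j‖ ^ 2 = 1 := by
    intro j
    have := sum_norm_sq_mulVec hU (Pi.single j 1)
    simp only [Matrix.mulVec_single_one, Matrix.col_apply] at this
    rw [this, Finset.sum_eq_single j]
    · simp
    · intro b _ hb; simp [hb]
    · simp
  simp [h]

lemma sum_left_norm_sq_chi {U : Matrix (Basis01 V) (Basis01 V) ℂ}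
    (hU : U ∈ Matrix.unitaryGroup (Basis01 V) ℂ) (q : Lab V) : ∑ p, ‖chi U p q‖ ^ 2 = 1 := by
  have hX : U * pauli q * Uᴴ ∈ Matrix.unitaryGroup (Basis01 V) ℂ :=
    mul_mem (mul_mem hU (pauli_mem_unitary q)) (conjTranspose_mem_unitary hU)
  have h := sum_norm_sq_pauli (fun a c => (U * pauli q * Uᴴ) a c)
  rw [sum_norm_sq_unitary hX] at h
  have hN : ((2 : ℝ) ^ Fintype.card V) ≠ 0 := by positivity
  simp only [chi, norm_mul, mul_pow, trace_transpose_mul, ← Finset.mul_sum]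
  rw [h]
  simp [dimC]
  field_simp

lemma sum_right_norm_sq_chi {U : Matrix (Basis01 V) (Basis01 V) ℂ}
    (hU : U ∈ Matrix.unitaryGroup (Basis01 V) ℂ) (p : Lab V) : ∑ q, ‖chi U p q‖ ^ 2 = 1 := by
  rw [← sum_left_norm_sq_chi (conjTranspose_mem_unitary hU) p]
  exact Finset.sum_congr rfl fun q _ => by rw [← star_chi, norm_star]

/-- Conjugation by `U` maps Pauli operators to Pauli operators, up to phases, and acts on their
labels by `M`. -/
def ConjugatesBy (U : Matrix (Basis01 V) (Basis01 V) ℂ) (M : Lab V → Lab V) : Prop :=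
  ∀ v, ∃ z : ℂ, ‖z‖ = 1 ∧ U * pauli v = z • (pauli (M v) * U)

lemma norm_chi_mul_left {C : Matrix (Basis01 V) (Basis01 V) ℂ} {M : Lab V → Lab V}
    (hC : C ∈ Matrix.unitaryGroup (Basis01 V) ℂ) (hM : ConjugatesBy C M)
    (U : Matrix (Basis01 V) (Basis01 V) ℂ) (p q : Lab V) :
    ‖chi (C * U) (M p) q‖ = ‖chi U p q‖ := by
  obtain ⟨z, hz, h⟩ := hM p
  have h1 : Cᴴ * C = 1 := Matrix.mem_unitaryGroup_iff'.mp hC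
  have h2 : pauli p = z • (Cᴴ * (pauli (M p) * C)) := by
    rw [← Matrix.mul_smul, ← h, ← Matrix.mul_assoc, h1, one_mul]
  have h3 : ((pauli p)ᵀ * (U * pauli q * Uᴴ)).trace
      = star z * ((pauli (M p))ᵀ * (C * U * pauli q * (C * U)ᴴ)).trace := by
    rw [← conjTranspose_pauli p, h2]
    simp only [Matrix.conjTranspose_smul, Matrix.conjTranspose_mul,
      Matrix.conjTranspose_conjTranspose, conjTranspose_pauli, Matrix.smul_mul, Matrix.trace_smul,
      smul_eq_mul]
    rw [Matrix.mul_assoc Cᴴ, Matrix.mul_assoc Cᴴ, Matrix.trace_mul_comm Cᴴ]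
    simp only [Matrix.mul_assoc]
  simp only [chi, norm_mul, h3, norm_star, hz, one_mul]

lemma norm_chi_mul_right {C : Matrix (Basis01 V) (Basis01 V) ℂ} {M : Lab V → Lab V}
    (hC : C ∈ Matrix.unitaryGroup (Basis01 V) ℂ) (hM : ConjugatesBy C M)
    (U : Matrix (Basis01 V) (Basis01 V) ℂ) (p q : Lab V) :
    ‖chi (U * C) p q‖ = ‖chi U p (M q)‖ := by
  obtain ⟨z, hz, h⟩ := hM q
  have h1 : C * Cᴴ = 1 := Matrix.mem_unitaryGroup_iff.mp hC
  have h2 : U * C * pauli q * (U * C)ᴴ = z • (U * pauli (M q) * Uᴴ) := by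
    rw [Matrix.mul_assoc U, h, Matrix.conjTranspose_mul]
    simp only [Matrix.mul_smul, Matrix.smul_mul]
    rw [← Matrix.mul_assoc, Matrix.mul_assoc U, Matrix.mul_assoc (pauli (M q)), h1, mul_one]
  simp only [chi, norm_mul, h2, Matrix.mul_smul, Matrix.trace_smul, smul_eq_mul, hz, one_mul]

/-! ### Twirled experiments -/

/-- The quadratic form of the observable `O`. -/
def quadForm {ι : Type} [Fintype ι] (O : Matrix ι ι ℂ) (x : ι → ℂ) : ℂ := star x ⬝ᵥ (O *ᵥ x)

lemma quadForm_sum {ι I : Type} [Fintype ι] [Fintype I] (O : Matrix ι ι ℂ) (c : I → ℂ)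
    (u : I → ι → ℂ) : quadForm O (∑ i, c i • u i)
      = ∑ i, ∑ j, star (c i) * c j * (star (u i) ⬝ᵥ (O *ᵥ u j)) := by
  simp only [quadForm, star_sum, Matrix.mulVec_sum, sum_dotProduct, dotProduct_sum,
    Matrix.mulVec_smul, star_smul, smul_dotProduct, dotProduct_smul, smul_eq_mul, mul_assoc,
    Finset.mul_sum]
  rw [Finset.sum_comm]
  exact Finset.sum_congr rfl fun i _ => Finset.sum_congr rfl fun j _ => by ring

/-- Averaging over orthogonal signs removes the interference terms of a quadratic form. -/
lemma sum_quadForm_of_orthogonal {ι I R : Type} [Fintype ι] [Fintype I] [DecidableEq I]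
    [Fintype R] (O : Matrix ι ι ℂ) (c : I → ℂ) (u : I → ι → ℂ) (s : R → I → ℂ)
    (hs : ∀ r i, star (s r i) = s r i) (K : ℂ)
    (horth : ∀ i j, ∑ r, s r i * s r j = if i = j then K else 0) :
    ∑ r, quadForm O (∑ i, (s r i * c i) • u i)
      = K * ∑ i, ((‖c i‖ ^ 2 : ℝ) : ℂ) * quadForm O (u i) := by
  have nsq : ∀ z : ℂ, ((‖z‖ ^ 2 : ℝ) : ℂ) = star z * z := fun z => by
    rw [mul_comm, Complex.star_def, Complex.mul_conj, Complex.normSq_eq_norm_sq]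
  simp only [quadForm_sum, star_mul', hs]
  rw [Finset.sum_comm, Finset.mul_sum]
  refine Finset.sum_congr rfl fun i _ => ?_
  rw [Finset.sum_comm]
  have e : ∀ j r, s r i * star (c i) * (s r j * c j) * (star (u i) ⬝ᵥ (O *ᵥ u j))
      = s r i * s r j * (star (c i) * c j * (star (u i) ⬝ᵥ (O *ᵥ u j))) := by intros; ring
  simp only [e, ← Finset.sum_mul, horth, ite_mul, zero_mul, Finset.sum_ite_eq, Finset.mem_univ,
    if_true, nsq]
  rfl

lemma quadForm_re_nonneg {ι : Type} [Fintype ι] [DecidableEq ι] {O : Matrix ι ι ℂ}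
    (hO : O.PosSemidef) (x : ι → ℂ) : 0 ≤ (quadForm O x).re :=
  hO.re_dotProduct_nonneg x

lemma quadForm_eq_re {ι : Type} [Fintype ι] [DecidableEq ι] {O : Matrix ι ι ℂ}
    (hO : O.PosSemidef) (x : ι → ℂ) : quadForm O x = ((quadForm O x).re : ℂ) := by
  have h : 0 ≤ quadForm O x := hO.dotProduct_mulVec_nonneg x
  exact Complex.ext (by simp) (by simpa using (Complex.le_def.mp h).2.symm)

lemma quadForm_re_le {ι : Type} [Fintype ι] [DecidableEq ι] {O : Matrix ι ι ℂ}
    (hO : (1 - O).PosSemidef) (x : ι → ℂ) : (quadForm O x).re ≤ ∑ i, ‖x i‖ ^ 2 := by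
  have h := quadForm_re_nonneg hO x
  have e : quadForm (1 - O) x = ((∑ i, ‖x i‖ ^ 2 : ℝ) : ℂ) - quadForm O x := by
    simp only [quadForm, Matrix.sub_mulVec, Matrix.one_mulVec, dotProduct_sub]
    congr 1
    rw [Complex.ofReal_sum]
    refine Finset.sum_congr rfl fun i _ => ?_
    rw [mul_comm, Pi.star_apply, Complex.star_def, Complex.mul_conj, Complex.normSq_eq_norm_sq]
  rw [e, Complex.sub_re, Complex.ofReal_re] at h
  linarith

lemma expect_eq_quadForm (A : Experiment V)
    (O : Matrix (Basis01 V × Basis01 (Fin A.m)) (Basis01 V × Basis01 (Fin A.m)) ℂ)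
    (U : UGroup (Basis01 V)) : A.expect O U = quadForm O (A.output U) := by
  rw [Experiment.expect, Matrix.mul_vecMulVec, Matrix.trace_vecMulVec, quadForm, dotProduct_comm]

/-- The families of coefficients in which the product of two queries is expanded: the entries of
the adjoint action of `U`, possibly transposed and possibly conjugated. -/
def IsChiFamily (c : Matrix (Basis01 V) (Basis01 V) ℂ → Lab V → Lab V → ℂ) : Prop :=
  (c = fun U p q => chi U p q) ∨ (c = fun U p q => star (chi U p q)) ∨
  (c = fun U p q => chi U q p) ∨ (c = fun U p q => star (chi U q p))

lemma star_mul_expansion (U : Matrix (Basis01 V) (Basis01 V) ℂ) (a b c d : Basis01 V) :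
    star (U a b) * U c d
      = (dimC V)⁻¹ * ∑ p, ∑ q, star (chi U p q) * (pauli p a c * pauli q b d) := by
  have hd : star (dimC V) = dimC V := by simp [dimC]
  have := congrArg star (mul_star_expansion U a b c d)
  simpa only [star_mul', star_star, star_sum, star_inv₀, hd, star_pauli_apply] using this

/-- In an experiment with mixed queries, the entries of one Pauli operator connect the output or
input indices of one query with one of the other query, those of the other Pauli operator connect
the remaining two indices; only two of the possible index patterns occur. -/
lemma exists_query_expansion {q₁ q₂ : Query}
    (h : (q₁.IsForward ∧ q₂.IsBackward) ∨ (q₁.IsBackward ∧ q₂.IsForward)) :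
    ∃ c : Matrix (Basis01 V) (Basis01 V) ℂ → Lab V → Lab V → ℂ, IsChiFamily c ∧
      ((∀ U t s w u, q₁.apply U t s * q₂.apply U w u
          = (dimC V)⁻¹ * ∑ r, ∑ r', c U r r' * (pauli r s w * pauli r' t u)) ∨
       (∀ U t s w u, q₁.apply U t s * q₂.apply U w u
          = (dimC V)⁻¹ * ∑ r, ∑ r', c U r r' * (pauli r t w * pauli r' s u))) := by
  have swap : ∀ (f : Lab V → Lab V → ℂ) (g g' : Lab V → ℂ),
      ∑ p, ∑ q, f p q * (g p * g' q) = ∑ r, ∑ r', f r' r * (g' r * g r') := by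
    intro f g g'
    rw [Finset.sum_comm]
    simp only [mul_comm (g _)]
  rcases h with ⟨h1 | h1, h2 | h2⟩ | ⟨h1 | h1, h2 | h2⟩ <;> subst h1 <;> subst h2
  · exact ⟨_, Or.inl rfl, Or.inr fun U t s w u => mul_star_expansion U t s w u⟩
  · exact ⟨_, Or.inr (Or.inr (Or.inl rfl)), Or.inl fun U t s w u => by
      rw [← swap (fun p q => chi U p q)]; exact mul_star_expansion U t s u w⟩
  · exact ⟨_, Or.inl rfl, Or.inl fun U t s w u => mul_star_expansion U s t w u⟩
  · exact ⟨_, Or.inr (Or.inr (Or.inl rfl)), Or.inr fun U t s w u => by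
      rw [← swap (fun p q => chi U p q)]; exact mul_star_expansion U s t u w⟩
  · exact ⟨_, Or.inr (Or.inl rfl), Or.inr fun U t s w u => star_mul_expansion U t s w u⟩
  · exact ⟨_, Or.inr (Or.inr (Or.inr rfl)), Or.inl fun U t s w u => by
      rw [← swap (fun p q => star (chi U p q))]; exact star_mul_expansion U t s u w⟩
  · exact ⟨_, Or.inr (Or.inl rfl), Or.inl fun U t s w u => star_mul_expansion U s t w u⟩
  · exact ⟨_, Or.inr (Or.inr (Or.inr rfl)), Or.inr fun U t s w u => by
      rw [← swap (fun p q => star (chi U p q))]; exact star_mul_expansion U s t u w⟩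

section Amplitudes

variable {κ : Type} [Fintype κ] [DecidableEq κ]

/-- The vector that multiplies the coefficient with labels `r`, `r'` in the state of an experiment
before its last unitary. -/
def amplitude (Y : Basis01 V → Basis01 V → Basis01 V → κ → ℂ) (r r' : Lab V) :
    Basis01 V × κ → ℂ :=
  fun a => (dimC V)⁻¹ * ∑ i, pauli r i a.1 * ∑ j, ∑ k, pauli r' j k * Y i j k a.2

/-- The squared norm of `amplitude Y r r'`, which does not depend on `r`. -/
def amplitudeWeight (Y : Basis01 V → Basis01 V → Basis01 V → κ → ℂ) (r' : Lab V) : ℝ :=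
  ((2 : ℝ) ^ Fintype.card V)⁻¹ ^ 2 * ∑ f, ∑ i, ‖∑ j, ∑ k, pauli r' j k * Y i j k f‖ ^ 2

lemma sum_norm_sq_amplitude (Y : Basis01 V → Basis01 V → Basis01 V → κ → ℂ) (r r' : Lab V) :
    ∑ a, ‖amplitude Y r r' a‖ ^ 2 = amplitudeWeight Y r' := by
  have h : ∀ f, ∑ w, ‖∑ i, pauli r i w * ∑ j, ∑ k, pauli r' j k * Y i j k f‖ ^ 2
      = ∑ i, ‖∑ j, ∑ k, pauli r' j k * Y i j k f‖ ^ 2 := by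
    intro f
    have hT : (pauli r)ᵀ ∈ Matrix.unitaryGroup (Basis01 V) ℂ := by
      rw [← conjTranspose_pauli]; exact conjTranspose_mem_unitary (pauli_mem_unitary r)
    exact sum_norm_sq_mulVec hT (fun i => ∑ j, ∑ k, pauli r' j k * Y i j k f)
  simp only [amplitude, norm_mul, mul_pow, Fintype.sum_prod_type_right, ← Finset.mul_sum, h]
  simp [amplitudeWeight, dimC]

lemma sum_amplitudeWeight (Y : Basis01 V → Basis01 V → Basis01 V → κ → ℂ)
    (hY : ∑ f, ∑ i, ∑ j, ∑ k, ‖Y i j k f‖ ^ 2 = 2 ^ Fintype.card V) :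
    ∑ r', amplitudeWeight Y r' = 1 := by
  simp only [amplitudeWeight, ← Finset.mul_sum]
  rw [Finset.sum_comm]
  have h : ∀ f, ∑ r' : Lab V, ∑ i, ‖∑ j, ∑ k, pauli r' j k * Y i j k f‖ ^ 2
      = 2 ^ Fintype.card V * ∑ i, ∑ j, ∑ k, ‖Y i j k f‖ ^ 2 := by
    intro f
    rw [Finset.sum_comm, Finset.mul_sum]
    exact Finset.sum_congr rfl fun i _ => sum_norm_sq_pauli (fun j k => Y i j k f)
  simp only [h, ← Finset.mul_sum, hY]
  have hN : ((2 : ℝ) ^ Fintype.card V) ≠ 0 := by positivity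
  field_simp

/-- The part of the amplitudes of an experiment that does not depend on the queried unitary. -/
def queryKernel (W₁ : Matrix (Basis01 V × κ) (Basis01 V × κ) ℂ) (ψ : Basis01 V × κ → ℂ)
    (s t u : Basis01 V) (f : κ) : ℂ := ∑ e, W₁ (u, f) (t, e) * ψ (s, e)

lemma sum_norm_sq_queryKernel {W₁ : Matrix (Basis01 V × κ) (Basis01 V × κ) ℂ}
    (hW : W₁ ∈ Matrix.unitaryGroup (Basis01 V × κ) ℂ) (ψ : Basis01 V × κ → ℂ)
    (hψ : ∑ a, ‖ψ a‖ ^ 2 = 1) :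
    ∑ s, ∑ t, ∑ u, ∑ f, ‖queryKernel W₁ ψ s t u f‖ ^ 2 = 2 ^ Fintype.card V := by
  have h : ∀ s t, ∑ u, ∑ f, ‖queryKernel W₁ ψ s t u f‖ ^ 2 = ∑ e, ‖ψ (s, e)‖ ^ 2 := by
    intro s t
    have h1 := sum_norm_sq_mulVec hW (fun a => if a.1 = t then ψ (s, a.2) else 0)
    have h2 : ∀ a, (W₁ *ᵥ fun a => if a.1 = t then ψ (s, a.2) else 0) a
        = queryKernel W₁ ψ s t a.1 a.2 := by
      intro a
      simp only [Matrix.mulVec, dotProduct, Fintype.sum_prod_type_right, queryKernel, mul_ite,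
        mul_zero, Finset.sum_ite_eq', Finset.mem_univ, if_true]
    simp only [h2] at h1
    rw [Fintype.sum_prod_type, Fintype.sum_prod_type_right] at h1
    rw [h1]
    refine Finset.sum_congr rfl fun e _ => ?_
    rw [Finset.sum_eq_single t]
    · simp
    · intro b _ hb; simp [hb]
    · simp
  simp only [h, Finset.sum_const, Finset.card_univ, nsmul_eq_mul, ← Finset.mul_sum]
  rw [Fintype.sum_prod_type] at hψ
  simp [hψ]

lemma query_output_apply (V₁ V₂ : Matrix (Basis01 V) (Basis01 V) ℂ)
    (W₁ : Matrix (Basis01 V × κ) (Basis01 V × κ) ℂ) (ψ : Basis01 V × κ → ℂ) (w : Basis01 V)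
    (f : κ) :
    ((V₂ ⊗ₖ (1 : Matrix κ κ ℂ)) *ᵥ (W₁ *ᵥ ((V₁ ⊗ₖ (1 : Matrix κ κ ℂ)) *ᵥ ψ))) (w, f)
      = ∑ s, ∑ t, ∑ u, V₁ t s * V₂ w u * queryKernel W₁ ψ s t u f := by
  have h : ∀ (B : Matrix (Basis01 V) (Basis01 V) ℂ) (x : Basis01 V × κ → ℂ) (w : Basis01 V)
      (f : κ), ((B ⊗ₖ (1 : Matrix κ κ ℂ)) *ᵥ x) (w, f) = ∑ u, B w u * x (u, f) := by
    intro B x w f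
    simp [Matrix.mulVec, dotProduct, Fintype.sum_prod_type, Matrix.kroneckerMap_apply,
      Matrix.one_apply]
  rw [h]
  have h2 : ∀ u, (W₁ *ᵥ ((V₁ ⊗ₖ (1 : Matrix κ κ ℂ)) *ᵥ ψ)) (u, f)
      = ∑ t, ∑ e, W₁ (u, f) (t, e) * ∑ s, V₁ t s * ψ (s, e) := by
    intro u
    simp only [← h]
    simp only [Matrix.mulVec, dotProduct, Fintype.sum_prod_type]
  simp only [h2, queryKernel, Finset.mul_sum]
  rw [Finset.sum_comm]
  conv_rhs => rw [Finset.sum_comm]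
  refine Finset.sum_congr rfl fun t _ => ?_
  conv_rhs => rw [Finset.sum_comm]
  refine Finset.sum_congr rfl fun u _ => ?_
  rw [Finset.sum_comm]
  exact Finset.sum_congr rfl fun s _ => Finset.sum_congr rfl fun e _ => by ring

end Amplitudes

lemma sum_comm_three_two {S L : Type} [Fintype S] [Fintype L] (F : S → S → S → L → L → ℂ) :
    ∑ s, ∑ t, ∑ u, ∑ r, ∑ r', F s t u r r' = ∑ r, ∑ r', ∑ s, ∑ t, ∑ u, F s t u r r' := by
  have := Finset.sum_comm (s := (Finset.univ : Finset (S × S × S)))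
    (t := (Finset.univ : Finset (L × L))) (f := fun a b => F a.1 a.2.1 a.2.2 b.1 b.2)
  simpa only [Fintype.sum_prod_type] using this

lemma exists_amplitude (A : Experiment V) (hA : A.IsMixed) :
    ∃ (c : Matrix (Basis01 V) (Basis01 V) ℂ → Lab V → Lab V → ℂ)
      (Y : Basis01 V → Basis01 V → Basis01 V → Basis01 (Fin A.m) → ℂ),
      IsChiFamily c ∧ (∑ f, ∑ i, ∑ j, ∑ k, ‖Y i j k f‖ ^ 2 = 2 ^ Fintype.card V) ∧
      ∀ U : UGroup (Basis01 V), A.output U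
        = ∑ i : Lab V × Lab V, c U.1 i.1 i.2 • (A.W₂.1 *ᵥ amplitude Y i.1 i.2) := by
  set ψ : Basis01 V × Basis01 (Fin A.m) → ℂ :=
    A.W₀.1 *ᵥ Pi.single (fun _ => 0, fun _ => 0) 1 with hψ
  have hnorm : ∑ a, ‖ψ a‖ ^ 2 = 1 := by
    rw [hψ, sum_norm_sq_mulVec A.W₀.2, Finset.sum_eq_single (fun _ => 0, fun _ => 0)]
    · simp
    · intro b _ hb; simp [hb]
    · simp
  have hZ := sum_norm_sq_queryKernel A.W₁.2 ψ hnorm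
  have hout : ∀ U : UGroup (Basis01 V), A.output U = A.W₂.1 *ᵥ
      ((A.q₂.apply U.1 ⊗ₖ 1) *ᵥ (A.W₁.1 *ᵥ ((A.q₁.apply U.1 ⊗ₖ 1) *ᵥ ψ))) := by
    intro U
    simp only [Experiment.output, hψ, Matrix.mulVec_mulVec, Matrix.mul_assoc]
  have key : ∀ (c : Matrix (Basis01 V) (Basis01 V) ℂ → Lab V → Lab V → ℂ)
      (Y : Basis01 V → Basis01 V → Basis01 V → Basis01 (Fin A.m) → ℂ) (U : UGroup (Basis01 V)),
      (∀ w f, ((A.q₂.apply U.1 ⊗ₖ 1) *ᵥ (A.W₁.1 *ᵥ ((A.q₁.apply U.1 ⊗ₖ 1) *ᵥ ψ))) (w, f)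
        = ∑ i : Lab V × Lab V, c U.1 i.1 i.2 * amplitude Y i.1 i.2 (w, f)) →
      A.output U = ∑ i : Lab V × Lab V, c U.1 i.1 i.2 • (A.W₂.1 *ᵥ amplitude Y i.1 i.2) := by
    intro c Y U h
    rw [hout]
    simp only [← Matrix.mulVec_smul, ← Matrix.mulVec_sum]
    congr 1
    funext a
    rw [h a.1 a.2]
    simp
  obtain ⟨c, hc, h | h⟩ := exists_query_expansion (V := V) hA
  · refine ⟨c, fun i j k f => queryKernel A.W₁.1 ψ i j k f, hc, ?_, fun U => key c _ U ?_⟩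
    · rw [← hZ, Finset.sum_comm]
      refine Finset.sum_congr rfl fun s _ => ?_
      rw [Finset.sum_comm]
      refine Finset.sum_congr rfl fun t _ => ?_
      rw [Finset.sum_comm]
    · intro w f
      rw [query_output_apply]
      simp only [h, amplitude, Fintype.sum_prod_type, Finset.mul_sum, Finset.sum_mul]
      rw [sum_comm_three_two]
      refine Finset.sum_congr rfl fun r _ => Finset.sum_congr rfl fun r' _ =>
        Finset.sum_congr rfl fun s _ => Finset.sum_congr rfl fun t _ =>
        Finset.sum_congr rfl fun u _ => by ring
  · refine ⟨c, fun i j k f => queryKernel A.W₁.1 ψ j i k f, hc, ?_, fun U => key c _ U ?_⟩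
    · rw [← hZ, Finset.sum_comm]
      conv_rhs => rw [Finset.sum_comm]
      refine Finset.sum_congr rfl fun t _ => ?_
      rw [Finset.sum_comm]
      refine Finset.sum_congr rfl fun s _ => ?_
      rw [Finset.sum_comm]
    · intro w f
      rw [query_output_apply]
      simp only [h, amplitude, Fintype.sum_prod_type, Finset.mul_sum, Finset.sum_mul]
      rw [Finset.sum_comm, sum_comm_three_two]
      refine Finset.sum_congr rfl fun r _ => Finset.sum_congr rfl fun r' _ =>
        Finset.sum_congr rfl fun t _ => Finset.sum_congr rfl fun s _ =>
        Finset.sum_congr rfl fun u _ => by ring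

lemma sum_labSign_mul (i j : Lab V × Lab V) : ∑ r : Lab V × Lab V,
    (labSign r.1 i.1 * labSign r.2 i.2) * (labSign r.1 j.1 * labSign r.2 j.2)
      = if i.1 = j.1 ∧ i.2 = j.2 then dimC V ^ 2 * dimC V ^ 2 else 0 := by
  have e : ∀ r : Lab V × Lab V,
      (labSign r.1 i.1 * labSign r.2 i.2) * (labSign r.1 j.1 * labSign r.2 j.2)
      = (labSign r.1 i.1 * labSign r.1 j.1) * (labSign r.2 i.2 * labSign r.2 j.2) :=
    fun r => by ring
  rw [Finset.sum_congr rfl fun r _ => e r, Fintype.sum_prod_type]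
  rw [← Fintype.sum_mul_sum (fun r => labSign r i.1 * labSign r j.1)
    (fun r => labSign r i.2 * labSign r j.2), labSign_orthogonal, labSign_orthogonal]
  by_cases h1 : i.1 = j.1 <;> by_cases h2 : i.2 = j.2 <;> simp [h1, h2]

/-- Averaged over Pauli operators applied before and after the queried unitary, an experiment with
mixed queries sees only the squared entries of the adjoint action of that unitary. -/
theorem exists_twirl_form (A : Experiment V) (hA : A.IsMixed)
    (O : Matrix (Basis01 V × Basis01 (Fin A.m)) (Basis01 V × Basis01 (Fin A.m)) ℂ)
    (hO : O.PosSemidef) (hO' : (1 - O).PosSemidef) :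
    ∃ (φ : Lab V → Lab V → ℝ) (w : Lab V → ℝ), (∀ r r', 0 ≤ φ r r' ∧ φ r r' ≤ w r') ∧
      ∑ r', w r' = 1 ∧
      ((∀ U : UGroup (Basis01 V), 𝔼 r₁, 𝔼 r₂, A.expect O (pauliU r₁ * U * pauliU r₂)
          = ((∑ r, ∑ r', ‖chi U.1 r r'‖ ^ 2 * φ r r' : ℝ) : ℂ)) ∨
        (∀ U : UGroup (Basis01 V), 𝔼 r₁, 𝔼 r₂, A.expect O (pauliU r₁ * U * pauliU r₂)
          = ((∑ r, ∑ r', ‖chi U.1 r' r‖ ^ 2 * φ r r' : ℝ) : ℂ))) := by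
  obtain ⟨c, Y, hc, hY, hout⟩ := exists_amplitude A hA
  have main : ∀ (U : UGroup (Basis01 V)) (s : Lab V × Lab V → Lab V × Lab V → ℂ),
      (∀ r i, star (s r i) = s r i) →
      (∀ i j, ∑ r, s r i * s r j = if i = j then dimC V ^ 2 * dimC V ^ 2 else 0) →
      (∀ r i, c (pauliU r.1 * U * pauliU r.2).1 i.1 i.2 = s r i * c U.1 i.1 i.2) →
      𝔼 r₁, 𝔼 r₂, A.expect O (pauliU r₁ * U * pauliU r₂)
        = ((∑ r, ∑ r', ‖c U.1 r r'‖ ^ 2 * (quadForm O (A.W₂.1 *ᵥ amplitude Y r r')).re : ℝ) : ℂ) := by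
    intro U s hs horth htw
    have h1 := sum_quadForm_of_orthogonal O (fun i : Lab V × Lab V => c U.1 i.1 i.2)
      (fun i => A.W₂.1 *ᵥ amplitude Y i.1 i.2) s hs _ horth
    have hd : dimC V ≠ 0 := dimC_ne_zero
    have h2 : ∀ r₁ r₂, A.expect O (pauliU r₁ * U * pauliU r₂)
        = quadForm O (∑ i : Lab V × Lab V, (s (r₁, r₂) i * c U.1 i.1 i.2) •
          (A.W₂.1 *ᵥ amplitude Y i.1 i.2)) := by
      intro r₁ r₂
      rw [expect_eq_quadForm, hout]
      congr 1
      exact Finset.sum_congr rfl fun i _ => by rw [htw (r₁, r₂) i]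
    simp only [Fintype.expect_eq_sum_div_card, h2]
    rw [card_lab, ← Finset.sum_div, ← Fintype.sum_prod_type', h1, Fintype.sum_prod_type, div_div,
      mul_div_cancel_left₀ _ (mul_ne_zero (pow_ne_zero 2 hd) (pow_ne_zero 2 hd))]
    push_cast
    refine Finset.sum_congr rfl fun r _ => Finset.sum_congr rfl fun r' _ => ?_
    rw [quadForm_eq_re hO]
    simp
  have horth : ∀ i j : Lab V × Lab V, ∑ r : Lab V × Lab V,
      (labSign r.1 i.1 * labSign r.2 i.2) * (labSign r.1 j.1 * labSign r.2 j.2)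
        = if i = j then dimC V ^ 2 * dimC V ^ 2 else 0 :=
    fun i j => (sum_labSign_mul i j).trans (if_congr Prod.ext_iff.symm rfl rfl)
  have horth' : ∀ i j : Lab V × Lab V, ∑ r : Lab V × Lab V,
      (labSign r.1 i.2 * labSign r.2 i.1) * (labSign r.1 j.2 * labSign r.2 j.1)
        = if i = j then dimC V ^ 2 * dimC V ^ 2 else 0 :=
    fun i j => (sum_labSign_mul i.swap j.swap).trans
      (if_congr (by rw [Prod.ext_iff, Prod.fst_swap, Prod.snd_swap, and_comm]; rfl) rfl rfl)
  refine ⟨fun r r' => (quadForm O (A.W₂.1 *ᵥ amplitude Y r r')).re, amplitudeWeight Y,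
    fun r r' => ⟨quadForm_re_nonneg hO _, ?_⟩, sum_amplitudeWeight Y hY, ?_⟩
  · refine (quadForm_re_le hO' _).trans_eq ?_
    rw [sum_norm_sq_mulVec A.W₂.2, sum_norm_sq_amplitude]
  rcases hc with rfl | rfl | rfl | rfl
  · exact Or.inl fun U => main U (fun r i => labSign r.1 i.1 * labSign r.2 i.2)
      (fun r i => by simp only [star_mul', star_labSign]) horth
      (fun r i => chi_pauli_twirl U.1 r.1 r.2 i.1 i.2)
  · refine Or.inl fun U => (main U (fun r i => labSign r.1 i.1 * labSign r.2 i.2)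
      (fun r i => by simp only [star_mul', star_labSign]) horth (fun r i => ?_)).trans ?_
    · have := congrArg star (chi_pauli_twirl U.1 r.1 r.2 i.1 i.2)
      rw [star_mul', star_mul', star_labSign, star_labSign] at this
      exact this
    · simp only [norm_star]
  · exact Or.inr fun U => main U (fun r i => labSign r.1 i.2 * labSign r.2 i.1)
      (fun r i => by simp only [star_mul', star_labSign]) horth'
      (fun r i => chi_pauli_twirl U.1 r.1 r.2 i.2 i.1)
  · refine Or.inr fun U => (main U (fun r i => labSign r.1 i.2 * labSign r.2 i.1)
      (fun r i => by simp only [star_mul', star_labSign]) horth' (fun r i => ?_)).trans ?_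
    · have := congrArg star (chi_pauli_twirl U.1 r.1 r.2 i.2 i.1)
      rw [star_mul', star_mul', star_labSign, star_labSign] at this
      exact this
    · simp only [norm_star]

lemma apply_mem_unitary (q : Query) {U : Matrix (Basis01 V) (Basis01 V) ℂ}
    (hU : U ∈ Matrix.unitaryGroup (Basis01 V) ℂ) :
    q.apply U ∈ Matrix.unitaryGroup (Basis01 V) ℂ := by
  cases q with
  | direct => exact hU
  | transpose => exact Matrix.transpose_mem_unitaryGroup_iff.mpr hU
  | conj => exact Matrix.map_star_mem_unitaryGroup_iff.mpr hU
  | adjoint => exact conjTranspose_mem_unitary hU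

lemma expect_mem_unit (A : Experiment V)
    (O : Matrix (Basis01 V × Basis01 (Fin A.m)) (Basis01 V × Basis01 (Fin A.m)) ℂ)
    (hO : O.PosSemidef) (hO' : (1 - O).PosSemidef) (U : UGroup (Basis01 V)) :
    A.expect O U = ((A.expect O U).re : ℂ) ∧ 0 ≤ (A.expect O U).re ∧ (A.expect O U).re ≤ 1 := by
  rw [expect_eq_quadForm]
  refine ⟨quadForm_eq_re hO _, quadForm_re_nonneg hO _, (quadForm_re_le hO' _).trans_eq ?_⟩
  have hk : ∀ q : Query, q.apply U.1 ⊗ₖ (1 : Matrix (Basis01 (Fin A.m)) (Basis01 (Fin A.m)) ℂ)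
      ∈ Matrix.unitaryGroup _ ℂ := fun q =>
    Matrix.kronecker_mem_unitary (apply_mem_unitary q U.2) (one_mem _)
  rw [Experiment.output, sum_norm_sq_mulVec (mul_mem (mul_mem (mul_mem (mul_mem A.W₂.2 (hk _))
    A.W₁.2) (hk _)) A.W₀.2), Finset.sum_eq_single (fun _ => 0, fun _ => 0)]
  · simp
  · intro b _ hb; simp [hb]
  · simp

/-! ### From mixing of Pauli labels to designs -/

/-- The random label maps `M ω` send every non-zero label to a label that is uniformly distributed,
up to an error `ε` in the expectation of functions with values in `[0, 1]`. -/
def IsMixing {Ω : Type} [Fintype Ω] (M : Ω → Lab V → Lab V) (ε : ℝ) : Prop :=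
  ∀ v : Lab V, v ≠ 0 → ∀ f : Lab V → ℝ, (∀ u, 0 ≤ f u ∧ f u ≤ 1) →
    |(𝔼 ω, f (M ω v)) - 𝔼 u, f u| ≤ ε

lemma IsMixing.abs_sub_le {Ω : Type} [Fintype Ω] {M : Ω → Lab V → Lab V} {ε : ℝ}
    (h : IsMixing M ε) {v : Lab V} (hv : v ≠ 0) (f : Lab V → ℝ) (b : ℝ)
    (hf : ∀ u, 0 ≤ f u ∧ f u ≤ b) : |(𝔼 ω, f (M ω v)) - 𝔼 u, f u| ≤ ε * b := by
  rcases (le_trans (hf 0).1 (hf 0).2).eq_or_lt with hb | hb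
  · have : ∀ u, f u = 0 := fun u => le_antisymm (hb ▸ (hf u).2) (hf u).1
    simp [this, ← hb]
  · have h1 := h v hv (fun u => f u / b) fun u =>
      ⟨div_nonneg (hf u).1 hb.le, (div_le_one hb).mpr (hf u).2⟩
    rw [← Finset.expect_div, ← Finset.expect_div, ← sub_div, abs_div, abs_of_pos hb,
      div_le_iff₀ hb] at h1
    exact h1

/-- The kernel `t` stands for the squared entries of the adjoint action of a unitary. Following it
by mixing label maps makes the average of `φ` independent of `t`, up to the mixing error. -/
lemma abs_expect_sub_le_of_isMixing {Ω : Type} [Fintype Ω] [Nonempty Ω] {M : Ω → Lab V → Lab V}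
    {ε : ℝ} (hε : 0 ≤ ε) (hM : IsMixing M ε) (hM0 : ∀ ω, M ω 0 = 0) {t φ : Lab V → Lab V → ℝ}
    {w : Lab V → ℝ} (ht : ∀ p q, 0 ≤ t p q) (hcol : ∀ q, ∑ p, t p q = 1)
    (ht0 : ∀ p, p ≠ 0 → t p 0 = 0) (ht0' : ∀ q, q ≠ 0 → t 0 q = 0)
    (hφ : ∀ p q, 0 ≤ φ p q ∧ φ p q ≤ w q) (hw : ∑ q, w q = 1) :
    |(𝔼 ω, ∑ p, ∑ q, t p q * φ (M ω p) q)
      - ∑ q, (if q = 0 then φ 0 0 else 𝔼 u, φ u q)| ≤ ε := by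
  have e1 : (𝔼 ω, ∑ p, ∑ q, t p q * φ (M ω p) q)
      = ∑ q, ∑ p, t p q * 𝔼 ω, φ (M ω p) q := by
    rw [Finset.expect_sum_comm]
    refine (Finset.sum_congr rfl fun p _ => Finset.expect_sum_comm _ _ _).trans ?_
    rw [Finset.sum_comm]
    refine (Finset.sum_congr rfl fun q _ => Finset.sum_congr rfl fun p _ => ?_)
    rw [Finset.mul_expect]
  have e2 : ∑ q, (if q = 0 then φ 0 0 else 𝔼 u, φ u q)
      = ∑ q, ∑ p, t p q * (if q = 0 then φ 0 0 else 𝔼 u, φ u q) :=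
    Finset.sum_congr rfl fun q _ => by rw [← Finset.sum_mul, hcol, one_mul]
  have e3 : ε = ∑ q, ∑ p, t p q * (ε * w q) := by
    simp only [← Finset.sum_mul, hcol, one_mul, ← Finset.mul_sum, hw, mul_one]
  rw [e1, e2, e3, ← Finset.sum_sub_distrib]
  refine (Finset.abs_sum_le_sum_abs _ _).trans (Finset.sum_le_sum fun q _ => ?_)
  rw [← Finset.sum_sub_distrib]
  refine (Finset.abs_sum_le_sum_abs _ _).trans (Finset.sum_le_sum fun p _ => ?_)
  rw [← mul_sub, abs_mul, abs_of_nonneg (ht p q)]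
  have hw0 : 0 ≤ w q := (hφ 0 q).1.trans (hφ 0 q).2
  by_cases hq : q = 0
  · subst hq
    by_cases hp : p = 0
    · subst hp
      simp only [hM0, Fintype.expect_const, if_true, sub_self, abs_zero, mul_zero]
      exact mul_nonneg (ht _ _) (mul_nonneg hε hw0)
    · simp [ht0 p hp]
  · by_cases hp : p = 0
    · subst hp
      simp [ht0' q hq]
    · rw [if_neg hq]
      exact mul_le_mul_of_nonneg_left
        (hM.abs_sub_le hp (fun u => φ u q) (w q) fun u => hφ u q) (ht p q)

lemma ConjugatesBy.map_zero {C : Matrix (Basis01 V) (Basis01 V) ℂ} {M : Lab V → Lab V}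
    (hC : C ∈ Matrix.unitaryGroup (Basis01 V) ℂ) (hM : ConjugatesBy C M) : M 0 = 0 := by
  by_contra h
  have h1 := norm_chi_mul_left hC hM 1 0 0
  rw [mul_one, chi_zero_right hC, chi_zero_right (one_mem _), if_neg h] at h1
  simp at h1

lemma isProbabilityMeasure_haarUnitary (ι : Type) [Fintype ι] [DecidableEq ι] :
    IsProbabilityMeasure (haarUnitary ι) :=
  ⟨Measure.haarMeasure_self⟩

lemma integral_haarUnitary_mul {ι : Type} [Fintype ι] [DecidableEq ι] (f : UGroup ι → ℂ)
    (g h : UGroup ι) : ∫ U, f (g * U * h) ∂(haarUnitary ι) = ∫ U, f U ∂(haarUnitary ι) := by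
  have hH : (haarUnitary ι).IsHaarMeasure := by unfold haarUnitary; infer_instance
  have hp := isProbabilityMeasure_haarUnitary ι
  have hr : (haarUnitary ι).map (fun U => U * h) = haarUnitary ι := by
    have h1 : ((haarUnitary ι).map (fun U => U * h)).IsHaarMeasure :=
      Measure.isHaarMeasure_map_mul_right _ h
    have h2 : IsProbabilityMeasure ((haarUnitary ι).map (fun U => U * h)) :=
      Measure.isProbabilityMeasure_map (measurable_mul_const h).aemeasurable
    exact Measure.isHaarMeasure_eq_of_isProbabilityMeasure _ _
  calc ∫ U, f (g * U * h) ∂(haarUnitary ι)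
      = ∫ U, f (g * U) ∂((haarUnitary ι).map (fun U => U * h)) := by
        rw [← MeasurableEquiv.coe_mulRight, MeasureTheory.integral_map_equiv]
        simp only [MeasurableEquiv.coe_mulRight, mul_assoc]
    _ = ∫ U, f (g * U) ∂(haarUnitary ι) := by rw [hr]
    _ = _ := integral_mul_left_eq_self f g

lemma continuous_expect (A : Experiment V)
    (O : Matrix (Basis01 V × Basis01 (Fin A.m)) (Basis01 V × Basis01 (Fin A.m)) ℂ) :
    Continuous (A.expect O) := by
  have hq : ∀ q : Query, Continuous fun U : UGroup (Basis01 V) => q.apply U.1 := by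
    intro q
    cases q with
    | direct => exact continuous_subtype_val
    | transpose => exact continuous_subtype_val.matrix_transpose
    | conj => exact continuous_subtype_val.matrix_map continuous_star
    | adjoint => exact continuous_subtype_val.matrix_conjTranspose
  have hk : ∀ q : Query, Continuous fun U : UGroup (Basis01 V) =>
      q.apply U.1 ⊗ₖ (1 : Matrix (Basis01 (Fin A.m)) (Basis01 (Fin A.m)) ℂ) := by
    intro q
    refine continuous_matrix fun i j => ?_
    simp only [Matrix.kroneckerMap_apply]
    exact ((hq q).matrix_elem _ _).mul continuous_const
  have hout : Continuous A.output := by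
    unfold Experiment.output
    exact Continuous.matrix_mulVec ((((continuous_const.matrix_mul (hk _)).matrix_mul
      continuous_const).matrix_mul (hk _)).matrix_mul continuous_const) continuous_const
  unfold Experiment.expect
  exact (continuous_const.matrix_mul (hout.matrix_vecMulVec hout.star)).matrix_trace

lemma integrable_expect (A : Experiment V)
    (O : Matrix (Basis01 V × Basis01 (Fin A.m)) (Basis01 V × Basis01 (Fin A.m)) ℂ)
    (ν : Measure (UGroup (Basis01 V))) [IsFiniteMeasure ν] : Integrable (A.expect O) ν :=
  (continuous_expect A O).integrable_of_hasCompactSupport (HasCompactSupport.of_compactSpace _)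

lemma sum_norm_chi_mul_left {C : Matrix (Basis01 V) (Basis01 V) ℂ} {M : Equiv.Perm (Lab V)}
    (hC : C ∈ Matrix.unitaryGroup (Basis01 V) ℂ) (hM : ConjugatesBy C M)
    (U : Matrix (Basis01 V) (Basis01 V) ℂ) (φ : Lab V → Lab V → ℝ) :
    ∑ r, ∑ r', ‖chi (C * U) r r'‖ ^ 2 * φ r r' = ∑ p, ∑ q, ‖chi U p q‖ ^ 2 * φ (M p) q := by
  rw [← Equiv.sum_comp M fun r => ∑ r', ‖chi (C * U) r r'‖ ^ 2 * φ r r']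
  exact Finset.sum_congr rfl fun p _ => Finset.sum_congr rfl fun q _ => by
    rw [norm_chi_mul_left hC hM]

lemma sum_norm_chi_mul_right {C : Matrix (Basis01 V) (Basis01 V) ℂ} {M : Equiv.Perm (Lab V)}
    (hC : C ∈ Matrix.unitaryGroup (Basis01 V) ℂ) (hM : ConjugatesBy C M)
    (U : Matrix (Basis01 V) (Basis01 V) ℂ) (φ : Lab V → Lab V → ℝ) :
    ∑ r, ∑ r', ‖chi (U * C) r' r‖ ^ 2 * φ r r'
      = ∑ p, ∑ q, ‖chi U q p‖ ^ 2 * φ (M.symm p) q := by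
  rw [← Equiv.sum_comp M fun p => ∑ q, ‖chi U q p‖ ^ 2 * φ (M.symm p) q]
  exact Finset.sum_congr rfl fun p _ => Finset.sum_congr rfl fun q _ => by
    rw [norm_chi_mul_right hC hM, Equiv.symm_apply_apply]

lemma continuous_expectation {X ι : Type} [TopologicalSpace X] [Fintype ι] {F : ι → X → ℂ}
    (hF : ∀ i, Continuous (F i)) : Continuous fun x => 𝔼 i, F i x := by
  simp only [Fintype.expect_eq_sum_div_card]
  exact (continuous_finsetSum _ fun i _ => hF i).div_const _

lemma integral_expectation {X ι : Type} [MeasurableSpace X] [Fintype ι] {F : ι → X → ℂ}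
    {ν : Measure X} (hF : ∀ i, Integrable (F i) ν) :
    ∫ x, (𝔼 i, F i x) ∂ν = 𝔼 i, ∫ x, F i x ∂ν := by
  simp only [Fintype.expect_eq_sum_div_card]
  rw [integral_div, integral_finsetSum _ fun i _ => hF i]

lemma integrable_haarUnitary {F : UGroup (Basis01 V) → ℂ} (hF : Continuous F) :
    Integrable F (haarUnitary (Basis01 V)) :=
  have := isProbabilityMeasure_haarUnitary (Basis01 V)
  hF.integrable_of_hasCompactSupport (HasCompactSupport.of_compactSpace _)

lemma continuous_comp_mul {F : UGroup (Basis01 V) → ℂ} (hF : Continuous F)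
    (g h : UGroup (Basis01 V)) : Continuous fun U => F (g * U * h) :=
  hF.comp ((continuous_const.mul continuous_id).mul continuous_const)

/-- The average of `F` over Pauli operators applied on either side of its argument. -/
def pauliTwirl (F : UGroup (Basis01 V) → ℂ) (U : UGroup (Basis01 V)) : ℂ :=
  𝔼 r₁, 𝔼 r₂, F (pauliU r₁ * U * pauliU r₂)

lemma continuous_pauliTwirl {F : UGroup (Basis01 V) → ℂ} (hF : Continuous F) :
    Continuous (pauliTwirl F) :=
  continuous_expectation fun r₁ => continuous_expectation fun r₂ =>
    continuous_comp_mul hF (pauliU r₁) (pauliU r₂)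

lemma integral_pauliTwirl {F : UGroup (Basis01 V) → ℂ} (hF : Continuous F) :
    ∫ U, pauliTwirl F U ∂(haarUnitary (Basis01 V)) = ∫ U, F U ∂(haarUnitary (Basis01 V)) := by
  unfold pauliTwirl
  rw [integral_expectation fun r₁ => integrable_haarUnitary (continuous_expectation fun r₂ =>
    continuous_comp_mul hF (pauliU r₁) (pauliU r₂))]
  refine (Finset.expect_congr rfl fun r₁ _ => ?_).trans (Fintype.expect_const _)
  rw [integral_expectation fun r₂ =>
    integrable_haarUnitary (continuous_comp_mul hF (pauliU r₁) (pauliU r₂))]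
  refine (Finset.expect_congr rfl fun r₂ _ => ?_).trans (Fintype.expect_const _)
  exact integral_haarUnitary_mul F _ _

/-- If random Clifford unitaries `C ω` mix the non-zero Pauli labels, and their inverses do as
well, then `C ω` with random Pauli operators on either side is a design for mixed queries. -/
theorem norm_expect_sub_integral_haar_le {Ω : Type} [Fintype Ω] [Nonempty Ω]
    (C : Ω → UGroup (Basis01 V)) (M : Ω → Equiv.Perm (Lab V))
    (hC : ∀ ω, ConjugatesBy (C ω).1 (M ω)) {ε : ℝ} (hε : 0 ≤ ε)
    (hM : IsMixing (fun ω => M ω) ε) (hM' : IsMixing (fun ω => (M ω).symm) ε)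
    (A : Experiment V) (hA : A.IsMixed)
    (O : Matrix (Basis01 V × Basis01 (Fin A.m)) (Basis01 V × Basis01 (Fin A.m)) ℂ)
    (hO : O.PosSemidef) (hO' : (1 - O).PosSemidef) :
    ‖(𝔼 ω, 𝔼 r₁, 𝔼 r₂, A.expect O (pauliU r₁ * C ω * pauliU r₂))
      - ∫ U, A.expect O U ∂(haarUnitary (Basis01 V))‖ ≤ 2 * ε := by
  have hprob := isProbabilityMeasure_haarUnitary (Basis01 V)
  obtain ⟨φ, w, hφ, hw, h⟩ := exists_twirl_form A hA O hO hO'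
  change ‖(𝔼 ω, pauliTwirl (A.expect O) (C ω)) - _‖ ≤ _
  have hΦ := continuous_pauliTwirl (continuous_expect A O)
  have hΦ' := integral_pauliTwirl (continuous_expect A O)
  change (∀ U, pauliTwirl (A.expect O) U = _) ∨ (∀ U, pauliTwirl (A.expect O) U = _) at h
  generalize pauliTwirl (A.expect O) = Φ at *
  rw [← hΦ']
  have hM0 : ∀ ω, M ω 0 = 0 := fun ω => (hC ω).map_zero (C ω).2
  have hM0' : ∀ ω, (M ω).symm 0 = 0 := fun ω => by
    rw [Equiv.symm_apply_eq, hM0]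
  -- Multiplying by `C ω` on one side brings the average of `Φ`, the twirled expectation, close to a
  -- constant `B`.
  obtain ⟨B, g, g', hg, hB⟩ : ∃ (B : ℝ) (g g' : Ω → UGroup (Basis01 V)),
      (∀ ω, g ω * g' ω = C ω) ∧
      ∀ U : UGroup (Basis01 V), ‖(𝔼 ω, Φ (g ω * U * g' ω)) - (B : ℂ)‖ ≤ ε := by
    have coe_expect : ∀ F : Ω → ℝ, (𝔼 ω, ((F ω : ℝ) : ℂ)) = ((𝔼 ω, F ω : ℝ) : ℂ) := by
      intro F
      simp only [Fintype.expect_eq_sum_div_card]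
      push_cast
      rfl
    rcases h with h | h
    · refine ⟨∑ q, (if q = 0 then φ 0 0 else 𝔼 u, φ u q), C, fun _ => 1, by simp, fun U => ?_⟩
      have e : ∀ ω, Φ (C ω * U * 1)
          = ((∑ p, ∑ q, ‖chi U.1 p q‖ ^ 2 * φ (M ω p) q : ℝ) : ℂ) := by
        intro ω
        rw [mul_one, ← sum_norm_chi_mul_left (C ω).2 (hC ω)]
        exact h (C ω * U)
      simp only [e, coe_expect]
      rw [← Complex.ofReal_sub, Complex.norm_real]
      exact abs_expect_sub_le_of_isMixing hε hM hM0 (fun p q => by positivity)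
        (sum_left_norm_sq_chi U.2) (fun p hp => by simp [chi_zero_right U.2, hp])
        (fun q hq => by simp [chi_zero_left U.2, hq]) hφ hw
    · refine ⟨∑ q, (if q = 0 then φ 0 0 else 𝔼 u, φ u q), fun _ => 1, C, by simp, fun U => ?_⟩
      have e : ∀ ω, Φ (1 * U * C ω)
          = ((∑ p, ∑ q, ‖chi U.1 q p‖ ^ 2 * φ ((M ω).symm p) q : ℝ) : ℂ) := by
        intro ω
        rw [one_mul, ← sum_norm_chi_mul_right (C ω).2 (hC ω)]
        exact h (U * C ω)
      simp only [e, coe_expect]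
      rw [← Complex.ofReal_sub, Complex.norm_real]
      exact abs_expect_sub_le_of_isMixing hε hM' hM0' (fun p q => by positivity)
        (sum_right_norm_sq_chi U.2) (fun p hp => by simp [chi_zero_left U.2, hp])
        (fun q hq => by simp [chi_zero_right U.2, hq]) hφ hw
  have hΦint : ∀ ω, Integrable (fun U => Φ (g ω * U * g' ω)) (haarUnitary (Basis01 V)) :=
    fun ω => integrable_haarUnitary (continuous_comp_mul hΦ _ _)
  have hint : ∫ U, Φ U ∂(haarUnitary (Basis01 V))
      = ∫ U, (𝔼 ω, Φ (g ω * U * g' ω)) ∂(haarUnitary (Basis01 V)) := by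
    rw [integral_expectation hΦint]
    refine ((Finset.expect_congr rfl fun ω _ => ?_).trans (Fintype.expect_const _)).symm
    exact integral_haarUnitary_mul Φ _ _
  have hfirst : ‖(𝔼 ω, Φ (C ω)) - (B : ℂ)‖ ≤ ε := by
    have := hB 1
    simpa only [mul_one, hg] using this
  have hsecond : ‖(B : ℂ) - ∫ U, Φ U ∂(haarUnitary (Basis01 V))‖ ≤ ε := by
    have hi : Integrable (fun U => 𝔼 ω, Φ (g ω * U * g' ω)) (haarUnitary (Basis01 V)) := by
      exact integrable_haarUnitary
        (continuous_expectation fun ω => continuous_comp_mul hΦ _ _)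
    have h1 : (B : ℂ) - ∫ U, Φ U ∂(haarUnitary (Basis01 V))
        = ∫ U, ((B : ℂ) - 𝔼 ω, Φ (g ω * U * g' ω)) ∂(haarUnitary (Basis01 V)) := by
      rw [integral_sub (integrable_const _) hi, hint]
      simp
    rw [h1]
    refine (norm_integral_le_of_norm_le_const (C := ε) (Filter.Eventually.of_forall fun U => ?_)).trans
      (by simp)
    rw [norm_sub_rev]
    exact hB U
  calc _ = ‖((𝔼 ω, Φ (C ω)) - (B : ℂ))
        + ((B : ℂ) - ∫ U, Φ U ∂(haarUnitary (Basis01 V)))‖ := by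
        rw [sub_add_sub_cancel]
    _ ≤ ε + ε := (norm_add_le _ _).trans (add_le_add hfirst hsecond)
    _ = 2 * ε := by ring

/-! ### Clifford gates and circuits -/

section Embedding

variable (s : Finset V)

/-- The basis labels of all qubits, split into those of the qubits in `s` and those of the other
qubits. -/
def splitBasis : Basis01 V ≃ Basis01 s × Basis01 {w // w ∉ s} :=
  Equiv.piEquivPiSubtypeProd (fun w => w ∈ s) fun _ => Fin 2

lemma pauli_eq_submatrix (v : Lab V) :
    pauli v = ((pauli fun w : s => v w) ⊗ₖ (pauli fun w : {w // w ∉ s} => v w)).submatrix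
      (splitBasis s) (splitBasis s) := by
  ext x y
  simp only [Matrix.submatrix_apply, Matrix.kroneckerMap_apply, pauli_apply]
  convert (Fintype.prod_subtype_mul_prod_subtype (fun w => w ∈ s)
    fun w => (pauliEntry (v w) (x w) (y w) : ℂ)).symm <;> rfl

end Embedding

section Gates

variable {G : SimpleGraph V}

lemma gate_toMatrix_eq_submatrix (g : Gate G) :
    g.toMatrix = ((g.op : Matrix (Basis01 g.support) (Basis01 g.support) ℂ) ⊗ₖ
      (1 : Matrix (Basis01 {w // w ∉ g.support}) (Basis01 {w // w ∉ g.support}) ℂ)).submatrix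
        (splitBasis g.support) (splitBasis g.support) := by
  ext x y
  have h : (∀ w, w ∉ g.support → x w = y w) ↔
      (splitBasis g.support x).2 = (splitBasis g.support y).2 := by
    rw [funext_iff, Subtype.forall]
    rfl
  simp only [Gate.toMatrix, Matrix.submatrix_apply, Matrix.kroneckerMap_apply,
    Matrix.one_apply, mul_ite, mul_one, mul_zero, h]
  rfl

lemma gate_toMatrix_mem_unitary (g : Gate G) :
    g.toMatrix ∈ Matrix.unitaryGroup (Basis01 V) ℂ := by
  have h := Matrix.kronecker_mem_unitary g.op.2
    (one_mem (Matrix.unitaryGroup (Basis01 {w // w ∉ g.support}) ℂ))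
  rw [Matrix.mem_unitaryGroup_iff, Matrix.star_eq_conjTranspose] at h ⊢
  rw [gate_toMatrix_eq_submatrix, Matrix.conjTranspose_submatrix, Matrix.submatrix_mul_equiv, h,
    Matrix.submatrix_one_equiv]

lemma gate_toMatrix_mul_pauli (g : Gate G) (v : Lab V) (u : Lab g.support) (z : ℂ)
    (h : g.op.1 * pauli (fun w : g.support => v w) = z • (pauli u * g.op.1)) :
    g.toMatrix * pauli v
      = z • (pauli (fun w => if hw : w ∈ g.support then u ⟨w, hw⟩ else v w) * g.toMatrix) := by
  have e : (fun w : g.support => if hw : (w : V) ∈ g.support then u ⟨w, hw⟩ else v w) = u :=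
    funext fun w => dif_pos w.2
  have e' : (fun w : {w // w ∉ g.support} =>
      if hw : (w : V) ∈ g.support then u ⟨w, hw⟩ else v w)
      = fun w : {w // w ∉ g.support} => v w :=
    funext fun w : {w // w ∉ g.support} => dif_neg w.2
  rw [gate_toMatrix_eq_submatrix, pauli_eq_submatrix g.support v,
    pauli_eq_submatrix g.support (fun w => if hw : w ∈ g.support then u ⟨w, hw⟩ else v w), e, e',
    Matrix.submatrix_mul_equiv, Matrix.submatrix_mul_equiv, ← Matrix.mul_kronecker_mul,
    ← Matrix.mul_kronecker_mul, h, one_mul, mul_one, Matrix.smul_kronecker, Matrix.submatrix_smul]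
  rfl

end Gates

lemma ConjugatesBy.mul {U U' : Matrix (Basis01 V) (Basis01 V) ℂ} {M M' : Lab V → Lab V}
    (h : ConjugatesBy U M) (h' : ConjugatesBy U' M') : ConjugatesBy (U * U') (M ∘ M') := by
  intro v
  obtain ⟨z', hz', e'⟩ := h' v
  obtain ⟨z, hz, e⟩ := h (M' v)
  refine ⟨z' * z, by rw [norm_mul, hz, hz', one_mul], ?_⟩
  rw [Matrix.mul_assoc, e', Matrix.mul_smul, ← Matrix.mul_assoc, e, Matrix.smul_mul, smul_smul,
    Matrix.mul_assoc]
  rfl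

lemma ConjugatesBy.one : ConjugatesBy (1 : Matrix (Basis01 V) (Basis01 V) ℂ) id :=
  fun v => ⟨1, norm_one, by simp⟩

lemma ConjugatesBy.conjTranspose {U : Matrix (Basis01 V) (Basis01 V) ℂ}
    (hU : U ∈ Matrix.unitaryGroup (Basis01 V) ℂ) {M : Equiv.Perm (Lab V)}
    (h : ConjugatesBy U M) : ConjugatesBy Uᴴ M.symm := by
  intro v
  obtain ⟨z, hz, e⟩ := h (M.symm v)
  rw [Equiv.apply_symm_apply] at e
  have hz0 : z ≠ 0 := fun h0 => by simp [h0] at hz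
  have h1 : U * Uᴴ = 1 := Matrix.mem_unitaryGroup_iff.mp hU
  have h2 : Uᴴ * U = 1 := Matrix.mem_unitaryGroup_iff'.mp hU
  refine ⟨z⁻¹, by rw [norm_inv, hz, inv_one], ?_⟩
  have e2 : pauli (M.symm v) * Uᴴ = z • (Uᴴ * pauli v) := by
    calc pauli (M.symm v) * Uᴴ = Uᴴ * (U * pauli (M.symm v)) * Uᴴ := by
          rw [← Matrix.mul_assoc, h2, one_mul]
      _ = z • (Uᴴ * pauli v * (U * Uᴴ)) := by
          rw [e]; simp only [Matrix.mul_smul, Matrix.smul_mul, Matrix.mul_assoc]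
      _ = _ := by rw [h1, mul_one]
  rw [e2, smul_smul, inv_mul_cancel₀ hz0, one_smul]

section Layers

variable {G : SimpleGraph V}

/-- Up to phases, some layer of gates on the qubits `A` acts on Pauli labels by `M`. -/
def LayerOn (G : SimpleGraph V) (A : Finset V) (M : Lab V → Lab V) : Prop :=
  ∃ L : List (Gate G), L.Pairwise (fun g h => Disjoint g.support h.support) ∧
    (∀ g ∈ L, g.support ⊆ A) ∧ ConjugatesBy (L.map Gate.toMatrix).prod M

lemma LayerOn.empty : LayerOn G ∅ id :=
  ⟨[], List.Pairwise.nil, by simp, by simpa using ConjugatesBy.one⟩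

lemma LayerOn.comp {A B : Finset V} {M M' : Lab V → Lab V} (hAB : Disjoint A B)
    (h : LayerOn G A M) (h' : LayerOn G B M') : LayerOn G (A ∪ B) (M ∘ M') := by
  obtain ⟨L, h1, h2, h3⟩ := h
  obtain ⟨L', h1', h2', h3'⟩ := h'
  refine ⟨L ++ L', List.pairwise_append.mpr ⟨h1, h1', fun g hg g' hg' =>
    hAB.mono (h2 g hg) (h2' g' hg')⟩, fun g hg => ?_, ?_⟩
  · rcases List.mem_append.mp hg with hg | hg
    · exact (h2 g hg).trans Finset.subset_union_left
    · exact (h2' g hg).trans Finset.subset_union_right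
  · rw [List.map_append, List.prod_append]
    exact h3.mul h3'

lemma LayerOn.of_gate (g : Gate G) (M : Lab V → Lab V) (h : ConjugatesBy g.toMatrix M) :
    LayerOn G g.support M :=
  ⟨[g], List.pairwise_singleton _ _, by simp, by simpa using h⟩

lemma hasCircuitDepth_one (d : ℕ) : HasCircuitDepth G d 1 :=
  ⟨⟨[], by simp⟩, Nat.zero_le _, rfl⟩

lemma hasCircuitDepth_mul {d d' : ℕ} {U U' : UGroup (Basis01 V)} (h : HasCircuitDepth G d U)
    (h' : HasCircuitDepth G d' U') : HasCircuitDepth G (d + d') (U * U') := by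
  obtain ⟨⟨L, hL⟩, h1, h2⟩ := h
  obtain ⟨⟨L', hL'⟩, h1', h2'⟩ := h'
  refine ⟨⟨L ++ L', fun l hl => ?_⟩, ?_, ?_⟩
  · rcases List.mem_append.mp hl with hl | hl
    · exact hL l hl
    · exact hL' l hl
  · simp only [Circuit.depth, List.length_append] at *
    omega
  · simp only [Circuit.toMatrix, List.map_append, List.prod_append] at *
    rw [h2, h2']
    rfl

/-- The inverse of a gate. -/
def invGate (g : Gate G) : Gate G := ⟨g.support, g.isLocal, g.op⁻¹⟩

lemma toMatrix_invGate (g : Gate G) : (invGate g).toMatrix = (g.toMatrix)ᴴ := by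
  ext x y
  rw [Matrix.conjTranspose_apply]
  by_cases h : ∀ w, w ∉ g.support → x w = y w
  · exact (if_pos h).trans (congrArg star (if_pos fun w hw => (h w hw).symm)).symm
  · refine (if_neg h).trans (Eq.trans (star_zero ℂ).symm (congrArg star ?_))
    exact (if_neg fun h' => h fun w hw => (h' w hw).symm).symm

lemma hasCircuitDepth_inv {d : ℕ} {U : UGroup (Basis01 V)} (h : HasCircuitDepth G d U) :
    HasCircuitDepth G d U⁻¹ := by
  obtain ⟨⟨L, hL⟩, h1, h2⟩ := h
  refine ⟨⟨(L.map fun l => (l.map invGate).reverse).reverse, fun l hl => ?_⟩, ?_, ?_⟩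
  · rw [List.mem_reverse, List.mem_map] at hl
    obtain ⟨l', hl', rfl⟩ := hl
    rw [List.pairwise_reverse, List.pairwise_map]
    exact (hL l' hl').imp fun hd => hd.symm
  · simpa [Circuit.depth] using h1
  · have hprod : ∀ l : List (Matrix (Basis01 V) (Basis01 V) ℂ),
        (l.map Matrix.conjTranspose).reverse.prod = (l.prod)ᴴ := by
      intro l
      rw [Matrix.conjTranspose_list_prod]
    simp only [Circuit.toMatrix] at h2 ⊢
    have e : ∀ l : List (Gate G), (((l.map invGate).reverse).map Gate.toMatrix).prod
        = ((l.map Gate.toMatrix).prod)ᴴ := by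
      intro l
      rw [← hprod, List.map_reverse, List.map_map, List.map_map]
      congr 2
      exact List.map_congr_left fun g _ => toMatrix_invGate g
    have hinv : ((U⁻¹ : UGroup (Basis01 V)) : Matrix (Basis01 V) (Basis01 V) ℂ) = (U.1)ᴴ := rfl
    rw [List.map_reverse, List.map_map, hinv, ← h2, ← hprod, List.map_map]
    congr 2
    exact List.map_congr_left fun l _ => e l

/-- Some circuit of depth at most `d` acts on Pauli labels by `M`, up to phases. -/
def CliffordDepth (G : SimpleGraph V) (d : ℕ) (M : Equiv.Perm (Lab V)) : Prop :=
  ∃ U : UGroup (Basis01 V), HasCircuitDepth G d U ∧ ConjugatesBy U.1 M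

lemma CliffordDepth.one (d : ℕ) : CliffordDepth G d 1 :=
  ⟨1, hasCircuitDepth_one d, ConjugatesBy.one⟩

lemma CliffordDepth.mul {d d' : ℕ} {M M' : Equiv.Perm (Lab V)} (h : CliffordDepth G d M)
    (h' : CliffordDepth G d' M') : CliffordDepth G (d + d') (M * M') := by
  obtain ⟨U, h1, h2⟩ := h
  obtain ⟨U', h1', h2'⟩ := h'
  exact ⟨U * U', hasCircuitDepth_mul h1 h1', h2.mul h2'⟩

lemma CliffordDepth.inv {d : ℕ} {M : Equiv.Perm (Lab V)} (h : CliffordDepth G d M) :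
    CliffordDepth G d M⁻¹ := by
  obtain ⟨U, h1, h2⟩ := h
  exact ⟨U⁻¹, hasCircuitDepth_inv h1, h2.conjTranspose U.2⟩

lemma hasCircuitDepth_of_layer (L : List (Gate G))
    (hL : L.Pairwise (fun g h => Disjoint g.support h.support)) (U : UGroup (Basis01 V))
    (hU : (L.map Gate.toMatrix).prod = U.1) : HasCircuitDepth G 1 U :=
  ⟨⟨[L], by simpa using hL⟩, le_rfl, by simpa [Circuit.toMatrix] using hU⟩

lemma LayerOn.cliffordDepth {A : Finset V} {M : Equiv.Perm (Lab V)} (h : LayerOn G A M) :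
    CliffordDepth G 1 M := by
  obtain ⟨L, h1, -, h3⟩ := h
  have hmem : (L.map Gate.toMatrix).prod ∈ Matrix.unitaryGroup (Basis01 V) ℂ :=
    Submonoid.list_prod_mem _ fun A hA => by
      obtain ⟨g, -, rfl⟩ := List.mem_map.mp hA
      exact gate_toMatrix_mem_unitary g
  exact ⟨⟨_, hmem⟩, hasCircuitDepth_of_layer L h1 _ rfl, h3⟩

end Layers

/-! ### Exchange, phase and Hadamard layers -/

lemma submatrix_mem_unitary {ι κ : Type} [Fintype ι] [DecidableEq ι] [Fintype κ] [DecidableEq κ]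
    (e : ι ≃ κ) {A : Matrix κ κ ℂ} (hA : A ∈ Matrix.unitaryGroup κ ℂ) :
    A.submatrix e e ∈ Matrix.unitaryGroup ι ℂ := by
  rw [Matrix.mem_unitaryGroup_iff, Matrix.star_eq_conjTranspose] at hA ⊢
  rw [Matrix.conjTranspose_submatrix, Matrix.submatrix_mul_equiv, hA, Matrix.submatrix_one_equiv]

/-- The action on labels that agrees with `N` on the qubits in `A` and fixes the labels of all
other qubits. -/
def onSet (A : Finset V) (N : Lab V → Lab V) (v : Lab V) : Lab V :=
  fun x => if x ∈ A then N v x else v x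

section SingleQubit

variable {G : SimpleGraph V}

/-- The basis labels of a single qubit. -/
def singleBasis (u : V) : Basis01 ({u} : Finset V) ≃ Fin 2 where
  toFun x := x ⟨u, Finset.mem_singleton_self u⟩
  invFun i _ := i
  left_inv x := by
    funext w
    exact congrArg x (Subtype.ext (Finset.mem_singleton.mp w.2).symm)
  right_inv _ := rfl

/-- The gate that applies `A` to the qubit `u`. -/
def singleGate (G : SimpleGraph V) (u : V) (A : UGroup (Fin 2)) : Gate G :=
  ⟨{u}, Or.inl ⟨u, rfl⟩, ⟨A.1.submatrix (singleBasis u) (singleBasis u),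
    submatrix_mem_unitary _ A.2⟩⟩

lemma pauli_singleton (u : V) (p : Lab ({u} : Finset V)) :
    pauli p = (sitePauli (p ⟨u, Finset.mem_singleton_self u⟩)).submatrix
      (singleBasis u) (singleBasis u) := by
  ext x y
  have : Subsingleton ({u} : Finset V) :=
    ⟨fun a b => Subtype.ext ((Finset.mem_singleton.mp a.2).trans (Finset.mem_singleton.mp b.2).symm)⟩
  exact Fintype.prod_subsingleton (fun w => (pauliEntry (p w) (x w) (y w) : ℂ))
    (⟨u, Finset.mem_singleton_self u⟩ : ({u} : Finset V))

lemma LayerOn.single (u : V) (A : UGroup (Fin 2)) (N : Lab V → Lab V)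
    (h : ∀ v : Lab V, ∃ z : ℂ, ‖z‖ = 1 ∧ A.1 * sitePauli (v u) = z • (sitePauli (N v u) * A.1)) :
    LayerOn G {u} (onSet {u} N) := by
  refine LayerOn.of_gate (singleGate G u A) _ fun v => ?_
  obtain ⟨z, hz, e⟩ := h v
  have key : A.1.submatrix (singleBasis u) (singleBasis u)
        * pauli (fun w : ({u} : Finset V) => v w)
      = z • (pauli (fun w : ({u} : Finset V) => N v w)
        * A.1.submatrix (singleBasis u) (singleBasis u)) := by
    rw [pauli_singleton, pauli_singleton, Matrix.submatrix_mul_equiv, Matrix.submatrix_mul_equiv, e]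
    rfl
  exact ⟨z, hz, gate_toMatrix_mul_pauli (singleGate G u A) v (fun w => N v w) z key⟩

/-- The entries of the Hadamard matrix, up to normalisation. -/
def hadamardEntry (i j : Fin 2) : ℤ := if i = 1 ∧ j = 1 then -1 else 1

lemma hadamardEntry_mul : ∀ i j : Fin 2, ∑ k, hadamardEntry i k * hadamardEntry j k
    = if i = j then 2 else 0 := by decide

lemma hadamardEntry_mul_pauliEntry : ∀ (p : ZMod 2 × ZMod 2) (i j : Fin 2),
    ∑ k, hadamardEntry i k * pauliEntry p k j
      = (if p.1 * p.2 = 0 then 1 else -1) * ∑ k, pauliEntry p.swap i k * hadamardEntry k j := by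
  decide

/-- The Hadamard gate. -/
def hadamard : UGroup (Fin 2) :=
  ⟨((√2 : ℝ) : ℂ)⁻¹ • Matrix.of fun i j => (hadamardEntry i j : ℂ), by
    rw [Matrix.mem_unitaryGroup_iff, Matrix.star_eq_conjTranspose]
    ext i j
    have h2 : ((√2 : ℝ) : ℂ)⁻¹ * ((√2 : ℝ) : ℂ)⁻¹ = 2⁻¹ := by
      rw [← mul_inv, ← Complex.ofReal_mul, Real.mul_self_sqrt (by norm_num)]
      simp
    have h := hadamardEntry_mul i j
    have h' : ∑ k, (hadamardEntry i k : ℂ) * (hadamardEntry j k : ℂ) = if i = j then 2 else 0 := by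
      exact_mod_cast h
    calc _ = ∑ k, (((√2 : ℝ) : ℂ)⁻¹ * ((√2 : ℝ) : ℂ)⁻¹)
          * ((hadamardEntry i k : ℂ) * (hadamardEntry j k : ℂ)) := by
          simp only [Matrix.mul_apply, Matrix.conjTranspose_apply, Matrix.smul_apply, smul_eq_mul,
            Matrix.of_apply, star_mul', star_inv₀, Complex.star_def, Complex.conj_ofReal, map_intCast]
          exact Finset.sum_congr rfl fun k _ => by ring
      _ = _ := by
          rw [← Finset.mul_sum, h', h2, Matrix.one_apply]
          split_ifs <;> simp⟩

lemma hadamard_mul_sitePauli (p : ZMod 2 × ZMod 2) : ∃ z : ℂ, ‖z‖ = 1 ∧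
    hadamard.1 * sitePauli p = z • (sitePauli p.swap * hadamard.1) := by
  refine ⟨((if p.1 * p.2 = 0 then 1 else -1 : ℤ) : ℂ), by split_ifs <;> simp, ?_⟩
  rw [hadamard]
  simp only [Matrix.smul_mul, Matrix.mul_smul]
  rw [smul_comm]
  congr 1
  ext i j
  simp only [Matrix.mul_apply, Matrix.smul_apply, Matrix.of_apply, sitePauli, smul_eq_mul]
  exact_mod_cast hadamardEntry_mul_pauliEntry p i j

/-- The phase gate `diag(1, i)` for `s = 1`, and the identity for `s = 0`. -/
def phaseGate (s : ZMod 2) : UGroup (Fin 2) :=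
  ⟨Matrix.diagonal fun i => if s = 1 ∧ i = 1 then Complex.I else 1, by
    rw [Matrix.mem_unitaryGroup_iff, Matrix.star_eq_conjTranspose, Matrix.diagonal_conjTranspose,
      Matrix.diagonal_mul_diagonal, ← Matrix.diagonal_one]
    congr 1
    funext i
    simp only [Pi.star_apply]
    split_ifs <;> simp⟩

/-- The label of a qubit with label `p` and partner `q` after it has been exchanged with its
partner, together with a controlled-`Z` gate if `s = 1`. For a qubit that is its own partner this
is the action of the phase gate. -/
def exchange (s : ZMod 2) (p q : ZMod 2 × ZMod 2) : ZMod 2 × ZMod 2 := (q.1, q.2 + s * p.1)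

lemma phaseGate_mul_sitePauli (s : ZMod 2) (p : ZMod 2 × ZMod 2) : ∃ z : ℂ, ‖z‖ = 1 ∧
    (phaseGate s).1 * sitePauli p = z • (sitePauli (exchange s p p) * (phaseGate s).1) := by
  refine ⟨if s = 1 ∧ p.1 = 1 then Complex.I else 1, by split_ifs <;> simp, ?_⟩
  obtain ⟨a, b⟩ := p
  ext i j
  simp only [phaseGate, Matrix.diagonal_mul, Matrix.smul_apply, Matrix.mul_diagonal, smul_eq_mul,
    sitePauli, exchange]
  have key : ∀ (s a b : ZMod 2) (i j : Fin 2),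
      (s = 0 ∧ pauliEntry (a, b) i j = pauliEntry (a, b + s * a) i j) ∨
      (s = 1 ∧ a = 0 ∧ i ≠ j ∧ pauliEntry (a, b) i j = 0 ∧ pauliEntry (a, b + s * a) i j = 0) ∨
      (s = 1 ∧ a = 0 ∧ i = j ∧ pauliEntry (a, b) i j = pauliEntry (a, b + s * a) i j) ∨
      (s = 1 ∧ a = 1 ∧ i = j ∧ pauliEntry (a, b) i j = 0 ∧ pauliEntry (a, b + s * a) i j = 0) ∨
      (s = 1 ∧ a = 1 ∧ i = 1 ∧ j = 0 ∧
        pauliEntry (a, b) i j = pauliEntry (a, b + s * a) i j) ∨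
      (s = 1 ∧ a = 1 ∧ i = 0 ∧ j = 1 ∧
        pauliEntry (a, b) i j = - pauliEntry (a, b + s * a) i j) := by decide
  rcases key s a b i j with ⟨h1, h⟩ | ⟨h1, h2, h3, h4, h5⟩ | ⟨h1, h2, h3, h⟩ |
    ⟨h1, h2, h3, h4, h5⟩ | ⟨h1, h2, h3, h4, h⟩ | ⟨h1, h2, h3, h4, h⟩
  · rw [h]; simp [h1]
  · rw [h4, h5]; simp
  · rw [h]; subst h3; simp [h1, h2, mul_comm]
  · rw [h4, h5]; simp
  · rw [h]; simp [h1, h2, h3, h4]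
  · rw [h]; simp [h1, h2, h3, h4]
    linear_combination (-(pauliEntry (1, b + 1) 0 1 : ℂ)) * Complex.I_mul_I

end SingleQubit

section Pair

variable {G : SimpleGraph V}

/-- The basis labels of a pair of qubits. -/
def pairBasis {u w : V} (h : u ≠ w) : Basis01 ({u, w} : Finset V) ≃ Fin 2 × Fin 2 where
  toFun x := (x ⟨u, by simp⟩, x ⟨w, by simp⟩)
  invFun i a := if a.1 = u then i.1 else i.2
  left_inv x := by
    funext ⟨a, ha⟩
    rcases Finset.mem_insert.mp ha with rfl | ha
    · simp
    · obtain rfl := Finset.mem_singleton.mp ha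
      simp [h.symm]
  right_inv i := by simp [h.symm]

lemma pauli_pair {u w : V} (h : u ≠ w) (p : Lab ({u, w} : Finset V)) :
    pauli p = ((sitePauli (p ⟨u, by simp⟩)) ⊗ₖ (sitePauli (p ⟨w, by simp⟩))).submatrix
      (pairBasis h) (pairBasis h) := by
  ext x y
  refine Fintype.prod_eq_mul (⟨u, by simp⟩ : ({u, w} : Finset V)) ⟨w, by simp⟩
    (fun e => h (congrArg Subtype.val e)) fun a ha => ?_
  rcases Finset.mem_insert.mp a.2 with ha' | ha'
  · exact absurd (Subtype.ext ha') ha.1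
  · exact absurd (Subtype.ext (Finset.mem_singleton.mp ha')) ha.2

/-- The sign of a controlled-`Z` gate. -/
def czSign (s : ZMod 2) (i j : Fin 2) : ℤ := if s = 1 ∧ i = 1 ∧ j = 1 then -1 else 1

/-- The entries of the exchange gate of two qubits, with a controlled-`Z` gate if `s = 1`. -/
def exchangeEntry (s : ZMod 2) (i k : Fin 2 × Fin 2) : ℤ :=
  if k = i.swap then czSign s i.1 i.2 else 0

lemma exchangeEntry_mul : ∀ (s : ZMod 2) (i j : Fin 2 × Fin 2),
    ∑ k, exchangeEntry s i k * exchangeEntry s j k = if i = j then 1 else 0 := by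
  decide

set_option maxRecDepth 4000 in
lemma exchangeEntry_mul_pauliEntry : ∀ (s : ZMod 2) (p q : ZMod 2 × ZMod 2) (i k j l : Fin 2),
    czSign s i k * (pauliEntry p k j * pauliEntry q i l)
      = (if s * p.1 * q.1 = 0 then 1 else -1) *
        (pauliEntry (exchange s p q) i l * pauliEntry (exchange s q p) k j * czSign s l j) := by
  decide

/-- The exchange gate of two qubits, with a controlled-`Z` gate if `s = 1`. -/
def exchangeGate (s : ZMod 2) : UGroup (Fin 2 × Fin 2) :=
  ⟨Matrix.of fun i k => (exchangeEntry s i k : ℂ), by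
    rw [Matrix.mem_unitaryGroup_iff, Matrix.star_eq_conjTranspose]
    ext i j
    have h := exchangeEntry_mul s i j
    simp only [Matrix.mul_apply, Matrix.conjTranspose_apply, Matrix.of_apply, Complex.star_def,
      map_intCast, Matrix.one_apply]
    exact_mod_cast h⟩

lemma exchangeGate_mul (s : ZMod 2) (p q : ZMod 2 × ZMod 2) : ∃ z : ℂ, ‖z‖ = 1 ∧
    (exchangeGate s).1 * (sitePauli p ⊗ₖ sitePauli q)
      = z • ((sitePauli (exchange s p q) ⊗ₖ sitePauli (exchange s q p)) * (exchangeGate s).1) := by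
  refine ⟨((if s * p.1 * q.1 = 0 then 1 else -1 : ℤ) : ℂ), by split_ifs <;> simp, ?_⟩
  ext ⟨i, k⟩ ⟨j, l⟩
  have h := exchangeEntry_mul_pauliEntry s p q i k j l
  rw [Matrix.smul_apply, Matrix.mul_apply, Matrix.mul_apply,
    Finset.sum_eq_single (k, i) (fun b _ hb => ?_) (by simp),
    Finset.sum_eq_single (l, j) (fun b _ hb => ?_) (by simp)]
  · simp only [exchangeGate, exchangeEntry, Matrix.of_apply, Prod.swap_prod_mk, if_true,
      Matrix.kroneckerMap_apply,
      sitePauli, smul_eq_mul]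
    exact_mod_cast h
  · have : ((j, l) : Fin 2 × Fin 2) ≠ b.swap := fun e => hb (by rw [← Prod.swap_swap b, ← e]; rfl)
    simp [exchangeGate, exchangeEntry, this]
  · have : b ≠ ((i, k) : Fin 2 × Fin 2).swap := hb
    simp only [exchangeGate, exchangeEntry, Matrix.of_apply, if_neg this]
    simp

lemma LayerOn.pair {u w : V} (hadj : G.Adj u w) (s : ZMod 2) (N : Lab V → Lab V)
    (hu : ∀ v, N v u = exchange s (v u) (v w)) (hw : ∀ v, N v w = exchange s (v w) (v u)) :
    LayerOn G {u, w} (onSet {u, w} N) := by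
  have hne : u ≠ w := hadj.ne
  set B := (exchangeGate s).1.submatrix (pairBasis hne) (pairBasis hne) with hB
  let g : Gate G := ⟨{u, w}, Or.inr ⟨u, w, hadj, rfl⟩, ⟨B, submatrix_mem_unitary _ (exchangeGate s).2⟩⟩
  refine LayerOn.of_gate g _ fun v => ?_
  obtain ⟨z, hz, e⟩ := exchangeGate_mul s (v u) (v w)
  have key : B * pauli (fun a : ({u, w} : Finset V) => v a)
      = z • (pauli (fun a : ({u, w} : Finset V) => N v a) * B) := by
    rw [pauli_pair hne, pauli_pair hne, hu, hw, hB, Matrix.submatrix_mul_equiv,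
      Matrix.submatrix_mul_equiv, e]
    rfl
  exact ⟨z, hz, gate_toMatrix_mul_pauli g v (fun a => N v a) z key⟩

end Pair

section WholeLayers

variable {G : SimpleGraph V}

/-- The action on labels of a layer in which every qubit `x` is exchanged with its partner `τ x`,
and a phase of strength `s x` is applied. -/
def exchangeLayer (τ : V → V) (s : V → ZMod 2) (v : Lab V) : Lab V :=
  fun x => exchange (s x) (v x) (v (τ x))

lemma layerOn_exchangeLayer {τ : V → V} {s : V → ZMod 2} (hτ : ∀ x, τ (τ x) = x)
    (hadj : ∀ x, τ x = x ∨ G.Adj x (τ x)) (hs : ∀ x, s (τ x) = s x) (A : Finset V)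
    (hA : ∀ x ∈ A, τ x ∈ A) : LayerOn G A (onSet A (exchangeLayer τ s)) := by
  induction A using Finset.strongInduction with
  | H A ih =>
    rcases A.eq_empty_or_nonempty with rfl | ⟨x, hx⟩
    · have : onSet ∅ (exchangeLayer τ s) = id := by
        funext v x
        simp [onSet]
      rw [this]
      exact LayerOn.empty
    · set B : Finset V := {x, τ x} with hB
      have hBA : B ⊆ A := by
        intro y hy
        rcases Finset.mem_insert.mp hy with rfl | hy
        · exact hx
        · rw [Finset.mem_singleton.mp hy]; exact hA x hx
      have hBτ : ∀ y, τ y ∈ B ↔ y ∈ B := by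
        have h1 : ∀ y, y ∈ B → τ y ∈ B := by
          intro y hy
          rcases Finset.mem_insert.mp hy with rfl | hy
          · simp [hB]
          · rw [Finset.mem_singleton.mp hy, hτ]; simp [hB]
        exact fun y => ⟨fun h => hτ y ▸ h1 _ h, h1 y⟩
      have hlayer : LayerOn G B (onSet B (exchangeLayer τ s)) := by
        rcases hadj x with h | h
        · have hB' : B = {x} := by rw [hB, h]; simp
          rw [hB']
          refine LayerOn.single x (phaseGate (s x)) _ fun v => ?_
          simp only [exchangeLayer, h]
          exact phaseGate_mul_sitePauli _ _
        · refine LayerOn.pair h (s x) _ (fun v => rfl) fun v => ?_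
          simp only [exchangeLayer, hs, hτ]
      have hrest := ih (A \ B) (Finset.sdiff_ssubset hBA ⟨x, by simp [hB]⟩) fun y hy => by
        rw [Finset.mem_sdiff] at hy ⊢
        exact ⟨hA y hy.1, fun h => hy.2 ((hBτ y).mp h)⟩
      have hcomp := hlayer.comp Finset.disjoint_sdiff hrest
      rw [Finset.union_sdiff_of_subset hBA] at hcomp
      have hmap : onSet A (exchangeLayer τ s)
          = onSet B (exchangeLayer τ s) ∘ onSet (A \ B) (exchangeLayer τ s) := by
        funext v y
        simp only [onSet, Function.comp_apply, exchangeLayer, Finset.mem_sdiff, hBτ]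
        by_cases hy : y ∈ B
        · simp [hy, hBA hy]
        · simp [hy]
      rw [hmap]
      exact hcomp

lemma layerOn_hadamard (A : Finset V) : LayerOn G A (onSet A fun v x => (v x).swap) := by
  induction A using Finset.induction_on with
  | empty =>
    have : onSet ∅ (fun (v : Lab V) x => (v x).swap) = id := by
      funext v x
      simp [onSet]
    rw [this]
    exact LayerOn.empty
  | insert u A hu ih =>
    have h := (LayerOn.single (G := G) u hadamard (fun v x => (v x).swap)
      fun v => hadamard_mul_sitePauli _).comp (Finset.disjoint_singleton_left.mpr hu) ih
    have hmap : onSet (insert u A) (fun (v : Lab V) x => (v x).swap)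
        = onSet {u} (fun v x => (v x).swap) ∘ onSet A (fun v x => (v x).swap) := by
      funext v y
      simp only [onSet, Function.comp_apply, Finset.mem_insert, Finset.mem_singleton]
      by_cases hy : y = u
      · subst hy; simp [hu]
      · simp [hy]
    rw [hmap]
    exact h

lemma pauli_update_mul (u : V) (p : ZMod 2 × ZMod 2) (r : Lab V) (hr : r u = 0) :
    pauli (Function.update (0 : Lab V) u p) * pauli r = pauli (Function.update r u p) := by
  have h0 : sitePauli 0 = 1 := by
    ext i j
    simp only [sitePauli, pauliEntry_zero, Matrix.one_apply]
    split_ifs <;> simp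
  rw [pauli, pauli, tensor_mul, pauli]
  congr 1
  funext w
  by_cases hw : w = u
  · subst hw; simp [hr, h0]
  · simp [Function.update_of_ne hw, h0]

lemma sitePauli_mem_unitary (p : ZMod 2 × ZMod 2) :
    sitePauli p ∈ Matrix.unitaryGroup (Fin 2) ℂ := by
  have : (sitePauli p)ᴴ = (sitePauli p)ᵀ := by
    ext i j
    simp [sitePauli]
  rw [Matrix.mem_unitaryGroup_iff, Matrix.star_eq_conjTranspose, this, sitePauli_mul_transpose]

lemma singleGate_sitePauli (u : V) (p : ZMod 2 × ZMod 2) :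
    (singleGate G u ⟨sitePauli p, sitePauli_mem_unitary p⟩).toMatrix
      = pauli (Function.update (0 : Lab V) u p) := by
  rw [gate_toMatrix_eq_submatrix, pauli_eq_submatrix {u}]
  have h1 := pauli_singleton u (fun w => Function.update (0 : Lab V) u p w)
  have h2 : (fun w : {w // w ∉ ({u} : Finset V)} => Function.update (0 : Lab V) u p w) = 0 := by
    funext ⟨w, hw⟩
    simp [Function.update_of_ne (fun h => hw (Finset.mem_singleton.mpr h) : w ≠ u)]
  rw [h1, h2, pauli_zero]
  simp only [Function.update_self]
  rfl

lemma hasCircuitDepth_pauliU (r : Lab V) : HasCircuitDepth G 1 (pauliU r) := by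
  have h : ∀ A : Finset V, ∃ L : List (Gate G),
      L.Pairwise (fun g h => Disjoint g.support h.support) ∧ (∀ g ∈ L, g.support ⊆ A) ∧
      (L.map Gate.toMatrix).prod = pauli fun x => if x ∈ A then r x else 0 := by
    intro A
    induction A using Finset.induction_on with
    | empty => exact ⟨[], by simp, by simp, by
      simp only [List.map_nil, List.prod_nil, Finset.notMem_empty, if_false]
      exact pauli_zero.symm⟩
    | insert u A hu ih =>
      obtain ⟨L, h1, h2, h3⟩ := ih
      refine ⟨singleGate G u ⟨sitePauli (r u), sitePauli_mem_unitary _⟩ :: L,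
        List.pairwise_cons.mpr ⟨fun g hg => ?_, h1⟩, fun g hg => ?_, ?_⟩
      · exact (Finset.disjoint_singleton_left.mpr hu).mono_right (h2 g hg)
      · rcases List.mem_cons.mp hg with rfl | hg
        · exact Finset.singleton_subset_iff.mpr (Finset.mem_insert_self u A)
        · exact (h2 g hg).trans (Finset.subset_insert u A)
      · rw [List.map_cons, List.prod_cons, h3, singleGate_sitePauli,
          pauli_update_mul u (r u) (fun x => if x ∈ A then r x else 0) (if_neg hu)]
        congr 1
        funext w
        by_cases hw : w = u
        · subst hw; simp
        · simp [hw]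
  obtain ⟨L, h1, -, h3⟩ := h Finset.univ
  refine hasCircuitDepth_of_layer L h1 _ ?_
  rw [h3]
  simp [pauliU]

end WholeLayers

/-! ### The odd-even exchange network on a line -/

section Network

variable {ℓ : ℕ}

/-- The exchange of neighbours on a line in step `t` of odd-even transposition sort: positions
with the parity of `t` are exchanged with the next position, the others with the previous one, as
long as this position exists. -/
def oddEven (t : ℕ) (p : Fin ℓ) : Fin ℓ :=
  if p.val % 2 = t % 2 then (if h : p.val + 1 < ℓ then ⟨p.val + 1, h⟩ else p)
  else ⟨p.val - 1, by omega⟩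

lemma oddEven_val (t : ℕ) (p : Fin ℓ) : (oddEven t p).val =
    if p.val % 2 = t % 2 then (if p.val + 1 < ℓ then p.val + 1 else p.val) else p.val - 1 := by
  unfold oddEven
  split_ifs <;> rfl

lemma oddEven_oddEven (t : ℕ) (p : Fin ℓ) : oddEven t (oddEven t p) = p := by
  apply Fin.ext
  rw [oddEven_val, oddEven_val]
  have := p.2
  split_ifs <;> omega

lemma oddEven_adj (t : ℕ) (p : Fin ℓ) :
    oddEven t p = p ∨ (SimpleGraph.pathGraph ℓ).Adj p (oddEven t p) := by
  rw [SimpleGraph.pathGraph_adj, Fin.ext_iff, oddEven_val]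
  have := p.2
  split_ifs <;> omega

/-- The place of position `p` at time `t` on the cycle with `2 * ℓ` places that is obtained by
unfolding the line. Items on right-moving positions occupy the first half of the cycle, items on
left-moving positions the second half, so that the exchange network rotates the cycle. -/
def cyclePlace (t : ℕ) (p : Fin ℓ) : ZMod (2 * ℓ) :=
  if p.val % 2 = t % 2 then (p.val : ZMod (2 * ℓ)) else -1 - (p.val : ZMod (2 * ℓ))

lemma two_mul_cast_eq_zero : (2 * (ℓ : ZMod (2 * ℓ))) = 0 := by
  have := ZMod.natCast_self (2 * ℓ)
  push_cast at this
  exact this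

/-- Each step of the network rotates the cycle by one place. -/
lemma cyclePlace_succ_oddEven (t : ℕ) (p : Fin ℓ) :
    cyclePlace (t + 1) (oddEven t p) = cyclePlace t p + 1 := by
  have h2 := two_mul_cast_eq_zero (ℓ := ℓ)
  have hp := p.2
  unfold cyclePlace
  rw [oddEven_val]
  by_cases h : p.val % 2 = t % 2
  · by_cases h' : p.val + 1 < ℓ
    · simp only [h, h', if_true]
      rw [if_pos (by omega)]
      push_cast; ring
    · simp only [h, h', if_true, if_false]
      rw [if_neg (by omega)]
      have : ((p.val + 1 : ℕ) : ZMod (2 * ℓ)) = ℓ := by congr 1; omega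
      push_cast at this
      linear_combination -h2 - 2 * this
  · simp only [h, if_false]
    by_cases h' : p.val = 0
    · rw [if_pos (by omega), h']
      simp
    · rw [if_neg (by omega)]
      have : ((p.val - 1 + 1 : ℕ) : ZMod (2 * ℓ)) = p.val := by congr 1; omega
      push_cast at this
      linear_combination -this

/-- Exchanged items sit on places that are mirror images under a reflection of the cycle. -/
lemma cyclePlace_oddEven (t : ℕ) (p : Fin ℓ) :
    cyclePlace t (oddEven t p) = -2 - cyclePlace t p := by
  have h2 := two_mul_cast_eq_zero (ℓ := ℓ)
  have hp := p.2
  unfold cyclePlace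
  rw [oddEven_val]
  by_cases h : p.val % 2 = t % 2
  · by_cases h' : p.val + 1 < ℓ
    · simp only [h, h', if_true]
      rw [if_neg (by omega)]
      push_cast; ring
    · simp only [h, h', if_true, if_false]
      have : ((p.val + 1 : ℕ) : ZMod (2 * ℓ)) = ℓ := by congr 1; omega
      push_cast at this
      linear_combination h2 + 2 * this
  · simp only [h, if_false]
    by_cases h' : p.val = 0
    · rw [if_neg (by omega), h']
      simp; ring
    · rw [if_pos (by omega)]
      have : ((p.val - 1 + 1 : ℕ) : ZMod (2 * ℓ)) = p.val := by congr 1; omega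
      push_cast at this
      linear_combination this

lemma cyclePlace_injective (t : ℕ) : Function.Injective (cyclePlace (ℓ := ℓ) t) := by
  intro p q h
  have hp := p.2
  have hq := q.2
  have inj : ∀ a b : ℕ, a < 2 * ℓ → b < 2 * ℓ → (a : ZMod (2 * ℓ)) = b → a = b := by
    intro a b ha hb hab
    rw [ZMod.natCast_eq_natCast_iff'] at hab
    rwa [Nat.mod_eq_of_lt ha, Nat.mod_eq_of_lt hb] at hab
  have mixed : ∀ a b : ℕ, a < ℓ → b < ℓ → (a : ZMod (2 * ℓ)) ≠ -1 - b := by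
    intro a b ha hb hab
    have : ((a + b + 1 : ℕ) : ZMod (2 * ℓ)) = ((0 : ℕ) : ZMod (2 * ℓ)) := by
      push_cast
      linear_combination hab
    have := inj _ _ (by omega) (by omega) this
    omega
  unfold cyclePlace at h
  split_ifs at h with h1 h2 h2
  · exact Fin.ext (inj _ _ (by omega) (by omega) h)
  · exact absurd h (mixed _ _ hp hq)
  · exact absurd h.symm (mixed _ _ hq hp)
  · refine Fin.ext (inj _ _ (by omega) (by omega) ?_)
    linear_combination -h

/-- One step of the network as a permutation. -/
def oddEvenPerm (ℓ t : ℕ) : Equiv.Perm (Fin ℓ) :=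
  Function.Involutive.toPerm (oddEven t) (oddEven_oddEven t)

/-- The position at time `t` of the item that starts at a given position. -/
def netPos (ℓ : ℕ) : ℕ → Equiv.Perm (Fin ℓ)
  | 0 => 1
  | t + 1 => oddEvenPerm ℓ t * netPos ℓ t

lemma netPos_succ_apply (t : ℕ) (p : Fin ℓ) : netPos ℓ (t + 1) p = oddEven t (netPos ℓ t p) := rfl

lemma cyclePlace_netPos (t : ℕ) (p : Fin ℓ) :
    cyclePlace t (netPos ℓ t p) = cyclePlace 0 p + t := by
  induction t with
  | zero => simp [netPos]
  | succ t ih =>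
    rw [netPos_succ_apply, cyclePlace_succ_oddEven, ih]
    push_cast; ring

lemma netPos_two_mul : netPos ℓ (2 * ℓ) = 1 := by
  ext1 p
  apply cyclePlace_injective (2 * ℓ)
  rw [cyclePlace_netPos, ZMod.natCast_self, add_zero]
  simp [cyclePlace]

/-- The item that is exchanged at time `t` with the item that starts at position `p`. -/
def netPartner (t : ℕ) (p : Fin ℓ) : Fin ℓ := (netPos ℓ t)⁻¹ (oddEven t (netPos ℓ t p))

lemma netPos_netPartner (t : ℕ) (p : Fin ℓ) :
    netPos ℓ t (netPartner t p) = oddEven t (netPos ℓ t p) := by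
  simp [netPartner]

lemma cyclePlace_netPartner (t : ℕ) (p : Fin ℓ) :
    cyclePlace 0 (netPartner t p) = -2 - 2 * t - cyclePlace 0 p := by
  have h1 := cyclePlace_netPos t (netPartner t p)
  rw [netPos_netPartner, cyclePlace_oddEven, cyclePlace_netPos] at h1
  linear_combination -h1

/-- Within `ℓ` steps, each item meets each item, including itself, exactly once. -/
lemma netPartner_bijective (p : Fin ℓ) :
    Function.Bijective fun t : Fin ℓ => netPartner t.val p := by
  rw [Fintype.bijective_iff_injective_and_card]
  refine ⟨fun t u h => ?_, rfl⟩
  have h1 := congrArg (cyclePlace 0) h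
  simp only [cyclePlace_netPartner] at h1
  have h2 : ((2 * t.val : ℕ) : ZMod (2 * ℓ)) = ((2 * u.val : ℕ) : ZMod (2 * ℓ)) := by
    push_cast
    linear_combination -h1
  rw [ZMod.natCast_eq_natCast_iff', Nat.mod_eq_of_lt (by omega), Nat.mod_eq_of_lt (by omega)] at h2
  exact Fin.ext (by omega)

end Network

/-! ### Shears along the lines of the grid -/

section Shear

variable {D ℓ : ℕ}

/-- The sites of the grid. -/
abbrev Site (D ℓ : ℕ) : Type := Fin D → Fin ℓ

/-- The action of a permutation of the line on the lines of the grid in direction `k`. -/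
def linePerm (k : Fin D) (σ : Equiv.Perm (Fin ℓ)) : Equiv.Perm (Site D ℓ) where
  toFun x := Function.update x k (σ (x k))
  invFun x := Function.update x k (σ⁻¹ (x k))
  left_inv x := by simp
  right_inv x := by simp

lemma linePerm_apply (k : Fin D) (σ : Equiv.Perm (Fin ℓ)) (x : Site D ℓ) :
    linePerm k σ x = Function.update x k (σ (x k)) := rfl

lemma linePerm_mul (k : Fin D) (σ τ : Equiv.Perm (Fin ℓ)) :
    linePerm k (σ * τ) = linePerm k σ * linePerm k τ := by
  ext1 x
  simp [linePerm_apply]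

lemma linePerm_one (k : Fin D) : linePerm k (1 : Equiv.Perm (Fin ℓ)) = 1 := by
  ext1 x
  simp [linePerm_apply]

lemma linePerm_oddEven_involutive (k : Fin D) (t : ℕ) (x : Site D ℓ) :
    linePerm k (oddEvenPerm ℓ t) (linePerm k (oddEvenPerm ℓ t) x) = x := by
  have : oddEvenPerm ℓ t * oddEvenPerm ℓ t = 1 := by
    ext1 p
    exact oddEven_oddEven t p
  rw [← Equiv.Perm.mul_apply, ← linePerm_mul, this, linePerm_one]
  rfl

lemma linePerm_oddEven_adj (k : Fin D) (t : ℕ) (x : Site D ℓ) :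
    linePerm k (oddEvenPerm ℓ t) x = x ∨ (gridGraph D ℓ).Adj x (linePerm k (oddEvenPerm ℓ t) x) := by
  rcases oddEven_adj t (x k) with h | h
  · left
    rw [linePerm_apply]
    change Function.update x k (oddEven t (x k)) = x
    rw [h, Function.update_eq_self]
  · right
    refine ⟨k, ?_, fun j hj => ?_⟩
    · rw [linePerm_apply, Function.update_self]
      exact h
    · rw [linePerm_apply, Function.update_of_ne hj]

lemma exchangeLayer_involutive {τ : V → V} {s : V → ZMod 2} (hτ : ∀ x, τ (τ x) = x)
    (hs : ∀ x, s (τ x) = s x) : Function.Involutive (exchangeLayer τ s) := by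
  intro v
  funext x
  have h2 : ∀ a b : ZMod 2, a + b + b = a := by decide
  simp only [exchangeLayer, exchange, hτ, hs, h2]

/-- The strength of the controlled-`Z` gate at position `x` in step `t` of the network. Only the
first `ℓ` steps apply such gates, the others complete the rotation of the cycle. -/
def netStrength (k : Fin D) (S : Site D ℓ → Site D ℓ → ZMod 2) (t : ℕ) (x : Site D ℓ) : ZMod 2 :=
  if t < ℓ then S ((linePerm k (netPos ℓ t))⁻¹ x)
    ((linePerm k (netPos ℓ t))⁻¹ (linePerm k (oddEvenPerm ℓ t) x)) else 0

lemma netStrength_partner {k : Fin D} {S : Site D ℓ → Site D ℓ → ZMod 2}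
    (hS : ∀ x y, S x y = S y x) (t : ℕ) (x : Site D ℓ) :
    netStrength k S t (linePerm k (oddEvenPerm ℓ t) x) = netStrength k S t x := by
  unfold netStrength
  rw [linePerm_oddEven_involutive, hS]

/-- The action on labels of step `t` of the network. -/
def netStep (k : Fin D) (S : Site D ℓ → Site D ℓ → ZMod 2) (hS : ∀ x y, S x y = S y x) (t : ℕ) :
    Equiv.Perm (Lab (Site D ℓ)) :=
  Function.Involutive.toPerm
    (exchangeLayer (linePerm k (oddEvenPerm ℓ t)) (netStrength k S t))
    (exchangeLayer_involutive (linePerm_oddEven_involutive k t) (netStrength_partner hS t))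

lemma cliffordDepth_netStep (k : Fin D) (S : Site D ℓ → Site D ℓ → ZMod 2)
    (hS : ∀ x y, S x y = S y x) (t : ℕ) : CliffordDepth (gridGraph D ℓ) 1 (netStep k S hS t) := by
  have h := layerOn_exchangeLayer (linePerm_oddEven_involutive k t) (linePerm_oddEven_adj k t)
    (netStrength_partner hS t) Finset.univ (fun x _ => Finset.mem_univ _)
  have e : onSet Finset.univ (exchangeLayer (linePerm k (oddEvenPerm ℓ t)) (netStrength k S t))
      = ⇑(netStep k S hS t) := by
    funext v x
    exact if_pos (Finset.mem_univ x)
  rw [e] at h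
  exact h.cliffordDepth

/-- The action on labels of the first `t` steps of the network. -/
def netPerm (k : Fin D) (S : Site D ℓ → Site D ℓ → ZMod 2) (hS : ∀ x y, S x y = S y x) :
    ℕ → Equiv.Perm (Lab (Site D ℓ))
  | 0 => 1
  | t + 1 => netStep k S hS t * netPerm k S hS t

lemma cliffordDepth_netPerm (k : Fin D) (S : Site D ℓ → Site D ℓ → ZMod 2)
    (hS : ∀ x y, S x y = S y x) (t : ℕ) : CliffordDepth (gridGraph D ℓ) t (netPerm k S hS t) := by
  induction t with
  | zero => exact CliffordDepth.one 0
  | succ t ih =>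
    have h := (cliffordDepth_netStep k S hS t).mul ih
    rw [add_comm 1 t] at h
    exact h

lemma netPerm_apply (k : Fin D) (S : Site D ℓ → Site D ℓ → ZMod 2) (hS : ∀ x y, S x y = S y x)
    (t : ℕ) (v : Lab (Site D ℓ)) (x : Site D ℓ) :
    netPerm k S hS t v (linePerm k (netPos ℓ t) x) = ((v x).1, (v x).2 + ∑ u ∈ Finset.range t,
      if u < ℓ then S x (Function.update x k (netPartner u (x k)))
        * (v (Function.update x k (netPartner u (x k)))).1 else 0) := by
  induction t generalizing x with
  | zero => simp [netPerm, netPos, linePerm_one]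
  | succ t ih =>
    set x' := Function.update x k (netPartner t (x k)) with hx'
    have h1 : linePerm k (netPos ℓ (t + 1)) x
        = linePerm k (oddEvenPerm ℓ t) (linePerm k (netPos ℓ t) x) := by
      rw [netPos, linePerm_mul]; rfl
    have h2 : linePerm k (netPos ℓ t) x' = linePerm k (netPos ℓ (t + 1)) x := by
      rw [linePerm_apply, linePerm_apply, hx', Function.update_self, netPos_netPartner,
        Function.update_idem]
      rfl
    have h3 : netPerm k S hS (t + 1) v = exchangeLayer (linePerm k (oddEvenPerm ℓ t))
        (netStrength k S t) (netPerm k S hS t v) := rfl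
    have inv_apply : ∀ (σ : Equiv.Perm (Site D ℓ)) (y : Site D ℓ), σ⁻¹ (σ y) = y :=
      fun σ y => Equiv.symm_apply_apply σ y
    have h4 : netStrength k S t (linePerm k (netPos ℓ (t + 1)) x) = if t < ℓ then S x x' else 0 := by
      unfold netStrength
      rw [h1, linePerm_oddEven_involutive, ← h1, ← h2, inv_apply, inv_apply, hS]
    have h5 : (netPerm k S hS t v (linePerm k (netPos ℓ (t + 1)) x)).1 = (v x').1 := by
      rw [← h2, ih]
    rw [h3, exchangeLayer, exchange, h4, h5, h1, linePerm_oddEven_involutive, ih,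
      Finset.sum_range_succ]
    refine Prod.ext rfl ?_
    simp only [ite_mul, zero_mul, add_assoc]
    rfl

/-- The shear that adds to the `Z` exponent of each site a linear combination, with coefficients
`S`, of the `X` exponents on its line in direction `k`. -/
def shear (k : Fin D) (S : Site D ℓ → Site D ℓ → ZMod 2) (v : Lab (Site D ℓ)) : Lab (Site D ℓ) :=
  fun x => ((v x).1, (v x).2 + ∑ q, S x (Function.update x k q) * (v (Function.update x k q)).1)

/-- In the first `ℓ` of its `2 * ℓ` steps, the exchange network lets the qubits of each line meet
pairwise and applies the controlled-`Z` and phase gates; the other steps return the qubits to their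
places. -/
lemma exists_cliffordDepth_shear (k : Fin D) (S : Site D ℓ → Site D ℓ → ZMod 2)
    (hS : ∀ x y, S x y = S y x) : ∃ M : Equiv.Perm (Lab (Site D ℓ)),
      (⇑M = shear k S) ∧ CliffordDepth (gridGraph D ℓ) (2 * ℓ) M := by
  refine ⟨netPerm k S hS (2 * ℓ), ?_, cliffordDepth_netPerm k S hS _⟩
  funext v x
  have h := netPerm_apply k S hS (2 * ℓ) v x
  rw [netPos_two_mul, linePerm_one, Equiv.Perm.one_apply] at h
  rw [h, shear]
  congr 2
  rw [← Finset.sum_filter]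
  have e : (Finset.range (2 * ℓ)).filter (· < ℓ) = Finset.range ℓ := by
    ext u
    simp only [Finset.mem_filter, Finset.mem_range]
    omega
  rw [e, Finset.sum_range (fun u => S x (Function.update x k (netPartner u (x k)))
    * (v (Function.update x k (netPartner u (x k)))).1)]
  exact (netPartner_bijective (x k)).sum_comp fun q =>
    S x (Function.update x k q) * (v (Function.update x k q)).1

end Shear

/-! ### Random shears -/

/-- The averages of two functions of additive random variables agree if the variables take the same
values. -/
lemma expect_comp_addMonoidHom_eq {G H K : Type} [AddCommGroup G] [AddCommGroup H] [AddCommGroup K]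
    [Fintype G] [Fintype H] (A : G →+ K) (B : H →+ K) (hAB : ∀ g, ∃ h, B h = A g)
    (hBA : ∀ h, ∃ g, A g = B h) (F : K → ℝ) : 𝔼 g, F (A g) = 𝔼 h, F (B h) := by
  have h1 : ∀ h, 𝔼 g, F (A g + B h) = 𝔼 g, F (A g) := by
    intro h
    obtain ⟨g₀, e⟩ := hBA h
    exact Fintype.expect_equiv (Equiv.addRight g₀) _ _ fun g => by simp [e]
  have h2 : ∀ g, 𝔼 h, F (A g + B h) = 𝔼 h, F (B h) := by
    intro g
    obtain ⟨h₀, e⟩ := hAB g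
    exact Fintype.expect_equiv (Equiv.addLeft h₀) _ _ fun h => by simp [e]
  calc 𝔼 g, F (A g) = 𝔼 h, 𝔼 g, F (A g + B h) := by simp only [h1, Fintype.expect_const]
    _ = 𝔼 g, 𝔼 h, F (A g + B h) := Finset.expect_comm _ _ _
    _ = 𝔼 h, F (B h) := by simp only [h2, Fintype.expect_const]

section RandomShear

variable {D ℓ : ℕ}

/-- The sites whose line in direction `k` contains a site with a non-zero bit. -/
def activeSet (k : Fin D) (a : Site D ℓ → ZMod 2) : Set (Site D ℓ) :=
  {x | ∃ q, a (Function.update x k q) ≠ 0}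

/-- Adds the bits `c` to the `Z` exponents on all lines in direction `k` on which some `X` exponent
does not vanish. -/
def lowStep (k : Fin D) (c : Site D ℓ → ZMod 2) (v : Lab (Site D ℓ)) : Lab (Site D ℓ) :=
  fun x => ((v x).1, (v x).2 + (activeSet k fun y => (v y).1).indicator c x)

/-- The symmetric coefficients obtained from arbitrary bits. -/
def symmCoeff (σ : Site D ℓ → Site D ℓ → ZMod 2) (x y : Site D ℓ) : ZMod 2 :=
  if x = y then σ x x else σ x y + σ y x

lemma symmCoeff_comm (σ : Site D ℓ → Site D ℓ → ZMod 2) (x y : Site D ℓ) :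
    symmCoeff σ x y = symmCoeff σ y x := by
  unfold symmCoeff
  by_cases h : x = y
  · subst h; rfl
  · rw [if_neg h, if_neg (Ne.symm h), add_comm]

/-- The bits that the shear with coefficients `symmCoeff σ` adds to the `Z` exponents. -/
def shearIncrement (k : Fin D) (a : Site D ℓ → ZMod 2) :
    (Site D ℓ → Site D ℓ → ZMod 2) →+ (Site D ℓ → ZMod 2) where
  toFun σ x := ∑ q, symmCoeff σ x (Function.update x k q) * a (Function.update x k q)
  map_zero' := by
    funext x
    simp [symmCoeff]
  map_add' σ σ' := by
    funext x
    rw [Pi.add_apply, ← Finset.sum_add_distrib]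
    refine Finset.sum_congr rfl fun q _ => ?_
    unfold symmCoeff
    split_ifs <;> simp only [Pi.add_apply] <;> ring

/-- Restriction of bits to the active lines. -/
def maskIncrement (k : Fin D) (a : Site D ℓ → ZMod 2) :
    (Site D ℓ → ZMod 2) →+ (Site D ℓ → ZMod 2) where
  toFun c := (activeSet k a).indicator c
  map_zero' := Set.indicator_zero _ _
  map_add' c c' := Set.indicator_add _ c c'

/-- A symmetric matrix over the field with two elements can map a non-zero vector to any vector. -/
lemma exists_shearIncrement_eq (hℓ : 0 < ℓ) (k : Fin D) (a c₀ : Site D ℓ → ZMod 2) :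
    ∃ σ, shearIncrement k a σ = maskIncrement k a c₀ := by
  classical
  have : Nonempty (Fin ℓ) := ⟨⟨0, hℓ⟩⟩
  set c := maskIncrement k a c₀ with hc
  -- One site `x` with `w x = 1` and `a x = 1` is chosen on every active line. The matrix is the sum
  -- of `c wᵀ + w cᵀ`, which maps `a` to `c + γ w`, and of the correction `γ w wᵀ` with `γ = cᵀ a`.
  let r : Site D ℓ → Fin ℓ := fun x => Classical.epsilon fun q => a (Function.update x k q) ≠ 0
  let w : Site D ℓ → ZMod 2 := fun x => if x k = r x then 1 else 0
  let γ : Site D ℓ → ZMod 2 := fun x => ∑ q, c (Function.update x k q) * a (Function.update x k q)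
  have hr : ∀ x q, r (Function.update x k q) = r x := by
    intro x q
    simp only [r, Function.update_idem]
  have hw : ∀ x q, w (Function.update x k q) = if q = r x then 1 else 0 := by
    intro x q
    simp only [w, hr, Function.update_self]
  have two : ∀ s : ZMod 2, s + s = 0 := by decide
  refine ⟨fun x y => if x = y then γ x * w x else c x * w y, ?_⟩
  funext x
  change ∑ q, symmCoeff _ x (Function.update x k q) * a (Function.update x k q) = c x
  by_cases hx : x ∈ activeSet k a
  · have hra : a (Function.update x k (r x)) = 1 := by
      have h0 : a (Function.update x k (r x)) ≠ 0 := Classical.epsilon_spec hx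
      have h1 : ∀ s : ZMod 2, s ≠ 0 → s = 1 := by decide
      exact h1 _ h0
    have hsum : ∑ q, w (Function.update x k q) * a (Function.update x k q) = 1 := by
      simp only [hw, ite_mul, one_mul, zero_mul, Finset.sum_ite_eq', Finset.mem_univ, if_true, hra]
    have hS : ∀ q, symmCoeff (fun x y => if x = y then γ x * w x else c x * w y) x
        (Function.update x k q) = c x * w (Function.update x k q)
          + w x * c (Function.update x k q) + γ x * w x * w (Function.update x k q) := by
      intro q
      unfold symmCoeff
      by_cases h : x = Function.update x k q
      · rw [if_pos h, ← h]
        beta_reduce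
        rw [if_pos rfl]
        have hww : w x * w x = w x := by
          have : ∀ s : ZMod 2, s * s = s := by decide
          exact this _
        linear_combination (-γ x) * hww - two (c x * w x)
      · rw [if_neg h]
        beta_reduce
        rw [if_neg h, if_neg (Ne.symm h)]
        have hww : w x * w (Function.update x k q) = 0 := by
          rw [hw]
          by_cases hq : q = r x
          · have : ¬ x k = r x := fun e => h (by rw [hq, ← e, Function.update_eq_self])
            simp [w, this]
          · simp [hq]
        linear_combination (-γ x) * hww
    calc _ = c x * ∑ q, w (Function.update x k q) * a (Function.update x k q) + w x * γ x
          + γ x * w x * ∑ q, w (Function.update x k q) * a (Function.update x k q) := by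
          simp only [hS, γ, Finset.mul_sum, ← Finset.sum_add_distrib]
          refine Finset.sum_congr rfl fun q _ => by ring
      _ = c x := by
          rw [hsum]
          linear_combination two (w x * γ x)
  · have h0 : ∀ q, a (Function.update x k q) = 0 := by
      intro q
      by_contra h
      exact hx ⟨q, h⟩
    simp only [h0, mul_zero, Finset.sum_const_zero]
    exact (Set.indicator_of_notMem hx c₀).symm

lemma activeSet_update (k : Fin D) (a : Site D ℓ → ZMod 2) (x : Site D ℓ) (q : Fin ℓ) :
    Function.update x k q ∈ activeSet k a ↔ x ∈ activeSet k a := by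
  simp only [activeSet, Set.mem_ofPred_eq, Function.update_idem]

/-- A shear with random symmetric coefficients adds random bits on all active lines. -/
lemma expect_shear (hℓ : 0 < ℓ) (k : Fin D) (f : Lab (Site D ℓ) → ℝ) (v : Lab (Site D ℓ)) :
    𝔼 σ, f (shear k (symmCoeff σ) v) = 𝔼 c, f (lowStep k c v) := by
  refine expect_comp_addMonoidHom_eq (shearIncrement k fun y => (v y).1)
    (maskIncrement k fun y => (v y).1) (fun σ => ?_)
    (fun c => exists_shearIncrement_eq hℓ k _ c) (fun b => f fun x => ((v x).1, (v x).2 + b x))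
  refine ⟨shearIncrement k (fun y => (v y).1) σ, Set.indicator_eq_self.mpr fun x hx => ?_⟩
  by_contra h
  refine hx ?_
  change ∑ q, symmCoeff σ x (Function.update x k q) * (v (Function.update x k q)).1 = 0
  refine Finset.sum_eq_zero fun q _ => ?_
  have h0 : (v (Function.update x k q)).1 = 0 := by
    by_contra h0
    exact h ⟨q, h0⟩
  rw [h0, mul_zero]

end RandomShear

/-- The averaging operator `E` describes the labels under some random Clifford circuit of depth at
most `d`. -/
def Realizes (G : SimpleGraph V) (d : ℕ) (E : (Lab V → ℝ) → Lab V → ℝ) : Prop :=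
  ∃ (Ω : Type) (_ : Fintype Ω) (_ : Nonempty Ω) (M : Ω → Equiv.Perm (Lab V)),
    (∀ ω, CliffordDepth G d (M ω)) ∧ ∀ f v, E f v = 𝔼 ω, f (M ω v)

lemma Realizes.comp {G : SimpleGraph V} {d d' : ℕ} {E E' : (Lab V → ℝ) → Lab V → ℝ}
    (h : Realizes G d E) (h' : Realizes G d' E') : Realizes G (d + d') fun f => E (E' f) := by
  obtain ⟨Ω, _, _, M, hM, e⟩ := h
  obtain ⟨Ω', _, _, M', hM', e'⟩ := h'
  refine ⟨Ω × Ω', inferInstance, inferInstance, fun ω => M' ω.2 * M ω.1, fun ω => ?_,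
    fun f v => ?_⟩
  · rw [add_comm]
    exact (hM' ω.2).mul (hM ω.1)
  · change E (E' f) v = _
    rw [e]
    simp only [e']
    exact (Finset.expect_product' Finset.univ Finset.univ fun ω ω' => f (M' ω' (M ω v))).symm

/-- Exchanges the `X` and `Z` exponents of all qubits. -/
def swapLab (v : Lab V) : Lab V := fun x => (v x).swap

lemma realizes_swapLab (G : SimpleGraph V) : Realizes G 1 fun f v => f (swapLab v) := by
  refine ⟨Unit, inferInstance, inferInstance,
    fun _ => Function.Involutive.toPerm swapLab fun v => rfl, fun _ => ?_, fun f v => ?_⟩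
  · have h := layerOn_hadamard (G := G) (Finset.univ : Finset V)
    have e : onSet Finset.univ (fun (v : Lab V) x => (v x).swap)
        = ⇑(Function.Involutive.toPerm (swapLab (V := V)) fun v => rfl) := by
      funext v x
      exact if_pos (Finset.mem_univ x)
    rw [e] at h
    exact h.cliffordDepth
  · exact (Fintype.expect_const _).symm

section Steps

variable {D ℓ : ℕ}

/-- Adds the bits `c` to the `X` exponents on all lines in direction `k` on which some `Z` exponent
does not vanish. -/
def upStep (k : Fin D) (c : Site D ℓ → ZMod 2) (v : Lab (Site D ℓ)) : Lab (Site D ℓ) :=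
  swapLab (lowStep k c (swapLab v))

/-- The average over a random step on the `Z` exponents and a random step on the `X` exponents
along the lines in direction `k`. -/
def lineAvg (k : Fin D) (f : Lab (Site D ℓ) → ℝ) (v : Lab (Site D ℓ)) : ℝ :=
  𝔼 c, 𝔼 c', f (upStep k c' (lowStep k c v))

lemma realizes_lineAvg (hℓ : 0 < ℓ) (k : Fin D) :
    Realizes (gridGraph D ℓ) (4 * ℓ + 2) (lineAvg k) := by
  have hlow : Realizes (gridGraph D ℓ) (2 * ℓ) fun f v => 𝔼 c, f (lowStep k c v) := by
    choose M hM hd using fun σ : Site D ℓ → Site D ℓ → ZMod 2 =>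
      exists_cliffordDepth_shear k (symmCoeff σ) (symmCoeff_comm σ)
    refine ⟨_, inferInstance, inferInstance, M, hd, fun f v => ?_⟩
    simp only [hM]
    exact (expect_shear hℓ k f v).symm
  have h := hlow.comp ((realizes_swapLab _).comp (hlow.comp (realizes_swapLab _)))
  have e : 2 * ℓ + (1 + (2 * ℓ + 1)) = 4 * ℓ + 2 := by ring
  rw [e] at h
  exact h

/-- The average over random steps along the directions `m, …, 1, 0, 0, 1, …, m`. -/
def sweepAvg : (m : ℕ) → m < D → (Lab (Site D ℓ) → ℝ) → Lab (Site D ℓ) → ℝ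
  | 0, h => fun f => lineAvg ⟨0, h⟩ (lineAvg ⟨0, h⟩ f)
  | m + 1, h => fun f => lineAvg ⟨m + 1, h⟩ (sweepAvg m (by omega) (lineAvg ⟨m + 1, h⟩ f))

lemma realizes_sweepAvg (hℓ : 0 < ℓ) (m : ℕ) (h : m < D) :
    Realizes (gridGraph D ℓ) (2 * (m + 1) * (4 * ℓ + 2)) (sweepAvg m h) := by
  induction m with
  | zero =>
    have h1 := (realizes_lineAvg hℓ (⟨0, h⟩ : Fin D)).comp (realizes_lineAvg hℓ ⟨0, h⟩)
    have e : 4 * ℓ + 2 + (4 * ℓ + 2) = 2 * (0 + 1) * (4 * ℓ + 2) := by ring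
    rw [e] at h1
    exact h1
  | succ m ih =>
    have h1 := (realizes_lineAvg hℓ (⟨m + 1, h⟩ : Fin D)).comp
      ((ih (by omega)).comp (realizes_lineAvg hℓ ⟨m + 1, h⟩))
    have e : 4 * ℓ + 2 + (2 * (m + 1) * (4 * ℓ + 2) + (4 * ℓ + 2))
        = 2 * (m + 1 + 1) * (4 * ℓ + 2) := by ring
    rw [e] at h1
    exact h1

end Steps

/-! ### Averages over independent bits -/

lemma expect_prod_type {A B : Type} [Fintype A] [Fintype B] (F : A → B → ℝ) :
    𝔼 p : A × B, F p.1 p.2 = 𝔼 a, 𝔼 b, F a b :=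
  Finset.expect_product' Finset.univ Finset.univ F

lemma abs_expect_sub_le {Ω : Type} [Fintype Ω] [Nonempty Ω] {F B : Ω → ℝ} {r : ℝ}
    (h : ∀ ω, |F ω - r| ≤ B ω) : |𝔼 ω, F ω - r| ≤ 𝔼 ω, B ω := by
  have e : 𝔼 ω, F ω - r = 𝔼 ω, (F ω - r) := by
    rw [Finset.expect_sub_distrib, Fintype.expect_const]
  rw [e]
  exact (Finset.abs_expect_le _ _).trans (Finset.expect_le_expect fun ω _ => h ω)

lemma expect_mem_Icc {Ω : Type} [Fintype Ω] [Nonempty Ω] {F : Ω → ℝ} {r s : ℝ}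
    (h : ∀ ω, F ω ∈ Set.Icc r s) : 𝔼 ω, F ω ∈ Set.Icc r s := by
  constructor
  · rw [← Fintype.expect_const (ι := Ω) r]
    exact Finset.expect_le_expect fun ω _ => (h ω).1
  · rw [← Fintype.expect_const (ι := Ω) s]
    exact Finset.expect_le_expect fun ω _ => (h ω).2

lemma abs_sub_le_one {r s : ℝ} (hr : r ∈ Set.Icc (0 : ℝ) 1) (hs : s ∈ Set.Icc (0 : ℝ) 1) :
    |r - s| ≤ 1 := by
  rw [abs_le]
  constructor <;> linarith [hr.1, hr.2, hs.1, hs.2]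

lemma expect_zmod_two (g : ZMod 2 → ℝ) : 𝔼 s, g s = (g 0 + g 1) / 2 := by
  have h : (Finset.univ : Finset (ZMod 2)) = {0, 1} := by decide
  rw [Fintype.expect_eq_sum_div_card, h, Finset.sum_pair (by decide), ZMod.card]
  norm_num

lemma expect_pi_prod {α : Type} [Fintype α] (g : V → α → ℝ) :
    𝔼 c : V → α, ∏ x, g x (c x) = ∏ x, 𝔼 s, g x s := by
  classical
  simp only [Fintype.expect_eq_sum_div_card, Finset.prod_div_distrib, Finset.prod_const]
  rw [Finset.prod_univ_sum, Fintype.piFinset_univ, Fintype.card_fun, Finset.card_univ]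
  push_cast
  rfl

/-- The values of a uniformly random function at different places are independent. -/
lemma expect_prod_comp_injective {α ι : Type} [Fintype α] [Nonempty α] [Fintype ι] {y : ι → V}
    (hy : Function.Injective y) (g : ι → α → ℝ) :
    𝔼 c : V → α, ∏ q, g q (c (y q)) = ∏ q, 𝔼 s, g q s := by
  have h1 : ∀ x, x ∉ Set.range y → Function.extend y g (fun _ _ => 1) x = fun _ => 1 :=
    fun x hx => Function.extend_apply' g _ x hx
  have h2 : ∀ q, Function.extend y g (fun _ _ => 1) (y q) = g q := hy.extend_apply g _
  have e : ∀ c : V → α, ∏ q, g q (c (y q)) = ∏ x, Function.extend y g (fun _ _ => 1) x (c x) :=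
    fun c => Fintype.prod_of_injective y hy _ _ (fun x hx => by rw [h1 x hx]) fun q => by rw [h2]
  simp only [e]
  rw [expect_pi_prod]
  exact (Fintype.prod_of_injective y hy _ _ (fun x hx => by rw [h1 x hx, Fintype.expect_const])
    fun q => by rw [h2]).symm

/-- The indicator function of the bit `0`. -/
def zeroInd (s : ZMod 2) : ℝ := if s = 0 then 1 else 0

lemma zeroInd_mem (s : ZMod 2) : zeroInd s ∈ Set.Icc (0 : ℝ) 1 := by
  unfold zeroInd
  split_ifs <;> norm_num

lemma expect_zeroInd_add (b : ZMod 2) : 𝔼 s, zeroInd (b + s) = 1 / 2 := by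
  have h := Fintype.expect_equiv (Equiv.addLeft b) (fun s => zeroInd (b + s)) zeroInd fun _ => rfl
  rw [h, expect_zmod_two]
  norm_num [zeroInd]

lemma prod_mem_Icc {ι : Type} [Fintype ι] {g : ι → ℝ} (h : ∀ q, g q ∈ Set.Icc (0 : ℝ) 1) :
    ∏ q, g q ∈ Set.Icc (0 : ℝ) 1 :=
  ⟨Finset.prod_nonneg fun q _ => (h q).1,
    Finset.prod_le_one (fun q _ => (h q).1) fun q _ => (h q).2⟩

/-! ### Mixing on the grid -/

section Mixing

variable {D ℓ : ℕ}

lemma update_line_injective (x : Site D ℓ) (k : Fin D) :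
    Function.Injective fun q => Function.update x k q := Function.update_injective x k

/-- The number of lines in direction `k` inside `X` on which the bits `a` vanish, if `X` is a union
of such lines. Each line is counted with weight `1 / ℓ` at each of its sites. -/
def numZeroLines (k : Fin D) (X : Set (Site D ℓ)) (a : Site D ℓ → ZMod 2) : ℝ :=
  (∑ x, X.indicator (fun x => ∏ q, zeroInd (a (Function.update x k q))) x) / ℓ

lemma numZeroLines_nonneg (k : Fin D) (X : Set (Site D ℓ)) (a : Site D ℓ → ZMod 2) :
    0 ≤ numZeroLines k X a :=
  div_nonneg (Finset.sum_nonneg fun x _ =>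
    Set.indicator_nonneg (fun _ _ => (prod_mem_Icc fun _ => zeroInd_mem _).1) x) (Nat.cast_nonneg _)

lemma one_le_numZeroLines (hℓ : 0 < ℓ) {k : Fin D} {X : Set (Site D ℓ)}
    (hX : ∀ x q, Function.update x k q ∈ X ↔ x ∈ X) {a : Site D ℓ → ZMod 2} {x : Site D ℓ}
    (hx : x ∈ X) (ha : x ∉ activeSet k a) : 1 ≤ numZeroLines k X a := by
  have hℓ' : (0 : ℝ) < ℓ := Nat.cast_pos.mpr hℓ
  have h0 : ∀ q, a (Function.update x k q) = 0 := by
    intro q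
    by_contra h
    exact ha ⟨q, h⟩
  set F := X.indicator (fun x => ∏ q, zeroInd (a (Function.update x k q))) with hF
  have h1 : ∀ q, F (Function.update x k q) = 1 := by
    intro q
    rw [hF, Set.indicator_of_mem ((hX x q).mpr hx)]
    simp [h0, zeroInd]
  unfold numZeroLines
  rw [le_div_iff₀ hℓ', one_mul]
  calc (ℓ : ℝ) = ∑ q : Fin ℓ, F (Function.update x k q) := by simp [h1]
    _ = ∑ z ∈ Finset.univ.image fun q => Function.update x k q, F z :=
        (Finset.sum_image fun q _ q' _ h => update_line_injective x k h).symm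
    _ ≤ ∑ z, F z := Finset.sum_le_sum_of_subset_of_nonneg (Finset.subset_univ _) fun z _ _ =>
        Set.indicator_nonneg (fun x _ => (prod_mem_Icc fun _ => zeroInd_mem _).1) z

lemma expect_numZeroLines_le {Ω : Type} [Fintype Ω] (k : Fin D) (X : Set (Site D ℓ))
    (a : Ω → Site D ℓ → ZMod 2) {p : ℝ} (hp : 0 ≤ p)
    (h : ∀ x ∈ X, 𝔼 ω, ∏ q, zeroInd (a ω (Function.update x k q)) ≤ p) :
    𝔼 ω, numZeroLines k X (a ω) ≤ (ℓ : ℝ) ^ D / ℓ * p := by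
  unfold numZeroLines
  rw [← Finset.expect_div, Finset.expect_sum_comm, div_mul_eq_mul_div]
  refine div_le_div_of_nonneg_right ?_ (Nat.cast_nonneg _)
  calc _ ≤ ∑ _x : Site D ℓ, p := Finset.sum_le_sum fun x _ => by
        by_cases hx : x ∈ X
        · simp only [Set.indicator_of_mem hx]
          exact h x hx
        · simpa only [Set.indicator_of_notMem hx, Finset.expect_const_zero] using hp
    _ = (ℓ : ℝ) ^ D * p := by simp

lemma expect_numZeroLines_uniform_le (k : Fin D) (X : Set (Site D ℓ)) :
    𝔼 c, numZeroLines k X c ≤ (ℓ : ℝ) ^ D / ℓ * (1 / 2) ^ ℓ := by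
  refine expect_numZeroLines_le k X (fun c => c) (by positivity) fun x _ => ?_
  rw [expect_prod_comp_injective (update_line_injective x k) fun _ => zeroInd]
  have h := expect_zeroInd_add 0
  simp only [zero_add] at h
  simp [h]

lemma lineAvg_mem_Icc {f : Lab (Site D ℓ) → ℝ} (hf : ∀ v, f v ∈ Set.Icc (0 : ℝ) 1) (k : Fin D)
    (v : Lab (Site D ℓ)) : lineAvg k f v ∈ Set.Icc (0 : ℝ) 1 :=
  expect_mem_Icc fun _ => expect_mem_Icc fun _ => hf _

lemma upStep_apply (k : Fin D) (c : Site D ℓ → ZMod 2) (v : Lab (Site D ℓ)) (x : Site D ℓ) :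
    upStep k c v x = ((v x).1 + (activeSet k fun y => (v y).2).indicator c x, (v x).2) := rfl

lemma activeSet_subset {k : Fin D} {X : Set (Site D ℓ)}
    (hX : ∀ x q, Function.update x k q ∈ X ↔ x ∈ X) {a : Site D ℓ → ZMod 2}
    (ha : ∀ x, a x ≠ 0 → x ∈ X) : activeSet k a ⊆ X := by
  rintro x ⟨q, hq⟩
  exact (hX x q).mp (ha _ hq)

lemma lowStep_supported {k : Fin D} {X : Set (Site D ℓ)}
    (hX : ∀ x q, Function.update x k q ∈ X ↔ x ∈ X) {v : Lab (Site D ℓ)}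
    (hv : ∀ x, v x ≠ 0 → x ∈ X) (c : Site D ℓ → ZMod 2) (x : Site D ℓ)
    (hx : lowStep k c v x ≠ 0) : x ∈ X := by
  by_contra h
  have h1 : v x = 0 := by
    by_contra h1
    exact h (hv x h1)
  have h2 : x ∉ activeSet k fun y => (v y).1 := fun h2 =>
    h (activeSet_subset hX (fun y hy => hv y fun e => hy (by simp [e])) h2)
  exact hx (by simp [lowStep, h1, Set.indicator_of_notMem h2])

lemma swapLab_ne_zero {v : Lab V} {x : V} : swapLab v x ≠ 0 ↔ v x ≠ 0 := by
  simp [swapLab, Prod.ext_iff, and_comm]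

lemma upStep_supported {k : Fin D} {X : Set (Site D ℓ)}
    (hX : ∀ x q, Function.update x k q ∈ X ↔ x ∈ X) {v : Lab (Site D ℓ)}
    (hv : ∀ x, v x ≠ 0 → x ∈ X) (c : Site D ℓ → ZMod 2) (x : Site D ℓ)
    (hx : upStep k c v x ≠ 0) : x ∈ X :=
  lowStep_supported hX (fun y hy => hv y (swapLab_ne_zero.mp hy)) c x (swapLab_ne_zero.mp hx)

lemma expect_lab (f : Lab V → ℝ) :
    𝔼 w, f w = 𝔼 c : V → ZMod 2, 𝔼 c' : V → ZMod 2, f fun x => (c' x, c x) := by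
  rw [← expect_prod_type fun (c : V → ZMod 2) (c' : V → ZMod 2) => f fun x => (c' x, c x)]
  exact Fintype.expect_equiv ((Equiv.arrowProdEquivProdArrow V _ _).trans (Equiv.prodComm _ _))
    _ _ fun w => rfl

/-- If no line of `X` in direction `k` has vanishing `X` exponents, then the random steps along
these lines make the labels on `X` uniform, except if the bits of the first step vanish on a
line. -/
lemma abs_lineAvg_sub_le (hℓ : 0 < ℓ) {k : Fin D} {X : Set (Site D ℓ)}
    (hX : ∀ x q, Function.update x k q ∈ X ↔ x ∈ X) {f : Lab (Site D ℓ) → ℝ}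
    (hf : ∀ v, f v ∈ Set.Icc (0 : ℝ) 1) {u : Lab (Site D ℓ)} (hu : ∀ x, u x ≠ 0 → x ∈ X) :
    |lineAvg k f u - 𝔼 w, f (X.indicator w)|
      ≤ numZeroLines k X (fun x => (u x).1) + 𝔼 c, numZeroLines k X c := by
  have hE : 0 ≤ 𝔼 c, numZeroLines k X c :=
    Finset.expect_nonneg fun c _ => numZeroLines_nonneg k X c
  by_cases hact : X ⊆ activeSet k fun x => (u x).1
  swap
  · obtain ⟨x, hx, hxa⟩ := Set.not_subset.mp hact
    have h1 := abs_sub_le_one (lineAvg_mem_Icc hf k u)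
      (expect_mem_Icc fun w : Lab (Site D ℓ) => hf (X.indicator w))
    linarith [one_le_numZeroLines hℓ hX hx hxa]
  have hactX : (activeSet k fun x => (u x).1) = X :=
    (activeSet_subset hX fun y hy => hu y fun e => hy (by simp [e])).antisymm hact
  have ind : ∀ (g : Site D ℓ → ZMod 2), (∀ x, g x ≠ 0 → x ∈ X) → ∀ c x,
      g x + X.indicator c x = X.indicator (g + c) x := by
    intro g hg c x
    by_cases hx : x ∈ X
    · simp [hx]
    · have : g x = 0 := by
        by_contra h
        exact hx (hg x h)
      simp [hx, this]
  have h1 : lineAvg k f u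
      = 𝔼 c, 𝔼 c', f (upStep k c' fun x => ((u x).1, X.indicator c x)) := by
    refine Fintype.expect_equiv (Equiv.addLeft fun x => (u x).2) _ _ fun c => ?_
    refine Finset.expect_congr rfl fun c' _ => ?_
    congr 2
    funext x
    simp only [lowStep, hactX]
    rw [ind (fun x => (u x).2) fun x hx => hu x fun e => hx (by simp [e])]
    rfl
  have h2 : 𝔼 w, f (X.indicator w) = 𝔼 c, 𝔼 c', f fun x => (X.indicator c' x, X.indicator c x) := by
    rw [expect_lab]
    refine Finset.expect_congr rfl fun c _ => Finset.expect_congr rfl fun c' _ => ?_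
    congr 1
    funext x
    by_cases hx : x ∈ X
    · simp [hx]
    · simp only [Set.indicator_of_notMem hx]
      rfl
  rw [h1, h2, ← Finset.expect_sub_distrib]
  have h3 := numZeroLines_nonneg k X (fun x => (u x).1)
  refine ((Finset.abs_expect_le _ _).trans
    (Finset.expect_le_expect fun c _ => ?_)).trans (le_add_of_nonneg_left h3)
  by_cases hc : X ⊆ activeSet k (X.indicator c)
  · have hcX : activeSet k (X.indicator c) = X :=
      (activeSet_subset hX fun y hy => Set.mem_of_indicator_ne_zero hy).antisymm hc
    have h4 : 𝔼 c', f (upStep k c' fun x => ((u x).1, X.indicator c x))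
        = 𝔼 c', f fun x => (X.indicator c' x, X.indicator c x) := by
      refine Fintype.expect_equiv (Equiv.addLeft fun x => (u x).1) _ _ fun c' => ?_
      congr 1
      funext x
      rw [upStep_apply]
      simp only [hcX]
      rw [ind (fun x => (u x).1) fun x hx => hu x fun e => hx (by simp [e])]
      rfl
    rw [h4, sub_self, abs_zero]
    exact numZeroLines_nonneg k X c
  · obtain ⟨x, hx, hxa⟩ := Set.not_subset.mp hc
    refine (abs_sub_le_one (expect_mem_Icc fun c' => hf _) (expect_mem_Icc fun c' => hf _)).trans
      (one_le_numZeroLines hℓ hX hx fun h => hxa ?_)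
    obtain ⟨q, hq⟩ := h
    refine ⟨q, ?_⟩
    rwa [Set.indicator_of_mem ((hX x q).mpr hx)]

/-- The random steps along a line on which the label does not vanish make the `X` exponents on this
line uniform, except if all `Z` exponents vanish after the first step. -/
lemma expect_prod_upStep_lowStep_le {k : Fin D} {v : Lab (Site D ℓ)} {y : Site D ℓ} (hy : v y ≠ 0)
    {g : ZMod 2 → ℝ} (hg : ∀ s, g s ∈ Set.Icc (0 : ℝ) 1) :
    𝔼 c, 𝔼 c', ∏ q, g (upStep k c' (lowStep k c v) (Function.update y k q)).1
      ≤ (1 / 2) ^ ℓ + (𝔼 s, g s) ^ ℓ := by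
  have hshift : ∀ b, 𝔼 s, g (b + s) = 𝔼 s, g s := fun b =>
    Fintype.expect_equiv (Equiv.addLeft b) _ _ fun _ => rfl
  have hpow : 0 ≤ (𝔼 s, g s) ^ ℓ := pow_nonneg (expect_mem_Icc hg).1 _
  have h1 : ∀ c, 𝔼 c', ∏ q, g (upStep k c' (lowStep k c v) (Function.update y k q)).1
      ≤ ∏ q, zeroInd (lowStep k c v (Function.update y k q)).2 + (𝔼 s, g s) ^ ℓ := by
    intro c
    by_cases h : y ∈ activeSet k fun z => (lowStep k c v z).2
    · have e : ∀ c' q, (upStep k c' (lowStep k c v) (Function.update y k q)).1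
          = (lowStep k c v (Function.update y k q)).1 + c' (Function.update y k q) := by
        intro c' q
        rw [upStep_apply, Set.indicator_of_mem ((activeSet_update k _ y q).mpr h)]
      simp only [e]
      rw [expect_prod_comp_injective (update_line_injective y k) fun q s =>
        g ((lowStep k c v (Function.update y k q)).1 + s)]
      simp only [hshift, Finset.prod_const, Finset.card_univ, Fintype.card_fin]
      exact le_add_of_nonneg_left (prod_mem_Icc fun _ => zeroInd_mem _).1
    · have h0 : ∀ q, (lowStep k c v (Function.update y k q)).2 = 0 := by
        intro q
        by_contra h'
        exact h ⟨q, h'⟩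
      have e : ∏ q : Fin ℓ, zeroInd (lowStep k c v (Function.update y k q)).2 = 1 :=
        Finset.prod_eq_one fun q _ => by rw [h0, zeroInd, if_pos rfl]
      rw [e]
      exact (expect_mem_Icc fun c' => prod_mem_Icc fun q => hg _).2.trans
        (le_add_of_nonneg_right hpow)
  refine (Finset.expect_le_expect fun c _ => h1 c).trans ?_
  rw [Finset.expect_add_distrib, Fintype.expect_const]
  refine add_le_add_left ?_ _
  by_cases h : y ∈ activeSet k fun z => (v z).1
  · have e : ∀ c q, (lowStep k c v (Function.update y k q)).2
        = (v (Function.update y k q)).2 + c (Function.update y k q) := by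
      intro c q
      rw [lowStep, Set.indicator_of_mem ((activeSet_update k _ y q).mpr h)]
    simp only [e]
    rw [expect_prod_comp_injective (update_line_injective y k) fun q s =>
      zeroInd ((v (Function.update y k q)).2 + s)]
    simp only [expect_zeroInd_add, Finset.prod_const, Finset.card_univ, Fintype.card_fin, le_refl]
  · -- All `X` exponents on the line vanish, so that the `Z` exponent at `y` does not.
    have hy1 : (v y).1 = 0 := by
      by_contra h'
      exact h ⟨y k, by rwa [Function.update_eq_self]⟩
    have hy2 : (v y).2 ≠ 0 := fun h' => hy (Prod.ext hy1 h')
    have e : ∀ c, ∏ q, zeroInd (lowStep k c v (Function.update y k q)).2 = 0 := by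
      intro c
      refine Finset.prod_eq_zero (Finset.mem_univ (y k)) ?_
      rw [Function.update_eq_self, lowStep, Set.indicator_of_notMem h, add_zero, zeroInd,
        if_neg hy2]
    simp only [e, Finset.expect_const_zero]
    positivity

/-- The sites at which a non-zero label of `v` may arrive if it moves in the directions
`0, …, m`. -/
def reach (m : ℕ) (v : Lab (Site D ℓ)) : Set (Site D ℓ) :=
  {x | ∃ y, (∀ i : Fin D, m < i.val → y i = x i) ∧ v y ≠ 0}

lemma reach_update {m : ℕ} {k : Fin D} (hk : k.val ≤ m) (v : Lab (Site D ℓ)) (x : Site D ℓ)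
    (q : Fin ℓ) : Function.update x k q ∈ reach m v ↔ x ∈ reach m v := by
  have h : ∀ i : Fin D, m < i.val → Function.update x k q i = x i := fun i hi =>
    Function.update_of_ne (fun e => by rw [e] at hi; omega) _ _
  constructor
  · rintro ⟨y, hy, hv⟩
    exact ⟨y, fun i hi => (hy i hi).trans (h i hi), hv⟩
  · rintro ⟨y, hy, hv⟩
    exact ⟨y, fun i hi => (hy i hi).trans (h i hi).symm, hv⟩

lemma mem_reach_of_ne_zero {m : ℕ} {v : Lab (Site D ℓ)} (x : Site D ℓ) (hx : v x ≠ 0) :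
    x ∈ reach m v :=
  ⟨x, fun _ _ => rfl, hx⟩

/-- A bound on the contribution of one direction to the mixing error. -/
def stepError (D ℓ : ℕ) : ℝ := (ℓ : ℝ) ^ D / ℓ * (2 * (1 / 2) ^ ℓ + (3 / 4) ^ ℓ)

/-- The steps of the first pair make the `X` exponents on each line with a non-zero label random, so
that those of the second pair make the whole labels on these lines random. -/
lemma abs_sweepAvg_zero_sub_le (hℓ : 0 < ℓ) (h : 0 < D) {f : Lab (Site D ℓ) → ℝ}
    (hf : ∀ v, f v ∈ Set.Icc (0 : ℝ) 1) (v : Lab (Site D ℓ)) :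
    |sweepAvg 0 h f v - 𝔼 w, f ((reach 0 v).indicator w)| ≤ stepError D ℓ := by
  set k : Fin D := ⟨0, h⟩ with hk
  set X := reach 0 v with hXdef
  have hX : ∀ x q, Function.update x k q ∈ X ↔ x ∈ X := reach_update (k := k) le_rfl v
  set B := 𝔼 c, numZeroLines k X c with hB
  let v₁ : (Site D ℓ → ZMod 2) × (Site D ℓ → ZMod 2) → Lab (Site D ℓ) := fun c =>
    upStep k c.2 (lowStep k c.1 v)
  have h1 : sweepAvg 0 h f v = 𝔼 c, lineAvg k f (v₁ c) :=
    (expect_prod_type fun c c' => lineAvg k f (upStep k c' (lowStep k c v))).symm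
  rw [h1]
  have h2 : ∀ c, |lineAvg k f (v₁ c) - 𝔼 w, f (X.indicator w)|
      ≤ numZeroLines k X (fun x => (v₁ c x).1) + B := fun c =>
    abs_lineAvg_sub_le hℓ hX hf
      (upStep_supported hX (lowStep_supported hX mem_reach_of_ne_zero _) _)
  refine (abs_expect_sub_le h2).trans ?_
  rw [Finset.expect_add_distrib, Fintype.expect_const]
  have h3 : B ≤ (ℓ : ℝ) ^ D / ℓ * (1 / 2) ^ ℓ := expect_numZeroLines_uniform_le k X
  have h4 : 𝔼 c, numZeroLines k X (fun x => (v₁ c x).1)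
      ≤ (ℓ : ℝ) ^ D / ℓ * ((1 / 2) ^ ℓ + (1 / 2) ^ ℓ) := by
    refine expect_numZeroLines_le k X (fun c x => (v₁ c x).1) (by positivity) ?_
    rintro x ⟨y, hy, hvy⟩
    have e : ∀ q, Function.update x k q = Function.update y k q := by
      intro q
      funext i
      by_cases hi : i = k
      · rw [hi, Function.update_self, Function.update_self]
      · rw [Function.update_of_ne hi, Function.update_of_ne hi]
        refine (hy i (Nat.pos_of_ne_zero fun h0 => hi (Fin.ext h0))).symm
    simp only [e]
    rw [expect_prod_type fun c c' => ∏ q, zeroInd (upStep k c' (lowStep k c v)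
      (Function.update y k q)).1]
    refine (expect_prod_upStep_lowStep_le hvy zeroInd_mem).trans (le_of_eq ?_)
    have h := expect_zeroInd_add 0
    simp only [zero_add] at h
    rw [h]
  have h5 : (1 / 2 : ℝ) ^ ℓ ≤ (3 / 4) ^ ℓ := pow_le_pow_left₀ (by norm_num) (by norm_num) _
  calc _ ≤ (ℓ : ℝ) ^ D / ℓ * ((1 / 2) ^ ℓ + (1 / 2) ^ ℓ) + (ℓ : ℝ) ^ D / ℓ * (1 / 2) ^ ℓ :=
        add_le_add h4 h3
    _ = (ℓ : ℝ) ^ D / ℓ * (2 * (1 / 2) ^ ℓ + (1 / 2) ^ ℓ) := by ring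
    _ ≤ stepError D ℓ := mul_le_mul_of_nonneg_left (by linarith) (by positivity)

/-- If the sweep over the directions `0, …, m` makes the labels uniform on the sites that it can
reach, then steps along direction `m + 1` before and after it make the labels on whole slabs of one
more dimension uniform. The steps before the sweep spread a non-zero label over a line in
direction `m + 1`, so that the sweep makes about half of the sites of each such line random. -/
lemma abs_sweepAvg_succ_sub_le (hℓ : 0 < ℓ) {m : ℕ} (h : m + 1 < D) {ε : ℝ}
    (ih : ∀ f : Lab (Site D ℓ) → ℝ, (∀ v, f v ∈ Set.Icc (0 : ℝ) 1) → ∀ v,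
      |sweepAvg m (by omega) f v - 𝔼 w, f ((reach m v).indicator w)| ≤ ε)
    {f : Lab (Site D ℓ) → ℝ} (hf : ∀ v, f v ∈ Set.Icc (0 : ℝ) 1) (v : Lab (Site D ℓ)) :
    |sweepAvg (m + 1) h f v - 𝔼 w, f ((reach (m + 1) v).indicator w)| ≤ ε + stepError D ℓ := by
  set k : Fin D := ⟨m + 1, h⟩ with hk
  set X := reach (m + 1) v with hXdef
  have hX : ∀ x q, Function.update x k q ∈ X ↔ x ∈ X := reach_update (k := k) le_rfl v
  set B := 𝔼 c, numZeroLines k X c with hB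
  set E := 𝔼 w, f (X.indicator w) with hE
  let v₁ : (Site D ℓ → ZMod 2) × (Site D ℓ → ZMod 2) → Lab (Site D ℓ) := fun c =>
    upStep k c.2 (lowStep k c.1 v)
  let u : (Site D ℓ → ZMod 2) × (Site D ℓ → ZMod 2) → Lab (Site D ℓ) → Lab (Site D ℓ) :=
    fun c w => (reach m (v₁ c)).indicator w
  have h1 : sweepAvg (m + 1) h f v = 𝔼 c, sweepAvg m (by omega) (lineAvg k f) (v₁ c) :=
    (expect_prod_type fun c c' =>
      sweepAvg m (by omega) (lineAvg k f) (upStep k c' (lowStep k c v))).symm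
  have hsub : ∀ c, reach m (v₁ c) ⊆ X := by
    rintro c x ⟨y, hy, hv₁⟩
    obtain ⟨z, hz, hvz⟩ := upStep_supported hX (lowStep_supported hX mem_reach_of_ne_zero _) _ y hv₁
    exact ⟨z, fun i hi => (hz i hi).trans (hy i (by omega)), hvz⟩
  have h2 : ∀ c w, |lineAvg k f (u c w) - E| ≤ numZeroLines k X (fun x => (u c w x).1) + B :=
    fun c w => abs_lineAvg_sub_le hℓ hX hf fun x hx =>
      hsub c (Set.mem_of_indicator_ne_zero hx)
  have h3 : ∀ c, |sweepAvg m (by omega) (lineAvg k f) (v₁ c) - E|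
      ≤ ε + 𝔼 w, (numZeroLines k X (fun x => (u c w x).1) + B) := fun c =>
    (abs_sub_le _ (𝔼 w, lineAvg k f (u c w)) _).trans
      (add_le_add (ih _ (lineAvg_mem_Icc hf k) (v₁ c)) (abs_expect_sub_le (h2 c)))
  rw [h1]
  refine (abs_expect_sub_le h3).trans ?_
  simp only [Finset.expect_add_distrib, Fintype.expect_const]
  rw [← expect_prod_type fun c w => numZeroLines k X (fun x => (u c w x).1)]
  have h4 : B ≤ (ℓ : ℝ) ^ D / ℓ * (1 / 2) ^ ℓ := expect_numZeroLines_uniform_le k X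
  have h5 : 𝔼 p : ((Site D ℓ → ZMod 2) × (Site D ℓ → ZMod 2)) × Lab (Site D ℓ),
      numZeroLines k X (fun x => (u p.1 p.2 x).1)
      ≤ (ℓ : ℝ) ^ D / ℓ * ((1 / 2) ^ ℓ + (3 / 4) ^ ℓ) := by
    refine expect_numZeroLines_le
      (Ω := ((Site D ℓ → ZMod 2) × (Site D ℓ → ZMod 2)) × Lab (Site D ℓ)) k X
      (fun p x => (u p.1 p.2 x).1) (by positivity) ?_
    rintro x ⟨y, hy, hvy⟩
    rw [expect_prod_type fun c w => ∏ q, zeroInd (u c w (Function.update x k q)).1]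
    -- A site of the line through `x` is certainly made random if the label at the corresponding
    -- site of the line through `y` has a non-zero `X` exponent after the first steps.
    let g : ZMod 2 → ZMod 2 → ℝ := fun s t => if s = 0 then 1 else zeroInd t
    have hg : ∀ s t, g s t ∈ Set.Icc (0 : ℝ) 1 := by
      intro s t
      simp only [g]
      split_ifs
      · norm_num
      · exact zeroInd_mem t
    have hgE : ∀ s, 𝔼 t, g s t = if s = 0 then 1 else 1 / 2 := by
      intro s
      rw [expect_zmod_two]
      by_cases hs : s = 0 <;> norm_num [g, hs, zeroInd]
    have hle : ∀ c w q, zeroInd (u c w (Function.update x k q)).1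
        ≤ g (v₁ c (Function.update y k q)).1 (w (Function.update x k q)).1 := by
      intro c w q
      simp only [g]
      split_ifs with hs
      · exact (zeroInd_mem _).2
      · have hmem : Function.update x k q ∈ reach m (v₁ c) := by
          refine ⟨Function.update y k q, fun i hi => ?_, fun e => hs (by rw [e]; rfl)⟩
          by_cases hik : i = k
          · rw [hik, Function.update_self, Function.update_self]
          · rw [Function.update_of_ne hik, Function.update_of_ne hik]
            have : i.val ≠ m + 1 := fun e => hik (Fin.ext e)
            exact hy i (by omega)
        simp only [u, Set.indicator_of_mem hmem, le_refl]
    have hw : ∀ c, 𝔼 w, ∏ q, zeroInd (u c w (Function.update x k q)).1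
        ≤ ∏ q, 𝔼 t, g (v₁ c (Function.update y k q)).1 t := by
      intro c
      refine (Finset.expect_le_expect fun w _ => Finset.prod_le_prod
        (fun q _ => (zeroInd_mem _).1) fun q _ => hle c w q).trans (le_of_eq ?_)
      rw [expect_prod_comp_injective (update_line_injective x k) fun q (s : ZMod 2 × ZMod 2) =>
        g (v₁ c (Function.update y k q)).1 s.1]
      refine Finset.prod_congr rfl fun q _ => ?_
      rw [expect_prod_type fun s (_ : ZMod 2) => g (v₁ c (Function.update y k q)).1 s]
      simp only [Fintype.expect_const]
    refine (Finset.expect_le_expect fun c _ => hw c).trans ?_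
    rw [expect_prod_type fun c c' => ∏ q, 𝔼 t,
      g (upStep k c' (lowStep k c v) (Function.update y k q)).1 t]
    refine (expect_prod_upStep_lowStep_le hvy (g := fun s => 𝔼 t, g s t)
      fun s => expect_mem_Icc (hg s)).trans (le_of_eq ?_)
    simp only [hgE]
    rw [expect_zmod_two]
    norm_num
  have h6 : stepError D ℓ = (ℓ : ℝ) ^ D / ℓ * ((1 / 2) ^ ℓ + (3 / 4) ^ ℓ)
      + (ℓ : ℝ) ^ D / ℓ * (1 / 2) ^ ℓ := by
    unfold stepError; ring
  linarith

lemma abs_sweepAvg_sub_le (hℓ : 0 < ℓ) (m : ℕ) (h : m < D) {f : Lab (Site D ℓ) → ℝ}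
    (hf : ∀ v, f v ∈ Set.Icc (0 : ℝ) 1) (v : Lab (Site D ℓ)) :
    |sweepAvg m h f v - 𝔼 w, f ((reach m v).indicator w)| ≤ (m + 1) * stepError D ℓ := by
  induction m generalizing f v with
  | zero =>
    rw [Nat.cast_zero, zero_add, one_mul]
    exact abs_sweepAvg_zero_sub_le hℓ h hf v
  | succ m ih =>
    refine (abs_sweepAvg_succ_sub_le hℓ h (fun f hf v => ih (by omega) hf v) hf v).trans
      (le_of_eq ?_)
    push_cast; ring

/-- A sweep over all directions makes every non-zero label nearly uniform. -/
lemma abs_sweepAvg_sub_expect_le (hℓ : 0 < ℓ) (m : ℕ) (h : m + 1 = D) {f : Lab (Site D ℓ) → ℝ}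
    (hf : ∀ v, f v ∈ Set.Icc (0 : ℝ) 1) {v : Lab (Site D ℓ)} (hv : v ≠ 0) :
    |sweepAvg m (by omega) f v - 𝔼 w, f w| ≤ D * stepError D ℓ := by
  obtain ⟨y, hy⟩ := Function.ne_iff.mp hv
  have hreach : reach m v = Set.univ := by
    refine Set.eq_univ_of_forall fun x => ⟨y, fun i hi => ?_, hy⟩
    have := i.2
    omega
  have h1 := abs_sweepAvg_sub_le hℓ m (by omega) hf v
  rw [hreach] at h1
  simp only [Set.indicator_univ] at h1
  refine h1.trans (le_of_eq ?_)
  rw [← h]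
  push_cast; ring

end Mixing

/-! ### Designs from mixing ensembles -/

/-- The distribution of `U ω` for uniformly random `ω`. -/
def uniformLaw {X Ω : Type} [MeasurableSpace X] [Fintype Ω] (U : Ω → X) : Measure X :=
  (Fintype.card Ω : ENNReal)⁻¹ • ∑ ω, Measure.dirac (U ω)

lemma isProbabilityMeasure_uniformLaw {X Ω : Type} [MeasurableSpace X] [Fintype Ω] [Nonempty Ω]
    (U : Ω → X) : IsProbabilityMeasure (uniformLaw U) := by
  refine ⟨?_⟩
  simp only [uniformLaw, Measure.smul_apply, Measure.finsetSum_apply, measure_univ,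
    Finset.sum_const, Finset.card_univ, smul_eq_mul, nsmul_eq_mul, mul_one]
  exact ENNReal.inv_mul_cancel (by simp) (by simp)

lemma integral_uniformLaw {X Ω : Type} [MeasurableSpace X] [MeasurableSingletonClass X] [Fintype Ω]
    (U : Ω → X) (F : X → ℂ) : ∫ x, F x ∂(uniformLaw U) = 𝔼 ω, F (U ω) := by
  rw [uniformLaw, integral_smul_measure, integral_finsetSum_measure
    fun ω _ => integrable_dirac enorm_lt_top]
  simp only [integral_dirac]
  rw [Fintype.expect_eq_sum_div_card, ENNReal.toReal_inv, ENNReal.toReal_natCast,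
    Complex.real_smul, div_eq_inv_mul]
  push_cast
  rfl

lemma ae_uniformLaw {X Ω : Type} [MeasurableSpace X] [MeasurableSingletonClass X] [Fintype Ω]
    {U : Ω → X} {p : X → Prop} (h : ∀ ω, p (U ω)) : ∀ᵐ x ∂(uniformLaw U), p x := by
  refine Measure.ae_smul_measure ?_ _
  rw [ae_finsetSum_measure_iff]
  intro ω _
  rw [ae_dirac_eq]
  exact h ω

lemma IsMixing.mul_inv {Ω : Type} [Fintype Ω] [Nonempty Ω] {M : Ω → Equiv.Perm (Lab V)} {ε : ℝ}
    (h : IsMixing (fun ω => M ω) ε) (h0 : ∀ ω, M ω 0 = 0) :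
    IsMixing (fun ω : Ω × Ω => M ω.1 * (M ω.2)⁻¹) ε := by
  intro v hv f hf
  have h1 : 𝔼 ω : Ω × Ω, f ((M ω.1 * (M ω.2)⁻¹) v) = 𝔼 ω', 𝔼 ω, f (M ω ((M ω')⁻¹ v)) :=
    (expect_prod_type fun ω ω' => f (M ω ((M ω')⁻¹ v))).trans (Finset.expect_comm _ _ _)
  rw [h1]
  refine (abs_expect_sub_le (B := fun _ => ε) fun ω' => h _ (fun e => hv ?_) f hf).trans
    (Fintype.expect_const _).le
  rw [Equiv.Perm.inv_eq_iff_eq, h0] at e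
  exact e

/-- A mixing ensemble of Clifford circuits yields a design: the product of one of its circuits and
the inverse of another one mixes the labels in both directions. -/
lemma exists_design_of_isMixing {G : SimpleGraph V} {d : ℕ} {ε : ℝ} (hε : 0 ≤ ε) {Ω : Type}
    [Fintype Ω] [Nonempty Ω] {M : Ω → Equiv.Perm (Lab V)} (hd : ∀ ω, CliffordDepth G d (M ω))
    (hM : IsMixing (fun ω => M ω) ε) :
    ∃ μ : Measure (UGroup (Basis01 V)), IsProbabilityMeasure μ ∧
      (∀ᵐ U ∂μ, HasCircuitDepth G (2 * d + 2) U) ∧ IsMixedQueryDesign μ (2 * ε) := by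
  have h0 : ∀ ω, M ω 0 = 0 := by
    intro ω
    obtain ⟨U, -, hU⟩ := hd ω
    exact hU.map_zero U.2
  have hd2 : ∀ ω : Ω × Ω, CliffordDepth G (2 * d) (M ω.1 * (M ω.2)⁻¹) := by
    intro ω
    rw [two_mul]
    exact (hd ω.1).mul (hd ω.2).inv
  choose C hCd hC using hd2
  have hmix := hM.mul_inv h0
  have hmix' : IsMixing (fun ω : Ω × Ω => (M ω.1 * (M ω.2)⁻¹).symm) ε := by
    intro v hv f hf
    refine Eq.trans_le (congrArg (fun s => |s - _|) ?_) (hmix v hv f hf)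
    exact Fintype.expect_equiv (Equiv.prodComm Ω Ω) _ _ fun ω => rfl
  let U : (Ω × Ω) × Lab V × Lab V → UGroup (Basis01 V) := fun ω =>
    pauliU ω.2.1 * C ω.1 * pauliU ω.2.2
  refine ⟨uniformLaw U, isProbabilityMeasure_uniformLaw U, ae_uniformLaw fun ω => ?_,
    fun A hA O hO hO' => ?_⟩
  · have h := hasCircuitDepth_mul (hasCircuitDepth_mul (hasCircuitDepth_pauliU (G := G) ω.2.1)
      (hCd ω.1)) (hasCircuitDepth_pauliU (G := G) ω.2.2)
    have e : 1 + 2 * d + 1 = 2 * d + 2 := by ring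
    rwa [e] at h
  · rw [integral_uniformLaw]
    have e : 𝔼 ω, A.expect O (U ω)
        = 𝔼 ω, 𝔼 r₁, 𝔼 r₂, A.expect O (pauliU r₁ * C ω * pauliU r₂) := by
      refine (Finset.expect_product' Finset.univ Finset.univ
        fun ω (r : Lab V × Lab V) => A.expect O (pauliU r.1 * C ω * pauliU r.2)).trans ?_
      refine Finset.expect_congr rfl fun ω _ => ?_
      exact Finset.expect_product' Finset.univ Finset.univ
        fun r₁ r₂ => A.expect O (pauliU r₁ * C ω * pauliU r₂)
    rw [e]
    exact norm_expect_sub_integral_haar_le C _ hC hε hmix hmix' A hA O hO hO'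

lemma exists_integral_expect_eq (A : Experiment V)
    {O : Matrix (Basis01 V × Basis01 (Fin A.m)) (Basis01 V × Basis01 (Fin A.m)) ℂ}
    (hO : O.PosSemidef) (hO' : (1 - O).PosSemidef) (μ : Measure (UGroup (Basis01 V)))
    [IsProbabilityMeasure μ] : ∃ r ∈ Set.Icc (0 : ℝ) 1, ∫ U, A.expect O U ∂μ = r := by
  have h := expect_mem_unit A O hO hO'
  have hint : Integrable (fun U => (A.expect O U).re) μ := (integrable_expect A O μ).re
  refine ⟨∫ U, (A.expect O U).re ∂μ, ⟨integral_nonneg fun U => (h U).2.1, ?_⟩, ?_⟩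
  · calc ∫ U, (A.expect O U).re ∂μ ≤ ∫ _U, (1 : ℝ) ∂μ :=
        integral_mono hint (integrable_const _) fun U => (h U).2.2
      _ = 1 := by simp
  · rw [← integral_complex_ofReal]
    exact integral_congr_ae (Filter.Eventually.of_forall fun U => (h U).1)

/-- Every probability measure is a design with error `1`. -/
lemma isMixedQueryDesign_one (μ : Measure (UGroup (Basis01 V))) [IsProbabilityMeasure μ] :
    IsMixedQueryDesign μ 1 := by
  intro A _ O hO hO'
  have := isProbabilityMeasure_haarUnitary (Basis01 V)
  obtain ⟨r, hr, e⟩ := exists_integral_expect_eq A hO hO' μ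
  obtain ⟨s, hs, e'⟩ := exists_integral_expect_eq A hO hO' (haarUnitary (Basis01 V))
  rw [e, e', ← Complex.ofReal_sub, Complex.norm_real]
  exact abs_sub_le_one hr hs

lemma exists_grid_design {D ℓ : ℕ} (hD : 1 ≤ D) (hℓ : 1 ≤ ℓ) :
    ∃ μ : Measure (UGroup (Basis01 (Site D ℓ))), IsProbabilityMeasure μ ∧
      (∀ᵐ U ∂μ, HasCircuitDepth (gridGraph D ℓ) (2 * (2 * D * (4 * ℓ + 2)) + 2) U) ∧
      IsMixedQueryDesign μ (2 * (D * stepError D ℓ)) := by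
  obtain ⟨m, rfl⟩ : ∃ m, m + 1 = D := ⟨D - 1, by omega⟩
  obtain ⟨Ω, _, _, M, hd, hM⟩ := realizes_sweepAvg hℓ m (Nat.lt_succ_self m)
  refine exists_design_of_isMixing ?_ hd fun v hv f hf => ?_
  · unfold stepError
    positivity
  · rw [← hM f v]
    exact abs_sweepAvg_sub_expect_le hℓ m rfl hf hv

/-! ### The error bound -/

/-- The error per site is at most `2 ^ (-ℓ / 3)`, stated without roots. -/
lemma pow_three_le_half_pow {ℓ : ℕ} (hℓ : 6 ≤ ℓ) :
    (2 * (1 / 2 : ℝ) ^ ℓ + (3 / 4) ^ ℓ) ^ 3 ≤ (1 / 2) ^ ℓ := by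
  induction ℓ, hℓ using Nat.le_induction with
  | base => norm_num
  | succ ℓ _ ih =>
    have h1 : 2 * (1 / 2 : ℝ) ^ (ℓ + 1) + (3 / 4) ^ (ℓ + 1)
        ≤ 3 / 4 * (2 * (1 / 2 : ℝ) ^ ℓ + (3 / 4) ^ ℓ) := by
      have : (0 : ℝ) ≤ (1 / 2) ^ ℓ := by positivity
      rw [pow_succ, pow_succ]
      linarith
    calc _ ≤ (3 / 4 * (2 * (1 / 2 : ℝ) ^ ℓ + (3 / 4) ^ ℓ)) ^ 3 :=
          pow_le_pow_left₀ (by positivity) h1 3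
      _ = 27 / 64 * (2 * (1 / 2 : ℝ) ^ ℓ + (3 / 4) ^ ℓ) ^ 3 := by ring
      _ ≤ 1 / 2 * (1 / 2) ^ ℓ := by
          have : (0 : ℝ) ≤ (1 / 2) ^ ℓ := by positivity
          linarith
      _ = (1 / 2) ^ (ℓ + 1) := by ring

/-- The error of the ensemble is small enough, unless the bound to be proved is trivial. -/
lemma one_le_or_stepError_le {D ℓ : ℕ} (hD : 1 ≤ D) (hℓ : 1 ≤ ℓ) :
    1 ≤ 2 * ((ℓ : ℝ) ^ D + 1) * Real.exp (-(ℓ * Real.log 2 / 3)) ∨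
      2 * (D * stepError D ℓ) ≤ 2 * ((ℓ : ℝ) ^ D + 1) * Real.exp (-(ℓ * Real.log 2 / 3)) := by
  set t := Real.exp (-(ℓ * Real.log 2 / 3)) with ht
  have ht0 : 0 < t := Real.exp_pos _
  have ht1 : t ≤ 1 := by
    rw [ht, Real.exp_le_one_iff, neg_nonpos]
    have := Real.log_nonneg (one_le_two (α := ℝ))
    positivity
  have ht3 : t ^ 3 = (1 / 2) ^ ℓ := by
    rw [ht, ← Real.exp_nat_mul]
    have e : ((3 : ℕ) : ℝ) * -(ℓ * Real.log 2 / 3) = ℓ * Real.log (1 / 2) := by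
      rw [one_div, Real.log_inv]
      push_cast; ring
    rw [e, Real.exp_nat_mul, Real.exp_log (by norm_num)]
  have hℓ1 : (1 : ℝ) ≤ ℓ := by exact_mod_cast hℓ
  by_cases h6 : ℓ < 6
  · left
    have h1 : (ℓ : ℝ) ≤ (ℓ : ℝ) ^ D := le_self_pow₀ hℓ1 (by omega)
    have h2 : 1 ≤ (2 * ((ℓ : ℝ) + 1) * t) ^ 3 := by
      rw [mul_pow, ht3]
      interval_cases ℓ <;> norm_num
    have h3 : 1 ≤ 2 * ((ℓ : ℝ) + 1) * t := by
      by_contra h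
      exact absurd (pow_lt_one₀ (by positivity) (not_le.mp h) three_ne_zero) (not_lt.mpr h2)
    refine h3.trans (mul_le_mul_of_nonneg_right ?_ ht0.le)
    linarith
  by_cases hDℓ : ℓ < D
  · left
    have h1 : (2 : ℝ) ^ ℓ ≤ (ℓ : ℝ) ^ D := by
      have h2 : (2 : ℝ) ≤ ℓ := by exact_mod_cast (by omega : 2 ≤ ℓ)
      exact (pow_le_pow_right₀ (by norm_num) hDℓ.le).trans (pow_le_pow_left₀ (by norm_num) h2 D)
    have h2 : (1 / 2 : ℝ) ^ ℓ ≤ t := ht3 ▸ pow_le_of_le_one ht0.le ht1 three_ne_zero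
    have h3 : (2 : ℝ) ^ ℓ * (1 / 2) ^ ℓ = 1 := by
      rw [← mul_pow]
      norm_num
    have h4 : (2 : ℝ) ^ ℓ * (1 / 2) ^ ℓ ≤ (ℓ : ℝ) ^ D * t := mul_le_mul h1 h2 (by positivity)
      (by positivity)
    linarith
  · right
    have h1 : 2 * (1 / 2 : ℝ) ^ ℓ + (3 / 4) ^ ℓ ≤ t := by
      rw [← pow_le_pow_iff_left₀ (by positivity) ht0.le three_ne_zero, ht3]
      exact pow_three_le_half_pow (by omega)
    have h2 : (D : ℝ) * ((ℓ : ℝ) ^ D / ℓ) ≤ (ℓ : ℝ) ^ D := by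
      rw [mul_div_assoc', div_le_iff₀ (by linarith), mul_comm]
      exact mul_le_mul_of_nonneg_left (by exact_mod_cast not_lt.mp hDℓ) (by positivity)
    have h3 : D * stepError D ℓ ≤ (ℓ : ℝ) ^ D * t := by
      unfold stepError
      rw [← mul_assoc]
      exact mul_le_mul h2 h1 (by positivity) (by positivity)
    linarith

end PauliMixing

theorem lemma3 :
    ∃ C : ℝ, 0 < C ∧ ∀ D ℓ n : ℕ, 1 ≤ D → 1 ≤ ℓ → n = ℓ ^ D →
      ∃ d : ℕ, (d : ℝ) ≤ C * (D * (n : ℝ) ^ ((1 : ℝ) / D)) ∧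
        ∃ μ : Measure (UGroup (Basis01 (Fin D → Fin ℓ))),
          IsProbabilityMeasure μ ∧
          (∀ᵐ U ∂μ, HasCircuitDepth (gridGraph D ℓ) d U) ∧
          IsMixedQueryDesign μ
            (2 * ((n : ℝ) + 1) * Real.exp (-((n : ℝ) ^ ((1 : ℝ) / D) * Real.log 2 / 3))) := by
  refine ⟨26, by norm_num, ?_⟩
  rintro D ℓ n hD hℓ rfl
  have hroot : ((ℓ ^ D : ℕ) : ℝ) ^ ((1 : ℝ) / D) = ℓ := by
    rw [Nat.cast_pow, one_div]
    exact Real.pow_rpow_inv_natCast (Nat.cast_nonneg ℓ) (by omega)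
  obtain ⟨μ, hμ, hdepth, hdesign⟩ := PauliMixing.exists_grid_design hD hℓ
  refine ⟨_, ?_, μ, hμ, hdepth, ?_⟩
  · rw [hroot]
    have hD' : (1 : ℝ) ≤ D := by exact_mod_cast hD
    have hℓ' : (1 : ℝ) ≤ ℓ := by exact_mod_cast hℓ
    push_cast
    nlinarith [mul_le_mul hD' hℓ' zero_le_one (zero_le_one.trans hD')]
  · rw [hroot, Nat.cast_pow]
    intro A hA O hO hO'
    rcases PauliMixing.one_le_or_stepError_le hD hℓ with h | h
    · exact (PauliMixing.isMixedQueryDesign_one μ A hA O hO hO').trans h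
    · exact (hdesign A hA O hO hO').trans h
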